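/- Consider the Boiti--Leon--Pempinelli (BLP) system $$u_{ty}=(u^2-u_x)_{xy}+2v_{xxx},\qquad v_t=v_{xx}+2uv_x$$ for smooth real functions $u,v$ of $(t,x,y)$. A \emph{point symmetry} of it is a $C^\infty$ diffeomorphism $\Phi$ between open subsets of the space $\mathbb R^5$ of the variables $(t,x,y,u,v)$ such that, whenever $\Phi$ maps the graph of a smooth pair $(u,v)$ over an open set of points $(t,x,y)$ onto the graph of a smooth pair $(\tilde u,\tilde v)$ over an open set, $(u,v)$ is a solution if and only if $(\tilde u,\tilde v)$ is. Fix $r\in\{0,1,2,\dots,\infty\}$. A point symmetry $\Psi$ with domain $W$ is \emph{continuous} if there is a family $(\Psi_s)_{0\le s\le1}$ of point symmetries with domain $W$, of class $C^r$ jointly in $s$ and in the point of $W$, such that $\Psi_0=\mathrm{id}_W$ and $\Psi_1=\Psi$. A point symmetry is \emph{discrete} if none of its restrictions to nonempty open subsets of its domain is continuous. Let $$\mathscr I\colon(t,x,y,u,v)\mapsto(t,-x,y,-u,v),\qquad \mathscr S\colon(t,x,y,u,v)\mapsto(t,x,-y,u,-v).$$ Then, for every $r$: (1) $\mathscr I$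 and $\mathscr S$ are involutions, and $\mathscr I$, $\mathscr S$ and $\mathscr I\circ\mathscr S$ are discrete point symmetries of the BLP system. (2) For every point symmetry $\Phi$ with nonempty connected domain there is a unique element $\delta$ of the group generated by $\mathscr I$ and $\mathscr S$ such that each point of the domain has an open neighbourhood on which $\Phi=\delta\circ\Psi$ with a continuous point symmetry $\Psi$. (3) If the domain of the point symmetry $\Phi$ is nonempty and convex, there is a unique $\delta$ in this group such that $\Phi=\delta\circ\Psi$ with a continuous point symmetry $\Psi$ on the whole domain. Thus, up to composition with each other and with continuous point symmetries, $\mathscr I$ and $\mathscr S$ form a complete list of independent discrete point symmetries of the BLP system. -/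

import Mathlib

open scoped ContDiff

namespace BLP

/-- The space of independent variables `(t, x, y)`. -/
abbrev Base : Type := ℝ × ℝ × ℝ

/-- The space of dependent variables `(u, v)`. -/
abbrev Fiber : Type := ℝ × ℝ

/-- The space of all variables `((t, x, y), (u, v))`. -/
abbrev Total : Type := Base × Fiber

noncomputable section

/-- Partial derivative with respect to `t`. -/
def dt (g : Base → ℝ) : Base → ℝ := fun p => fderiv ℝ g p (1, 0, 0)

/-- Partial derivative with respect to `x`. -/
def dx (g : Base → ℝ) : Base → ℝ := fun p => fderiv ℝ g p (0, 1, 0)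

/-- Partial derivative with respect to `y`. -/
def dy (g : Base → ℝ) : Base → ℝ := fun p => fderiv ℝ g p (0, 0, 1)

/-- `f = (u, v)` is a smooth solution on `Ω` of the Boiti–Leon–Pempinelli system
`u_ty = (u² - u_x)_xy + 2 v_xxx`, `v_t = v_xx + 2 u v_x`. It is used for open `Ω` only. -/
structure IsSolutionOn (f : Base → Fiber) (Ω : Set Base) : Prop where
  smooth : ContDiffOn ℝ ∞ f Ω
  eq_u : ∀ p ∈ Ω,
    dy (dt fun q => (f q).1) p =
      dy (dx fun q => (f q).1 ^ 2 - dx (fun q' => (f q').1) q) p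
        + 2 * dx (dx (dx fun q => (f q).2)) p
  eq_v : ∀ p ∈ Ω,
    dt (fun q => (f q).2) p =
      dx (dx fun q => (f q).2) p + 2 * (f p).1 * dx (fun q => (f q).2) p

/-- The graph of `f` over `Ω`. -/
def graphOver (f : Base → Fiber) (Ω : Set Base) : Set Total := (fun p => (p, f p)) '' Ω

/-- A (local) point symmetry of the BLP system: a diffeomorphism `Φ` between open subsets of the
space of all variables such that, whenever `Φ` maps the graph of a smooth function `f` of `(t, x, y)`
onto the graph of a smooth function `g`, `f` is a solution if and only if `g` is. -/
structure IsPointSymmetry (Φ : OpenPartialHomeomorph Total Total) : Prop where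
  smooth : ContDiffOn ℝ ∞ Φ Φ.source
  smooth_symm : ContDiffOn ℝ ∞ Φ.symm Φ.target
  solution_iff : ∀ (Ω Ω' : Set Base) (f g : Base → Fiber), IsOpen Ω → IsOpen Ω' →
    ContDiffOn ℝ ∞ f Ω → ContDiffOn ℝ ∞ g Ω' →
    graphOver f Ω ⊆ Φ.source → Φ '' graphOver f Ω = graphOver g Ω' →
    (IsSolutionOn f Ω ↔ IsSolutionOn g Ω')

/-- A continuous point symmetry: one joined to the identity, within the point symmetries with the
same domain, by a path `F s`, `0 ≤ s ≤ 1`, that is `C^r` jointly in `s` and in the variables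
(`r = 0` means jointly continuous). -/
def IsContinuousPointSymmetry (r : ℕ∞) (Ψ : OpenPartialHomeomorph Total Total) : Prop :=
  ∃ F : ℝ → OpenPartialHomeomorph Total Total,
    (∀ s ∈ Set.Icc (0 : ℝ) 1, IsPointSymmetry (F s) ∧ (F s).source = Ψ.source) ∧
    Set.EqOn (F 0) id Ψ.source ∧
    Set.EqOn (F 1) Ψ Ψ.source ∧
    ContDiffOn ℝ r (fun q : ℝ × Total => F q.1 q.2) (Set.Icc (0 : ℝ) 1 ×ˢ Ψ.source)

/-- A discrete point symmetry: a point symmetry no restriction of which to a nonempty open subset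
of its domain is a continuous point symmetry. -/
def IsDiscretePointSymmetry (r : ℕ∞) (Φ : OpenPartialHomeomorph Total Total) : Prop :=
  IsPointSymmetry Φ ∧
    ∀ W : Set Total, IsOpen W → (Φ.source ∩ W).Nonempty →
      ¬ IsContinuousPointSymmetry r (Φ.restr W)

/-- The map `(t, x, y, u, v) ↦ (t, -x, y, -u, v)`. -/
def reflX : Total ≃ₜ Total where
  toFun z := ((z.1.1, -z.1.2.1, z.1.2.2), (-z.2.1, z.2.2))
  invFun z := ((z.1.1, -z.1.2.1, z.1.2.2), (-z.2.1, z.2.2))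
  left_inv z := by simp
  right_inv z := by simp
  continuous_toFun := by fun_prop
  continuous_invFun := by fun_prop

/-- The map `(t, x, y, u, v) ↦ (t, x, -y, u, -v)`. -/
def reflY : Total ≃ₜ Total where
  toFun z := ((z.1.1, z.1.2.1, -z.1.2.2), (z.2.1, -z.2.2))
  invFun z := ((z.1.1, z.1.2.1, -z.1.2.2), (z.2.1, -z.2.2))
  left_inv z := by simp
  right_inv z := by simp
  continuous_toFun := by fun_prop
  continuous_invFun := by fun_prop

end

end BLP

/-! The theorem follows from a complete local description of the point symmetries. Each has, near
any point of its domain, the form t̃ = T(t), x̃ = S(t)x + X(t), ỹ = Y(y), ũ = (u − x̃_t/(2S))/S, ṽ =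
v/Y'(y) + V(y), with S² = T' and with S and Y' nowhere zero; conversely every diffeomorphism with
such differentials and such ũ is a point symmetry (`IsPointSymmetry.normalAt`,
`isPointSymmetry_of_normalAt`). The only discrete data are the signs of S = x̃_x and of Y' = ỹ_y,
and `reflX` and `reflY` flip exactly these two.

Necessity is obtained by testing a symmetry on explicit solutions, without infinitesimal generators
or prolongations. Imposing u_y = v_x makes the first equation a consequence of the second and gives
solutions depending on arbitrary functions ψ(t,x), c(y), d(y). They realize every first jet at a
point with u_y = v_x ≠ 0, and five further parameters move the second derivatives with the first jet
fixed (`exists_solutions_with_jet`). Some such jet is transversal to the fibres after the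
transformation, so its graph is carried to the graph of a solution. In the second equation for the
image, variation of the second derivatives forces a triangular differential
(`IsPointSymmetry.triangular`); variation of the first derivatives gives x̃_x² = t̃_t, ỹ_t = 0, the
formula for ũ, and ṽ = ṽ(y,v), affine in v (`coords_first`, `coords_poly`, `coords_second`). The
first equation, B_y = 2v_xxx with B = u_t − (u² − u_x)_x, then yields t̃_y = x̃_y = 0 (`coords_y`)
and ỹ_y ṽ_v = 1 (`dv_mul_dy`).

Along a continuous path from the identity, x̃_x and ỹ_y cannot vanish and hence stay positive
(`IsContinuousPointSymmetry.dd_pos`); this gives discreteness and uniqueness. For existence,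
composition with a suitable reflection makes both positive. On a convex domain the functions T, S,
X, Y, V are then globally defined, and interpolating T, X, Y and V linearly with those of the
identity, with S = √T', gives the path (`IsPointSymmetry.isContinuous`). Balls are convex, which
settles the local statement on connected domains. -/

namespace BLP

/-! ### Directional derivatives -/

section Calculus

variable {E F G : Type*} [NormedAddCommGroup E] [NormedSpace ℝ E]
  [NormedAddCommGroup F] [NormedSpace ℝ F] [NormedAddCommGroup G] [NormedSpace ℝ G]

/-- The derivative of `g` in the direction `e`. -/
noncomputable def dd (e : E) (g : E → F) : E → F := fun p => fderiv ℝ g p e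

theorem dd_congr {Ω : Set E} (hΩ : IsOpen Ω) {g h : E → F} (hgh : Set.EqOn g h Ω) {p : E}
    (hp : p ∈ Ω) (e : E) : dd e g p = dd e h p := by
  unfold dd
  rw [Filter.EventuallyEq.fderiv_eq (hgh.eventuallyEq_of_mem (hΩ.mem_nhds hp))]

theorem contDiffOn_dd {Ω : Set E} (hΩ : IsOpen Ω) {g : E → F} (hg : ContDiffOn ℝ ∞ g Ω) (e : E) :
    ContDiffOn ℝ ∞ (dd e g) Ω :=
  (hg.fderiv_of_isOpen hΩ (m := ∞) (by simp)).clm_apply contDiffOn_const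

theorem contDiffAt_of_open {Ω : Set E} (hΩ : IsOpen Ω) {g : E → F} (hg : ContDiffOn ℝ ∞ g Ω)
    {p : E} (hp : p ∈ Ω) : ContDiffAt ℝ ∞ g p := hg.contDiffAt (hΩ.mem_nhds hp)

theorem differentiableAt_of_open {Ω : Set E} (hΩ : IsOpen Ω) {g : E → F}
    (hg : ContDiffOn ℝ ∞ g Ω) {p : E} (hp : p ∈ Ω) : DifferentiableAt ℝ g p :=
  (contDiffAt_of_open hΩ hg hp).differentiableAt (by simp)

theorem contDiffAt_fderiv {g : E → F} {p : E} (hg : ContDiffAt ℝ ∞ g p) :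
    ContDiffAt ℝ ∞ (fderiv ℝ g) p := hg.fderiv_right (by simp)

theorem differentiableAt_fderiv {g : E → F} {p : E} (hg : ContDiffAt ℝ ∞ g p) :
    DifferentiableAt ℝ (fderiv ℝ g) p := (contDiffAt_fderiv hg).differentiableAt (by simp)

theorem dd_dd_eq {g : E → F} {p : E} (hg : ContDiffAt ℝ ∞ g p) (e e' : E) :
    dd e (dd e' g) p = fderiv ℝ (fderiv ℝ g) p e e' := by
  have : HasFDerivAt (fun q => fderiv ℝ g q e') _ p :=
    (differentiableAt_fderiv hg).hasFDerivAt.clm_apply (hasFDerivAt_const e' p)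
  unfold dd
  rw [this.fderiv]
  simp

theorem snd_fderiv_symm {g : E → F} {p : E} (hg : ContDiffAt ℝ ∞ g p) (e e' : E) :
    fderiv ℝ (fderiv ℝ g) p e e' = fderiv ℝ (fderiv ℝ g) p e' e :=
  hg.isSymmSndFDerivAt (by
    rw [minSmoothness_of_isRCLikeNormedField]; exact WithTop.coe_le_coe.2 (le_top : (2 : ℕ∞) ≤ ⊤)) e e'

theorem dd_comm {Ω : Set E} (hΩ : IsOpen Ω) {g : E → F} (hg : ContDiffOn ℝ ∞ g Ω) {p : E}
    (hp : p ∈ Ω) (e e' : E) : dd e (dd e' g) p = dd e' (dd e g) p := by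
  have h := contDiffAt_of_open hΩ hg hp
  rw [dd_dd_eq h, dd_dd_eq h, snd_fderiv_symm h]

theorem dd_comp {g : F → G} {a : E → F} {p : E} (hg : DifferentiableAt ℝ g (a p))
    (ha : DifferentiableAt ℝ a p) (e : E) :
    dd e (fun q => g (a q)) p = fderiv ℝ g (a p) (dd e a p) := by
  unfold dd
  rw [show (fun q => g (a q)) = g ∘ a from rfl, fderiv_comp p hg ha]
  rfl

theorem fderiv_fderiv_comp {g : F → G} {a : E → F} {p : E} (hg : ContDiffAt ℝ ∞ g (a p))
    (ha : ContDiffAt ℝ ∞ a p) (e e' : E) :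
    fderiv ℝ (fderiv ℝ (fun q => g (a q))) p e e' =
      fderiv ℝ (fderiv ℝ g) (a p) (fderiv ℝ a p e) (fderiv ℝ a p e')
        + fderiv ℝ g (a p) (fderiv ℝ (fderiv ℝ a) p e e') := by
  have h1 : (fderiv ℝ (fun q => g (a q))) =ᶠ[nhds p] fun q => (fderiv ℝ g (a q)).comp (fderiv ℝ a q) := by
    have hg' : ∀ᶠ q in nhds p, ContDiffAt ℝ 1 g (a q) :=
      ha.continuousAt.eventually ((hg.of_le (by simp)).eventually (by simp))
    have ha' : ∀ᶠ q in nhds p, ContDiffAt ℝ 1 a q := (ha.of_le (by simp)).eventually (by simp)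
    filter_upwards [hg', ha'] with q h h'
    exact fderiv_comp q (h.differentiableAt (by simp)) (h'.differentiableAt (by simp))
  rw [h1.fderiv_eq]
  have h2 : HasFDerivAt (fun q => fderiv ℝ g (a q)) _ p :=
    (differentiableAt_fderiv hg).hasFDerivAt.comp p (ha.differentiableAt (by simp)).hasFDerivAt
  have h3 := h2.clm_comp (differentiableAt_fderiv ha).hasFDerivAt
  rw [h3.fderiv]
  simp [add_comm]

section Scalar

variable {g h : E → ℝ} {p : E} (e : E)

theorem dd_const (c : F) : dd e (fun _ : E => c) p = 0 := by simp [dd]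

theorem dd_add (hg : DifferentiableAt ℝ g p) (hh : DifferentiableAt ℝ h p) :
    dd e (fun q => g q + h q) p = dd e g p + dd e h p := by
  simp [dd, fderiv_fun_add hg hh]

theorem dd_sub (hg : DifferentiableAt ℝ g p) (hh : DifferentiableAt ℝ h p) :
    dd e (fun q => g q - h q) p = dd e g p - dd e h p := by
  simp [dd, fderiv_fun_sub hg hh]

theorem dd_mul (hg : DifferentiableAt ℝ g p) (hh : DifferentiableAt ℝ h p) :
    dd e (fun q => g q * h q) p = dd e g p * h p + g p * dd e h p := by
  simp [dd, fderiv_fun_mul hg hh]; ring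

theorem dd_const_mul (hg : DifferentiableAt ℝ g p) (c : ℝ) :
    dd e (fun q => c * g q) p = c * dd e g p := by
  simp [dd, fderiv_const_mul hg]

theorem dd_pow (hg : DifferentiableAt ℝ g p) (n : ℕ) :
    dd e (fun q => g q ^ n) p = n * g p ^ (n - 1) * dd e g p := by
  simp [dd, fderiv_fun_pow n hg]

theorem dd_inv (hg : DifferentiableAt ℝ g p) (h0 : g p ≠ 0) :
    dd e (fun q => (g q)⁻¹) p = - dd e g p / g p ^ 2 := by
  have := ((hasDerivAt_inv h0).comp_hasFDerivAt p hg.hasFDerivAt)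
  unfold dd
  rw [show (fun q => (g q)⁻¹) = Inv.inv ∘ g from rfl, this.fderiv]
  simp; ring

theorem dd_eq_deriv {p : E} {g' : F} {g : E → F} (hg : DifferentiableAt ℝ g p)
    (h : HasDerivAt (fun s : ℝ => g (p + s • e)) g' 0) : dd e g p = g' := by
  have h1 : HasDerivAt (fun s : ℝ => p + s • e) e 0 := by
    simpa using ((hasDerivAt_id (0 : ℝ)).smul_const e).const_add p
  have h2 : HasFDerivAt g (fderiv ℝ g p) (p + (0 : ℝ) • e) := by simpa using hg.hasFDerivAt
  exact (h2.comp_hasDerivAt (0 : ℝ) h1).unique h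

end Scalar

end Calculus

theorem dt_eq (g : Base → ℝ) : dt g = dd (1, 0, 0) g := rfl
theorem dx_eq (g : Base → ℝ) : dx g = dd (0, 1, 0) g := rfl
theorem dy_eq (g : Base → ℝ) : dy g = dd (0, 0, 1) g := rfl

end BLP

/-! ### Explicit solutions with u_y = v_x -/

namespace BLP

theorem contDiffOn_dt {Ω : Set Base} (hΩ : IsOpen Ω) {g : Base → ℝ} (hg : ContDiffOn ℝ ∞ g Ω) :
    ContDiffOn ℝ ∞ (dt g) Ω := contDiffOn_dd hΩ hg _
theorem contDiffOn_dx {Ω : Set Base} (hΩ : IsOpen Ω) {g : Base → ℝ} (hg : ContDiffOn ℝ ∞ g Ω) :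
    ContDiffOn ℝ ∞ (dx g) Ω := contDiffOn_dd hΩ hg _
theorem contDiffOn_dy {Ω : Set Base} (hΩ : IsOpen Ω) {g : Base → ℝ} (hg : ContDiffOn ℝ ∞ g Ω) :
    ContDiffOn ℝ ∞ (dy g) Ω := contDiffOn_dd hΩ hg _

/-- If `u_y = v_x`, the first equation of the system follows from the second one. -/
theorem IsSolutionOn.of_dy_eq_dx {f : Base → Fiber} {Ω : Set Base} (hΩ : IsOpen Ω)
    (hf : ContDiffOn ℝ ∞ f Ω)
    (hyx : ∀ p ∈ Ω, dy (fun q => (f q).1) p = dx (fun q => (f q).2) p)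
    (hv : ∀ p ∈ Ω, dt (fun q => (f q).2) p =
      dx (dx fun q => (f q).2) p + 2 * (f p).1 * dx (fun q => (f q).2) p) :
    IsSolutionOn f Ω := by
  refine ⟨hf, fun p hp => ?_, hv⟩
  have hfu : ContDiffOn ℝ ∞ (fun q => (f q).1) Ω := hf.fst
  have hfv : ContDiffOn ℝ ∞ (fun q => (f q).2) Ω := hf.snd
  generalize hu : (fun q => (f q).1) = u at *
  generalize hw : (fun q => (f q).2) = v at *
  have hu' : ∀ q, (f q).1 = u q := fun q => congrFun hu q
  simp only [hu'] at *
  have D : ∀ {g : Base → ℝ}, ContDiffOn ℝ ∞ g Ω → ∀ q ∈ Ω, DifferentiableAt ℝ g q :=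
    fun hg q hq => differentiableAt_of_open hΩ hg hq
  have hvx := contDiffOn_dx hΩ hfv
  have hvxx := contDiffOn_dx hΩ hvx
  have hux := contDiffOn_dx hΩ hfu
  -- u_ty = v_xt after commuting derivatives, and v_t is then replaced by means of the second
  -- equation.
  have e1 : dy (dt u) p = dx (dx (dx v)) p + 2 * (dx u p * dx v p + u p * dx (dx v) p) := by
    calc dy (dt u) p = dt (dy u) p := dd_comm hΩ hfu hp _ _
      _ = dt (dx v) p := dd_congr hΩ hyx hp _
      _ = dx (dt v) p := dd_comm hΩ hfv hp _ _
      _ = dx (fun q => dx (dx v) q + 2 * u q * dx v q) p := dd_congr hΩ hv hp _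
      _ = _ := by
        simp only [dx_eq] at *
        rw [dd_add _ (D hvxx p hp) (((D hfu p hp).const_mul 2).fun_mul (D hvx p hp)),
          dd_mul _ ((D hfu p hp).const_mul 2) (D hvx p hp), dd_const_mul _ (D hfu p hp)]
        ring
  have e2 : dy (dx fun q => u q ^ 2 - dx u q) p =
      2 * (dx u p * dx v p + u p * dx (dx v) p) - dx (dx (dx v)) p := by
    calc dy (dx fun q => u q ^ 2 - dx u q) p = dx (dy fun q => u q ^ 2 - dx u q) p :=
          dd_comm hΩ ((hfu.pow 2).sub hux) hp _ _
      _ = dx (fun q => 2 * u q * dx v q - dx (dx v) q) p := by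
          refine dd_congr hΩ (fun q hq => ?_) hp _
          have h1 : dy (dx u) q = dx (dx v) q :=
            (dd_comm hΩ hfu hq _ _).trans (dd_congr hΩ hyx hq _)
          have h2 := hyx q hq
          simp only [dx_eq, dy_eq] at *
          rw [dd_sub _ ((D hfu q hq).fun_pow 2) (D hux q hq), dd_pow _ (D hfu q hq), h1, h2]
          norm_num
      _ = _ := by
        simp only [dx_eq] at *
        rw [dd_sub _ (((D hfu p hp).const_mul 2).fun_mul (D hvx p hp)) (D hvxx p hp),
          dd_mul _ ((D hfu p hp).const_mul 2) (D hvx p hp), dd_const_mul _ (D hfu p hp)]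
        ring
  rw [e1, e2]; ring

theorem dt_of_hasDerivAt {g : Base → ℝ} {p : Base} {g' : ℝ} (hg : DifferentiableAt ℝ g p)
    (h : HasDerivAt (fun s => g (s, p.2.1, p.2.2)) g' p.1) : dt g p = g' := by
  have h1 : HasDerivAt (fun s : ℝ => ((s, p.2.1, p.2.2) : Base)) (1, 0, 0) p.1 :=
    (hasDerivAt_id _).prodMk ((hasDerivAt_const _ _).prodMk (hasDerivAt_const _ _))
  exact (HasFDerivAt.comp_hasDerivAt (f := fun s : ℝ => ((s, p.2.1, p.2.2) : Base)) p.1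
    (l := g) hg.hasFDerivAt h1).unique h

theorem dx_of_hasDerivAt {g : Base → ℝ} {p : Base} {g' : ℝ} (hg : DifferentiableAt ℝ g p)
    (h : HasDerivAt (fun s => g (p.1, s, p.2.2)) g' p.2.1) : dx g p = g' := by
  have h1 : HasDerivAt (fun s : ℝ => ((p.1, s, p.2.2) : Base)) (0, 1, 0) p.2.1 :=
    (hasDerivAt_const _ _).prodMk ((hasDerivAt_id _).prodMk (hasDerivAt_const _ _))
  exact (HasFDerivAt.comp_hasDerivAt (f := fun s : ℝ => ((p.1, s, p.2.2) : Base)) p.2.1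
    (l := g) hg.hasFDerivAt h1).unique h

theorem dy_of_hasDerivAt {g : Base → ℝ} {p : Base} {g' : ℝ} (hg : DifferentiableAt ℝ g p)
    (h : HasDerivAt (fun s => g (p.1, p.2.1, s)) g' p.2.2) : dy g p = g' := by
  have h1 : HasDerivAt (fun s : ℝ => ((p.1, p.2.1, s) : Base)) (0, 0, 1) p.2.2 :=
    (hasDerivAt_const _ _).prodMk ((hasDerivAt_const _ _).prodMk (hasDerivAt_id _))
  exact (HasFDerivAt.comp_hasDerivAt (f := fun s : ℝ => ((p.1, p.2.1, s) : Base)) p.2.2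
    (l := g) hg.hasFDerivAt h1).unique h

/-- A family of solutions parametrized by arbitrary functions `ψ(t, x)`, `c(y)` and `d(y)`. -/
theorem isSolutionOn_of_potential {ψ ψt ψx ψxx : ℝ → ℝ → ℝ} {c c' d : ℝ → ℝ}
    (sψ : ContDiff ℝ ∞ fun p : Base => ψ p.1 p.2.1) (sψt : ContDiff ℝ ∞ fun p : Base => ψt p.1 p.2.1)
    (sψx : ContDiff ℝ ∞ fun p : Base => ψx p.1 p.2.1)
    (sψxx : ContDiff ℝ ∞ fun p : Base => ψxx p.1 p.2.1)
    (sc : ContDiff ℝ ∞ fun p : Base => c p.2.2) (sc' : ContDiff ℝ ∞ fun p : Base => c' p.2.2)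
    (sd : ContDiff ℝ ∞ fun p : Base => d p.2.2)
    (hψt : ∀ t x, HasDerivAt (fun s => ψ s x) (ψt t x) t)
    (hψx : ∀ t x, HasDerivAt (fun s => ψ t s) (ψx t x) x)
    (hψxx : ∀ t x, HasDerivAt (fun s => ψx t s) (ψxx t x) x)
    (hc : ∀ y, HasDerivAt c (c' y) y) {Ω : Set Base} (hΩ : IsOpen Ω)
    (h0 : ∀ p ∈ Ω, ψx p.1 p.2.1 ≠ 0) (h1 : ∀ p ∈ Ω, ψ p.1 p.2.1 + c p.2.2 ≠ 0) :
    IsSolutionOn (fun p => ((ψt p.1 p.2.1 - ψxx p.1 p.2.1) / (2 * ψx p.1 p.2.1)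
      + ψx p.1 p.2.1 / (ψ p.1 p.2.1 + c p.2.2), c' p.2.2 / (ψ p.1 p.2.1 + c p.2.2) + d p.2.2)) Ω := by
  have su : ContDiffOn ℝ ∞ (fun p : Base => (ψt p.1 p.2.1 - ψxx p.1 p.2.1) / (2 * ψx p.1 p.2.1)
      + ψx p.1 p.2.1 / (ψ p.1 p.2.1 + c p.2.2)) Ω :=
    ((sψt.sub sψxx).contDiffOn.div (contDiff_const.mul sψx).contDiffOn
      fun p hp => mul_ne_zero two_ne_zero (h0 p hp)).add
      (sψx.contDiffOn.div (sψ.add sc).contDiffOn h1)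
  have sv : ContDiffOn ℝ ∞ (fun p : Base => c' p.2.2 / (ψ p.1 p.2.1 + c p.2.2) + d p.2.2) Ω :=
    (sc'.contDiffOn.div (sψ.add sc).contDiffOn h1).add sd.contDiffOn
  have vx : ∀ p ∈ Ω, dx (fun p : Base => c' p.2.2 / (ψ p.1 p.2.1 + c p.2.2) + d p.2.2) p =
      - c' p.2.2 * ψx p.1 p.2.1 / (ψ p.1 p.2.1 + c p.2.2) ^ 2 := by
    intro p hp
    refine dx_of_hasDerivAt (differentiableAt_of_open hΩ sv hp) ?_
    dsimp only
    refine (((hasDerivAt_const _ _).fun_div ((hψx _ _).add_const _) (h1 p hp)).add_const _).congr_deriv ?_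
    simp
  have svx : ContDiffOn ℝ ∞ (fun p : Base => - c' p.2.2 * ψx p.1 p.2.1 /
      (ψ p.1 p.2.1 + c p.2.2) ^ 2) Ω :=
    (sc'.neg.mul sψx).contDiffOn.div ((sψ.add sc).pow 2).contDiffOn fun p hp => pow_ne_zero 2 (h1 p hp)
  -- Both u_y and v_x equal −c'ψ_x/(ψ + c)². The summand (ψ_t − ψ_xx)/(2ψ_x) of u is what the second
  -- equation requires once ψ_x/(ψ + c) has absorbed the quadratic term of v_xx.
  refine IsSolutionOn.of_dy_eq_dx hΩ (su.prodMk sv) (fun p hp => ?_) (fun p hp => ?_)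
  · simp only
    rw [vx p hp]
    refine dy_of_hasDerivAt (differentiableAt_of_open hΩ su hp) ?_
    dsimp only
    refine ((((hasDerivAt_const _ _).fun_div ((hc _).const_add _) (h1 p hp))).const_add _).congr_deriv ?_
    simp; ring
  · have e1 : dt (fun p : Base => c' p.2.2 / (ψ p.1 p.2.1 + c p.2.2) + d p.2.2) p =
        - c' p.2.2 * ψt p.1 p.2.1 / (ψ p.1 p.2.1 + c p.2.2) ^ 2 := by
      refine dt_of_hasDerivAt (differentiableAt_of_open hΩ sv hp) ?_
      dsimp only
      refine (((hasDerivAt_const _ _).fun_div ((hψt _ _).add_const _) (h1 p hp)).add_const _).congr_deriv ?_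
      simp
    have e2 : dx (dx (fun p : Base => c' p.2.2 / (ψ p.1 p.2.1 + c p.2.2) + d p.2.2)) p =
        - c' p.2.2 * ψxx p.1 p.2.1 / (ψ p.1 p.2.1 + c p.2.2) ^ 2
          + 2 * c' p.2.2 * ψx p.1 p.2.1 ^ 2 / (ψ p.1 p.2.1 + c p.2.2) ^ 3 := by
      rw [dx_eq, dd_congr hΩ vx hp, ← dx_eq]
      refine dx_of_hasDerivAt (differentiableAt_of_open hΩ svx hp) ?_
      dsimp only
      refine (((hψxx _ _).const_mul _).fun_div (((hψx _ _).add_const _).fun_pow 2)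
        (pow_ne_zero 2 (h1 p hp))).congr_deriv ?_
      have := h1 p hp
      simp
      field_simp
    simp only
    rw [e1, e2, vx p hp]
    have := h1 p hp
    have := h0 p hp
    field_simp
    ring

/-- With v constant and u_y = 0 both equations are trivial, so u may be any smooth function of t and
x. These solutions later test the first equation without its v-term. -/
theorem isSolutionOn_of_separated {u : Base → ℝ} (hu : ContDiff ℝ ∞ u)
    (huy : ∀ p, dy u p = 0) (v0 : ℝ) (Ω : Set Base) :
    IsSolutionOn (fun p => (u p, v0)) Ω := by
  have hΩ : IsOpen (Set.univ : Set Base) := isOpen_univ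
  have hu' : ContDiffOn ℝ ∞ u Set.univ := hu.contDiffOn
  have z : ∀ g : Base → ℝ, (∀ p, g p = 0) → ∀ (e p : Base), dd e g p = 0 := by
    intro g hg e p
    rw [show g = fun _ => 0 from funext hg, dd_const]
  have := IsSolutionOn.of_dy_eq_dx hΩ (f := fun p => (u p, v0)) (hu.prodMk contDiff_const).contDiffOn
    (fun p _ => by simp only; rw [huy, dx_eq, dd_const])
    (fun p _ => by
      simp only
      rw [dt_eq, dx_eq, dx_eq, dd_const, dd_const, z _ (fun p => dd_const _ _)]; simp)
  exact ⟨this.smooth.mono (Set.subset_univ _), fun p _ => this.eq_u p trivial,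
    fun p _ => this.eq_v p trivial⟩

end BLP

/-! ### Solutions with prescribed first jet and variable second derivatives -/

namespace BLP

/-- The second derivative of `h` in the direction `e` is twice the quadratic Taylor coefficient
along the line. It is used for the difference of two solutions with the same first jet. -/
theorem fderiv_fderiv_eq_of_line {E F : Type*} [NormedAddCommGroup E] [NormedSpace ℝ E]
    [NormedAddCommGroup F] [NormedSpace ℝ F] {h : E → F} {p e : E} (hh : ContDiffAt ℝ ∞ h p)
    {R : ℝ → F} (hR : ContDiffAt ℝ ∞ R 0)
    (hs : ∀ᶠ s in nhds (0 : ℝ), h (p + s • e) = s ^ 2 • R s) :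
    fderiv ℝ (fderiv ℝ h) p e e = (2 : ℝ) • R 0 := by
  have ha : ContDiff ℝ ∞ (fun s : ℝ => p + s • e) := by fun_prop
  have ha' : ∀ s : ℝ, HasDerivAt (fun s : ℝ => p + s • e) e s := fun s => by
    simpa using ((hasDerivAt_id s).smul_const e).const_add p
  have hf : fderiv ℝ (fun s : ℝ => p + s • e) = fun _ => ContinuousLinearMap.toSpanSingleton ℝ e :=
    funext fun s => (ha' s).hasFDerivAt.fderiv
  have h1 := fderiv_fderiv_comp (g := h) (a := fun s : ℝ => p + s • e) (p := (0 : ℝ))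
    (by simpa using hh) ha.contDiffAt 1 1
  rw [hf] at h1
  simp only [zero_smul, add_zero, ContinuousLinearMap.toSpanSingleton_apply, one_smul,
    fderiv_fun_const, Pi.zero_apply, zero_apply, map_zero] at h1
  rw [← h1]
  have h2 : (fun s : ℝ => h (p + s • e)) =ᶠ[nhds 0] fun s => s ^ 2 • R s := hs
  have h4 : ∀ᶠ s in nhds (0 : ℝ), ContDiffAt ℝ 1 R s := (hR.of_le (by simp)).eventually (by simp)
  have h3 : fderiv ℝ (fun s : ℝ => h (p + s • e)) =ᶠ[nhds 0]
      fun s => ContinuousLinearMap.toSpanSingleton ℝ (s ^ 2 • deriv R s + (2 * s) • R s) := by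
    filter_upwards [h2.eventuallyEq_nhds, h4] with s h5 h6
    rw [h5.fderiv_eq]
    have := ((hasDerivAt_id s).fun_pow 2).fun_smul (h6.differentiableAt (by simp)).hasDerivAt
    simp only [id] at this
    rw [this.hasFDerivAt.fderiv]
    simp
  have hdR : DifferentiableAt ℝ (deriv R) 0 := by
    have : deriv R = fun s => fderiv ℝ R s 1 := by ext s; simp
    rw [this]
    exact (differentiableAt_fderiv hR).clm_apply (differentiableAt_const _)
  have h7 : HasDerivAt (fun s : ℝ => s ^ 2 • deriv R s + (2 * s) • R s) ((2 : ℝ) • R 0) 0 := by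
    refine ((((hasDerivAt_id (0 : ℝ)).fun_pow 2).fun_smul hdR.hasDerivAt).fun_add
      (((hasDerivAt_id (0 : ℝ)).const_mul 2).fun_smul
        (hR.differentiableAt (by simp)).hasDerivAt)).congr_deriv ?_
    simp
  rw [h3.fderiv_eq]
  have h8 := (ContinuousLinearMap.toSpanSingletonCLE (𝕜 := ℝ) (E := F) :
    F →L[ℝ] (ℝ →L[ℝ] F)).hasFDerivAt.comp_hasDerivAt (0 : ℝ) h7
  have h9 : fderiv ℝ (fun s : ℝ =>
      ContinuousLinearMap.toSpanSingleton ℝ (s ^ 2 • deriv R s + (2 * s) • R s)) 0 =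
      ContinuousLinearMap.toSpanSingleton ℝ (ContinuousLinearMap.toSpanSingleton ℝ ((2 : ℝ) • R 0)) :=
    h8.hasFDerivAt.fderiv
  rw [h9]
  simp

theorem fderiv_base (g : Base → ℝ) (p e : Base) :
    fderiv ℝ g p e = e.1 * dt g p + e.2.1 * dx g p + e.2.2 * dy g p := by
  have : e = e.1 • ((1, 0, 0) : Base) + e.2.1 • ((0, 1, 0) : Base) + e.2.2 • ((0, 0, 1) : Base) := by
    simp
  conv_lhs => rw [this]
  simp only [map_add, map_smul, smul_eq_mul]
  rfl

theorem hasDerivAt_div_add_div {N W Q : ℝ → ℝ} {N' W' Q' s : ℝ} (hN : HasDerivAt N N' s)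
    (hW : HasDerivAt W W' s) (hQ : HasDerivAt Q Q' s) (hW0 : W s ≠ 0) (hQ0 : Q s ≠ 0) :
    HasDerivAt (fun s => N s / (2 * W s) + W s / Q s)
      (N' / (2 * W s) - N s * W' / (2 * W s ^ 2) + W' / Q s - W s * Q' / Q s ^ 2) s := by
  refine ((hN.fun_div (hW.const_mul 2) (mul_ne_zero two_ne_zero hW0)).fun_add
    (hW.fun_div hQ hQ0)).congr_deriv ?_
  field_simp
  ring

section Jets

/-- Parameters of a family of solutions with prescribed jets. -/
structure JetParams where
  (α β σ ρ A d₀ d₁ : ℝ)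
  e : Fin 5 → ℝ

namespace JetParams

variable (P : JetParams)

/-- The parameters other than `e` fix the first jet of the solution at the centre, and `e` enters
only its second derivatives. In particular `e 2` adds the same amount to ψ_tt and to ψ_txx, so that
it cancels in the t-derivative of ψ_t − ψ_xx, and thus in u_t, while it survives in v_tt. -/
noncomputable def ψ (t x : ℝ) : ℝ := 1 + P.α * t + P.β * x + P.σ * x ^ 2 / 2 + P.ρ * x ^ 3 / 6
  + P.A * t ^ 2 / 2 + P.e 0 * t ^ 3 / 6 + P.e 1 * x ^ 4 / 24 + P.e 2 * (t ^ 2 / 2 + t * x ^ 2 / 2)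

noncomputable def ψt (t x : ℝ) : ℝ := P.α + P.A * t + P.e 0 * t ^ 2 / 2 + P.e 2 * (t + x ^ 2 / 2)

noncomputable def ψx (t x : ℝ) : ℝ :=
  P.β + P.σ * x + P.ρ * x ^ 2 / 2 + P.e 1 * x ^ 3 / 6 + P.e 2 * (t * x)

noncomputable def ψxx (t x : ℝ) : ℝ := P.σ + P.ρ * x + P.e 1 * x ^ 2 / 2 + P.e 2 * t

noncomputable def c (y : ℝ) : ℝ := y + P.e 3 * y ^ 2 / 2

noncomputable def c' (y : ℝ) : ℝ := 1 + P.e 3 * y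

/-- The term −`e 3` cancels the contribution of c'' = `e 3` to v_y at the centre. -/
noncomputable def d (y : ℝ) : ℝ := P.d₀ + (P.d₁ - P.e 3) * y + P.e 4 * y ^ 2 / 2

theorem hasDerivAt_ψ_left (t x : ℝ) : HasDerivAt (fun s => P.ψ s x) (P.ψt t x) t := by
  have h := hasDerivAt_id' t
  unfold ψ ψt
  refine (((((((((hasDerivAt_const t (1 : ℝ)).fun_add (h.const_mul P.α)).add_const (P.β * x)).add_const
    (P.σ * x ^ 2 / 2)).add_const (P.ρ * x ^ 3 / 6)).fun_add (((h.fun_pow 2).const_mul P.A).div_const 2)).fun_add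
    (((h.fun_pow 3).const_mul (P.e 0)).div_const 6)).add_const (P.e 1 * x ^ 4 / 24)).fun_add
    ((((h.fun_pow 2).div_const 2).fun_add ((h.mul_const (x ^ 2)).div_const 2)).const_mul
      (P.e 2))).congr_deriv ?_
  norm_num; ring

theorem hasDerivAt_ψ_right (t x : ℝ) : HasDerivAt (fun s => P.ψ t s) (P.ψx t x) x := by
  have h := hasDerivAt_id' x
  unfold ψ ψx
  refine (((((((((h.const_mul P.β).const_add (1 + P.α * t)).fun_add
    (((h.fun_pow 2).const_mul P.σ).div_const 2)).fun_add
    (((h.fun_pow 3).const_mul P.ρ).div_const 6)).add_const (P.A * t ^ 2 / 2)).add_const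
    (P.e 0 * t ^ 3 / 6)).fun_add (((h.fun_pow 4).const_mul (P.e 1)).div_const 24))).fun_add
    (((((h.fun_pow 2).const_mul t).div_const 2).const_add (t ^ 2 / 2)).const_mul
      (P.e 2))).congr_deriv ?_
  norm_num; ring

theorem hasDerivAt_ψx_right (t x : ℝ) : HasDerivAt (fun s => P.ψx t s) (P.ψxx t x) x := by
  have h := hasDerivAt_id' x
  unfold ψx ψxx
  refine (((((h.const_mul P.σ).const_add P.β).fun_add
    (((h.fun_pow 2).const_mul P.ρ).div_const 2)).fun_add
    (((h.fun_pow 3).const_mul (P.e 1)).div_const 6)).fun_add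
    ((h.const_mul t).const_mul (P.e 2))).congr_deriv ?_
  norm_num; ring

theorem hasDerivAt_c (y : ℝ) : HasDerivAt P.c (P.c' y) y := by
  have h := hasDerivAt_id' y
  unfold c c'
  refine (h.fun_add (((h.fun_pow 2).const_mul (P.e 3)).div_const 2)).congr_deriv ?_
  norm_num; ring

/-- The member of the family, centred at `p₀`. -/
noncomputable def sol (p₀ : Base) : Base → Fiber := fun p =>
  ((P.ψt (p.1 - p₀.1) (p.2.1 - p₀.2.1) - P.ψxx (p.1 - p₀.1) (p.2.1 - p₀.2.1))
      / (2 * P.ψx (p.1 - p₀.1) (p.2.1 - p₀.2.1))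
    + P.ψx (p.1 - p₀.1) (p.2.1 - p₀.2.1)
      / (P.ψ (p.1 - p₀.1) (p.2.1 - p₀.2.1) + P.c (p.2.2 - p₀.2.2)),
    P.c' (p.2.2 - p₀.2.2) / (P.ψ (p.1 - p₀.1) (p.2.1 - p₀.2.1) + P.c (p.2.2 - p₀.2.2))
      + P.d (p.2.2 - p₀.2.2))

def dom (p₀ : Base) : Set Base :=
  {p | P.ψx (p.1 - p₀.1) (p.2.1 - p₀.2.1) ≠ 0} ∩
    {p | P.ψ (p.1 - p₀.1) (p.2.1 - p₀.2.1) + P.c (p.2.2 - p₀.2.2) ≠ 0}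

theorem isOpen_dom (p₀ : Base) : IsOpen (P.dom p₀) := by
  refine IsOpen.inter (isOpen_ne_fun ?_ continuous_const) (isOpen_ne_fun ?_ continuous_const)
  · unfold ψx; fun_prop
  · unfold ψ c; fun_prop

theorem mem_dom (p₀ : Base) (hβ : P.β ≠ 0) : p₀ ∈ P.dom p₀ := by
  simp [dom, ψx, ψ, c, hβ]

theorem isSolutionOn_sol (p₀ : Base) : IsSolutionOn (P.sol p₀) (P.dom p₀) := by
  refine isSolutionOn_of_potential
    (ψ := fun t x => P.ψ (t - p₀.1) (x - p₀.2.1)) (ψt := fun t x => P.ψt (t - p₀.1) (x - p₀.2.1))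
    (ψx := fun t x => P.ψx (t - p₀.1) (x - p₀.2.1))
    (ψxx := fun t x => P.ψxx (t - p₀.1) (x - p₀.2.1)) (c := fun y => P.c (y - p₀.2.2))
    (c' := fun y => P.c' (y - p₀.2.2)) (d := fun y => P.d (y - p₀.2.2))
    ?_ ?_ ?_ ?_ ?_ ?_ ?_ ?_ ?_ ?_ ?_ (P.isOpen_dom p₀) (fun p hp => hp.1) (fun p hp => hp.2)
  · unfold ψ; fun_prop
  · unfold ψt; fun_prop
  · unfold ψx; fun_prop
  · unfold ψxx; fun_prop
  · unfold c; fun_prop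
  · unfold c'; fun_prop
  · unfold d; fun_prop
  · exact fun t x => (P.hasDerivAt_ψ_left _ _).comp_sub_const t p₀.1
  · exact fun t x => (P.hasDerivAt_ψ_right _ _).comp_sub_const x p₀.2.1
  · exact fun t x => (P.hasDerivAt_ψx_right _ _).comp_sub_const x p₀.2.1
  · exact fun y => (P.hasDerivAt_c _).comp_sub_const y p₀.2.2

end JetParams

end Jets

end BLP

namespace BLP

namespace JetParams

variable (P : JetParams)

theorem hasDerivAt_quadratic (a b : ℝ) {R : ℝ → ℝ} (hR : DifferentiableAt ℝ R 0) :
    HasDerivAt (fun s => a + s * b + s ^ 2 * R s) b 0 := by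
  have h := hasDerivAt_id' (0 : ℝ)
  refine (((h.mul_const b).const_add a).fun_add ((h.fun_pow 2).fun_mul hR.hasDerivAt)).congr_deriv ?_
  simp

/-- This and the next two definitions are what remains, after division by s², of ψ_t − ψ_xx, ψ_x and
ψ + c on the line through the centre with direction `η`, once the terms of order 0 and 1 in s are
removed. -/
noncomputable def lineN₂ (η : Base) : ℝ :=
  P.e 0 * η.1 ^ 2 / 2 + P.e 2 * η.2.1 ^ 2 / 2 - P.e 1 * η.2.1 ^ 2 / 2

noncomputable def lineW₂ (η : Base) (s : ℝ) : ℝ :=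
  P.ρ * η.2.1 ^ 2 / 2 + P.e 1 * η.2.1 ^ 3 * s / 6 + P.e 2 * (η.1 * η.2.1)

noncomputable def lineQ₂ (η : Base) (s : ℝ) : ℝ :=
  P.σ * η.2.1 ^ 2 / 2 + P.ρ * η.2.1 ^ 3 * s / 6 + P.A * η.1 ^ 2 / 2 + P.e 0 * η.1 ^ 3 * s / 6
    + P.e 1 * η.2.1 ^ 4 * s ^ 2 / 24 + P.e 2 * (η.1 ^ 2 / 2 + η.1 * η.2.1 ^ 2 * s / 2)
    + P.e 3 * η.2.2 ^ 2 / 2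

/-- The members of the family along a line through the centre. -/
theorem sol_line (p₀ η : Base) (s : ℝ) :
    P.sol p₀ (p₀ + s • η) =
      ((P.α - P.σ + s * (P.A * η.1 - P.ρ * η.2.1) + s ^ 2 * P.lineN₂ η)
          / (2 * (P.β + s * (P.σ * η.2.1) + s ^ 2 * P.lineW₂ η s))
        + (P.β + s * (P.σ * η.2.1) + s ^ 2 * P.lineW₂ η s)
          / (1 + s * (P.α * η.1 + P.β * η.2.1 + η.2.2) + s ^ 2 * P.lineQ₂ η s),
        (1 + s * (P.e 3 * η.2.2))
          / (1 + s * (P.α * η.1 + P.β * η.2.1 + η.2.2) + s ^ 2 * P.lineQ₂ η s)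
        + (P.d₀ + s * ((P.d₁ - P.e 3) * η.2.2) + s ^ 2 * (P.e 4 * η.2.2 ^ 2 / 2))) := by
  simp only [sol, Prod.fst_add, Prod.snd_add, Prod.smul_fst, Prod.smul_snd, smul_eq_mul,
    add_sub_cancel_left]
  have h1 : P.ψt (s * η.1) (s * η.2.1) - P.ψxx (s * η.1) (s * η.2.1) =
      P.α - P.σ + s * (P.A * η.1 - P.ρ * η.2.1) + s ^ 2 * P.lineN₂ η := by
    unfold ψt ψxx lineN₂; ring
  have h2 : P.ψx (s * η.1) (s * η.2.1) =
      P.β + s * (P.σ * η.2.1) + s ^ 2 * P.lineW₂ η s := by unfold ψx lineW₂; ring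
  have h3 : P.ψ (s * η.1) (s * η.2.1) + P.c (s * η.2.2) =
      1 + s * (P.α * η.1 + P.β * η.2.1 + η.2.2) + s ^ 2 * P.lineQ₂ η s := by
    unfold ψ c lineQ₂; ring
  have h4 : P.c' (s * η.2.2) = 1 + s * (P.e 3 * η.2.2) := by unfold c'; ring
  have h5 : P.d (s * η.2.2) =
      P.d₀ + s * ((P.d₁ - P.e 3) * η.2.2) + s ^ 2 * (P.e 4 * η.2.2 ^ 2 / 2) := by unfold d; ring
  rw [h1, h2, h3, h4, h5]

theorem contDiffAt_sol (p₀ : Base) (hβ : P.β ≠ 0) : ContDiffAt ℝ ∞ (P.sol p₀) p₀ :=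
  contDiffAt_of_open (P.isOpen_dom p₀) (P.isSolutionOn_sol p₀).smooth (P.mem_dom p₀ hβ)

theorem sol_center (p₀ : Base) :
    P.sol p₀ p₀ = ((P.α - P.σ) / (2 * P.β) + P.β, 1 + P.d₀) := by
  have := P.sol_line p₀ 0 0
  simpa using this

theorem fderiv_sol (p₀ : Base) (hβ : P.β ≠ 0) (η : Base) :
    fderiv ℝ (P.sol p₀) p₀ η =
      ((P.A * η.1 - P.ρ * η.2.1) / (2 * P.β) - (P.α - P.σ) * (P.σ * η.2.1) / (2 * P.β ^ 2)
        + P.σ * η.2.1 - P.β * (P.α * η.1 + P.β * η.2.1 + η.2.2),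
        P.d₁ * η.2.2 - (P.α * η.1 + P.β * η.2.1 + η.2.2)) := by
  refine dd_eq_deriv η ((P.contDiffAt_sol p₀ hβ).differentiableAt (by simp)) ?_
  simp only [sol_line]
  have hW : DifferentiableAt ℝ (P.lineW₂ η) 0 := by unfold lineW₂; fun_prop
  have hQ : DifferentiableAt ℝ (P.lineQ₂ η) 0 := by unfold lineQ₂; fun_prop
  have hQ' := hasDerivAt_quadratic 1 (P.α * η.1 + P.β * η.2.1 + η.2.2) hQ
  have hC : HasDerivAt (fun s => 1 + s * (P.e 3 * η.2.2)) (P.e 3 * η.2.2) 0 := by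
    simpa using ((hasDerivAt_id' (0 : ℝ)).mul_const (P.e 3 * η.2.2)).const_add 1
  refine HasDerivAt.prodMk
    ((hasDerivAt_div_add_div (hasDerivAt_quadratic _ _ (differentiableAt_const _))
      (hasDerivAt_quadratic _ _ hW) hQ' (by simpa using hβ) (by simp)).congr_deriv ?_)
    (((hC.fun_div hQ' (by simp)).fun_add
      (hasDerivAt_quadratic _ _ (differentiableAt_const _))).congr_deriv ?_)
  · simp
  · simp; ring

/-- The second derivatives, up to those that the parameters `e` do not affect. -/
theorem fderiv_fderiv_sol_sub (p₀ : Base) (P₀ : JetParams) (hβ : P₀.β ≠ 0) (he : P₀.e = 0)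
    (e : Fin 5 → ℝ) (η : Base) :
    fderiv ℝ (fderiv ℝ (({P₀ with e := e} : JetParams).sol p₀)) p₀ η η
        - fderiv ℝ (fderiv ℝ (P₀.sol p₀)) p₀ η η =
      (2 : ℝ) • ((e 0 * η.1 ^ 2 + (e 2 - e 1) * η.2.1 ^ 2) / (4 * P₀.β)
          - (P₀.α - P₀.σ) * e 2 * η.1 * η.2.1 / (2 * P₀.β ^ 2) + e 2 * η.1 * η.2.1
          - P₀.β * (e 2 * η.1 ^ 2 + e 3 * η.2.2 ^ 2) / 2,
        - e 3 * η.2.2 * (P₀.α * η.1 + P₀.β * η.2.1 + η.2.2)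
          - (e 2 * η.1 ^ 2 + e 3 * η.2.2 ^ 2) / 2 + e 4 * η.2.2 ^ 2 / 2) := by
  set P : JetParams := {P₀ with e := e} with hP
  have h1 := P.contDiffAt_sol p₀ hβ
  have h2 := P₀.contDiffAt_sol p₀ hβ
  have hsub : fderiv ℝ (fderiv ℝ (P.sol p₀)) p₀ η η - fderiv ℝ (fderiv ℝ (P₀.sol p₀)) p₀ η η =
      fderiv ℝ (fderiv ℝ fun q => P.sol p₀ q - P₀.sol p₀ q) p₀ η η := by
    have e1 : fderiv ℝ (fun q => P.sol p₀ q - P₀.sol p₀ q) =ᶠ[nhds p₀]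
        fun q => fderiv ℝ (P.sol p₀) q - fderiv ℝ (P₀.sol p₀) q := by
      filter_upwards [(h1.of_le (by simp : (1 : ℕ∞ω) ≤ ∞)).eventually (by simp),
        (h2.of_le (by simp : (1 : ℕ∞ω) ≤ ∞)).eventually (by simp)] with q hq hq'
      exact fderiv_fun_sub (hq.differentiableAt (by simp)) (hq'.differentiableAt (by simp))
    rw [e1.fderiv_eq, fderiv_fun_sub (differentiableAt_fderiv h1) (differentiableAt_fderiv h2)]
    rfl
  rw [hsub]
  let W₀ : ℝ → ℝ := fun s => P₀.β + s * (P₀.σ * η.2.1) + s ^ 2 * P₀.lineW₂ η s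
  let W : ℝ → ℝ := fun s => P₀.β + s * (P₀.σ * η.2.1) + s ^ 2 * P.lineW₂ η s
  let Q₁ : ℝ := P₀.α * η.1 + P₀.β * η.2.1 + η.2.2
  let Q₀ : ℝ → ℝ := fun s => 1 + s * Q₁ + s ^ 2 * P₀.lineQ₂ η s
  let Q : ℝ → ℝ := fun s => 1 + s * Q₁ + s ^ 2 * P.lineQ₂ η s
  let N₀ : ℝ → ℝ := fun s => P₀.α - P₀.σ + s * (P₀.A * η.1 - P₀.ρ * η.2.1) + s ^ 2 * P₀.lineN₂ η
  let n₂ : ℝ := P.lineN₂ η - P₀.lineN₂ η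
  let w₂ : ℝ → ℝ := fun s => P.lineW₂ η s - P₀.lineW₂ η s
  let q₂ : ℝ → ℝ := fun s => P.lineQ₂ η s - P₀.lineQ₂ η s
  -- Numerators and denominators of the two solutions differ by s² times `n₂`, `w₂`, `q₂`. Over
  -- common denominators s² factors out of the difference; in the v-component the linear term s·`e
  -- 3`·η_y of c' is cancelled by that of d up to the factor 1/Q − 1, which is again of order s.
  let R : ℝ → Fiber := fun s =>
    ((n₂ * W₀ s - N₀ s * w₂ s) / (2 * (W₀ s * W s)) + (w₂ s * Q₀ s - W₀ s * q₂ s) / (Q₀ s * Q s),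
      - (e 3 * η.2.2) * (Q₁ + s * P.lineQ₂ η s) / Q s - q₂ s / (Q₀ s * Q s) + e 4 * η.2.2 ^ 2 / 2)
  have sW₀ : ContDiff ℝ ∞ W₀ := by simp only [W₀, lineW₂]; fun_prop
  have sW : ContDiff ℝ ∞ W := by simp only [W, lineW₂]; fun_prop
  have sQ₀ : ContDiff ℝ ∞ Q₀ := by simp only [Q₀, lineQ₂]; fun_prop
  have sQ : ContDiff ℝ ∞ Q := by simp only [Q, lineQ₂]; fun_prop
  have sN₀ : ContDiff ℝ ∞ N₀ := by simp only [N₀]; fun_prop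
  have sw₂ : ContDiff ℝ ∞ w₂ := by simp only [w₂, lineW₂]; fun_prop
  have sq₂ : ContDiff ℝ ∞ q₂ := by simp only [q₂, lineQ₂]; fun_prop
  have sL : ContDiff ℝ ∞ (fun s => P.lineQ₂ η s) := by simp only [lineQ₂]; fun_prop
  have W₀0 : W₀ 0 = P₀.β := by simp [W₀]
  have W0 : W 0 = P₀.β := by simp [W]
  have Q₀0 : Q₀ 0 = 1 := by simp [Q₀]
  have Q0 : Q 0 = 1 := by simp [Q]
  have sR : ContDiffAt ℝ ∞ R 0 := by
    refine ContDiffAt.prodMk (ContDiffAt.add (ContDiffAt.div ?_ ?_ ?_) (ContDiffAt.div ?_ ?_ ?_))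
      (ContDiffAt.add (ContDiffAt.sub (ContDiffAt.div ?_ ?_ ?_) (ContDiffAt.div ?_ ?_ ?_))
        contDiffAt_const)
    · exact ((contDiff_const.mul sW₀).sub (sN₀.mul sw₂)).contDiffAt
    · exact (contDiff_const.mul (sW₀.mul sW)).contDiffAt
    · simp [W₀0, W0, hβ]
    · exact ((sw₂.mul sQ₀).sub (sW₀.mul sq₂)).contDiffAt
    · exact (sQ₀.mul sQ).contDiffAt
    · simp [Q₀0, Q0]
    · exact (contDiff_const.mul (contDiff_const.add (contDiff_id.mul sL))).contDiffAt
    · exact sQ.contDiffAt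
    · simp [Q0]
    · exact sq₂.contDiffAt
    · exact (sQ₀.mul sQ).contDiffAt
    · simp [Q₀0, Q0]
  have key : ∀ᶠ s in nhds (0 : ℝ), P.sol p₀ (p₀ + s • η) - P₀.sol p₀ (p₀ + s • η) = s ^ 2 • R s := by
    filter_upwards [sW₀.continuous.continuousAt.eventually_ne (by rw [W₀0]; exact hβ),
      sW.continuous.continuousAt.eventually_ne (by rw [W0]; exact hβ),
      sQ₀.continuous.continuousAt.eventually_ne (by rw [Q₀0]; exact one_ne_zero),
      sQ.continuous.continuousAt.eventually_ne (by rw [Q0]; exact one_ne_zero)] with s h1 h2 h3 h4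
    have eN : P.α - P.σ + s * (P.A * η.1 - P.ρ * η.2.1) + s ^ 2 * P.lineN₂ η = N₀ s + s ^ 2 * n₂ := by
      simp only [N₀, n₂, hP]; ring
    have eW : P.β + s * (P.σ * η.2.1) + s ^ 2 * P.lineW₂ η s = W s := by simp only [W, hP]
    have eQ : 1 + s * (P.α * η.1 + P.β * η.2.1 + η.2.2) + s ^ 2 * P.lineQ₂ η s = Q s := by
      simp only [Q, Q₁, hP]
    have eN₀ : P₀.α - P₀.σ + s * (P₀.A * η.1 - P₀.ρ * η.2.1) + s ^ 2 * P₀.lineN₂ η = N₀ s := rfl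
    have eW₀ : P₀.β + s * (P₀.σ * η.2.1) + s ^ 2 * P₀.lineW₂ η s = W₀ s := rfl
    have eQ₀ : 1 + s * (P₀.α * η.1 + P₀.β * η.2.1 + η.2.2) + s ^ 2 * P₀.lineQ₂ η s = Q₀ s := rfl
    have eWW : W s = W₀ s + s ^ 2 * w₂ s := by simp only [W, W₀, w₂]; ring
    have eQQ : Q s = Q₀ s + s ^ 2 * q₂ s := by simp only [Q, Q₀, q₂]; ring
    have eQ1 : Q s = 1 + s * (Q₁ + s * P.lineQ₂ η s) := by simp only [Q]; ring
    have eQ1' : s * (Q₁ + s * P.lineQ₂ η s) = Q s - 1 := by rw [eQ1]; ring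
    rw [sol_line, sol_line, eN, eW, eQ, eN₀, eW₀, eQ₀, he]
    ext
    · simp only [R, Prod.fst_sub, Prod.smul_fst, smul_eq_mul]
      have hw : s ^ 2 * w₂ s = W s - W₀ s := by rw [eWW]; ring
      have hq : s ^ 2 * q₂ s = Q s - Q₀ s := by rw [eQQ]; ring
      field_simp
      linear_combination (- N₀ s * Q s * Q₀ s + 2 * W₀ s * W s * Q₀ s) * (-hw)
        + 2 * W₀ s ^ 2 * W s * hq
    · simp only [R, Prod.snd_sub, Prod.smul_snd, smul_eq_mul, hP, Pi.zero_apply]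
      have hq : s ^ 2 * q₂ s = Q s - Q₀ s := by rw [eQQ]; ring
      simp only [← hP]
      field_simp
      linear_combination (2 * Q₀ s * s * e 3 * η.2.2) * eQ1' + 2 * hq
  rw [fderiv_fderiv_eq_of_line (h1.sub h2) sR key]
  congr 1
  have hn : n₂ = e 0 * η.1 ^ 2 / 2 + (e 2 - e 1) * η.2.1 ^ 2 / 2 := by
    simp only [n₂, lineN₂, he, hP, Pi.zero_apply]; ring
  have hw : w₂ 0 = e 2 * (η.1 * η.2.1) := by
    simp only [w₂, lineW₂, he, hP, Pi.zero_apply]; ring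
  have hq : q₂ 0 = e 2 * η.1 ^ 2 / 2 + e 3 * η.2.2 ^ 2 / 2 := by
    simp only [q₂, lineQ₂, he, hP, Pi.zero_apply]; ring
  ext
  · simp only [R, W₀0, W0, Q₀0, Q0, hn, hw, hq, N₀]
    field_simp
    ring
  · simp only [R, Q₀0, Q0, hq, Q₁]
    ring

end JetParams

/-- Solutions with a prescribed first jet at a point and with varying second derivatives. -/
theorem exists_solutions_with_jet (p₀ : Base) (w₀ : Fiber) (a b k c d : ℝ) (hk : k ≠ 0) :
    ∃ (n : ℝ) (f : (Fin 5 → ℝ) → Base → Fiber), ∀ e : Fin 5 → ℝ,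
      (∃ Ω, IsOpen Ω ∧ p₀ ∈ Ω ∧ IsSolutionOn (f e) Ω) ∧ f e p₀ = w₀ ∧
      (∀ η : Base, fderiv ℝ (f e) p₀ η =
        (a * η.1 + b * η.2.1 + k * η.2.2, c * η.1 + k * η.2.1 + d * η.2.2)) ∧
      ∀ η : Base, fderiv ℝ (fderiv ℝ (f e)) p₀ η η - fderiv ℝ (fderiv ℝ (f 0)) p₀ η η =
        (2 : ℝ) • (- (e 0 * η.1 ^ 2 + (e 2 - e 1) * η.2.1 ^ 2) / (4 * k)
            + n * e 2 * η.1 * η.2.1 + k * (e 2 * η.1 ^ 2 + e 3 * η.2.2 ^ 2) / 2,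
          - e 3 * η.2.2 * (- c * η.1 - k * η.2.1 + η.2.2)
            - (e 2 * η.1 ^ 2 + e 3 * η.2.2 ^ 2) / 2 + e 4 * η.2.2 ^ 2 / 2) := by
  obtain ⟨u₀, v₀⟩ := w₀
  -- The value of ψ_t − ψ_xx at the centre, from u₀ = n₀/(2β) + β. Since ψ + c = c' = 1 there, u_y =
  -- v_x = −β and v_t = −α, so β = −k and α = −c; the remaining parameters solve linear equations
  -- for u_t, u_x, v and v_y.
  let n₀ : ℝ := -2 * k * (u₀ + k)
  let σ : ℝ := -c - n₀
  let P₀ : JetParams :=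
    { α := -c, β := -k, σ := σ, ρ := -2 * k * (σ - k ^ 2 - b) + n₀ * σ / k, A := -2 * k * (a + c * k),
      d₀ := v₀ - 1, d₁ := d + 1, e := 0 }
  refine ⟨1 - n₀ / (2 * k ^ 2), fun e => ({P₀ with e := e} : JetParams).sol p₀, fun e => ?_⟩
  have hβ : P₀.β ≠ 0 := neg_ne_zero.2 hk
  refine ⟨⟨({P₀ with e := e} : JetParams).dom p₀, JetParams.isOpen_dom _ p₀,
    JetParams.mem_dom {P₀ with e := e} p₀ hβ, JetParams.isSolutionOn_sol _ p₀⟩, ?_, fun η => ?_, fun η => ?_⟩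
  · refine (JetParams.sol_center {P₀ with e := e} p₀).trans ?_
    ext
    · simp only [P₀, σ, n₀]; field_simp; ring
    · simp [P₀]
  · refine (JetParams.fderiv_sol {P₀ with e := e} p₀ hβ η).trans ?_
    ext
    · simp only [P₀, σ, n₀]; field_simp; ring
    · simp only [P₀]; ring
  · refine (JetParams.fderiv_fderiv_sol_sub p₀ P₀ hβ rfl e η).trans ?_
    congr 1
    ext
    · simp only [P₀, σ]; field_simp; ring
    · simp only [P₀]; ring

end BLP

/-! ### Images of solutions under a point symmetry -/

namespace BLP

theorem IsSolutionOn.mono {f : Base → Fiber} {Ω Ω' : Set Base} (h : IsSolutionOn f Ω)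
    (hs : Ω' ⊆ Ω) : IsSolutionOn f Ω' :=
  ⟨h.smooth.mono hs, fun p hp => h.eq_u p (hs hp), fun p hp => h.eq_v p (hs hp)⟩

/-- The derivative of the base component of `Φ` along a graph whose tangent space at `z` is the
graph of `A`. -/
noncomputable def baseMap (Φ : Total → Total) (z : Total) (A : Base →L[ℝ] Fiber) :
    Base →L[ℝ] Base :=
  (ContinuousLinearMap.fst ℝ Base Fiber).comp
    ((fderiv ℝ Φ z).comp ((ContinuousLinearMap.id ℝ Base).prod A))

@[simp] theorem baseMap_apply (Φ : Total → Total) (z : Total) (A : Base →L[ℝ] Fiber) (η : Base) :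
    baseMap Φ z A η = (fderiv ℝ Φ z (η, A η)).1 := rfl

theorem fderiv_graph {f : Base → Fiber} {p : Base} (hf : DifferentiableAt ℝ f p) :
    HasFDerivAt (fun q => (q, f q)) ((ContinuousLinearMap.id ℝ Base).prod (fderiv ℝ f p)) p :=
  (hasFDerivAt_id p).prodMk hf.hasFDerivAt

/-- Injectivity of the base component of the differential along the graph means that the image is
transversal to the fibres. By the inverse function theorem the image is then, locally, the graph of
a smooth function, to which the defining property of a point symmetry applies. -/
theorem IsPointSymmetry.exists_image {Φ : OpenPartialHomeomorph Total Total}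
    (hΦ : IsPointSymmetry Φ) {f : Base → Fiber} {Ω : Set Base} (hΩ : IsOpen Ω) {p₀ : Base}
    (hp₀ : p₀ ∈ Ω) (hf : IsSolutionOn f Ω) (hz : (p₀, f p₀) ∈ Φ.source)
    (hinj : Function.Injective (baseMap Φ (p₀, f p₀) (fderiv ℝ f p₀))) :
    ∃ (Ω₁ Ω' : Set Base) (g : Base → Fiber), IsOpen Ω₁ ∧ IsOpen Ω' ∧ p₀ ∈ Ω₁ ∧ Ω₁ ⊆ Ω ∧
      IsSolutionOn g Ω' ∧ ∀ p ∈ Ω₁, (p, f p) ∈ Φ.source ∧ (Φ (p, f p)).1 ∈ Ω' ∧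
        (Φ (p, f p)).2 = g (Φ (p, f p)).1 := by
  have hgr : ContDiffOn ℝ ∞ (fun p : Base => (p, f p)) Ω := contDiffOn_id.prodMk hf.smooth
  set Ω₀ : Set Base := Ω ∩ (fun p : Base => (p, f p)) ⁻¹' Φ.source with hΩ₀
  have oΩ₀ : IsOpen Ω₀ := hgr.continuousOn.isOpen_inter_preimage hΩ Φ.open_source
  have hp : p₀ ∈ Ω₀ := ⟨hp₀, hz⟩
  have hΦf : ContDiffOn ℝ ∞ (fun p => Φ (p, f p)) Ω₀ :=
    hΦ.smooth.comp (hgr.mono Set.inter_subset_left) fun p hp => hp.2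
  set α : Base → Base := fun p => (Φ (p, f p)).1 with hα
  have sα : ContDiffOn ℝ ∞ α Ω₀ := hΦf.fst
  have dα : fderiv ℝ α p₀ = baseMap Φ (p₀, f p₀) (fderiv ℝ f p₀) := by
    have h1 := fderiv_graph (differentiableAt_of_open hΩ hf.smooth hp₀)
    have h2 := (differentiableAt_of_open Φ.open_source hΦ.smooth hz).hasFDerivAt.comp p₀ h1
    exact h2.fst.fderiv
  have hcont : ContinuousOn (fderiv ℝ α) Ω₀ :=
    (sα.fderiv_of_isOpen oΩ₀ (m := ∞) (by simp)).continuousOn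
  let L : Base ≃L[ℝ] Base :=
    (LinearEquiv.ofInjectiveEndo ((fderiv ℝ α p₀ : Base →L[ℝ] Base) : Base →ₗ[ℝ] Base)
      (by rw [dα]; exact hinj)).toContinuousLinearEquiv
  have hL : (L : Base →L[ℝ] Base) = fderiv ℝ α p₀ := by ext <;> rfl
  -- On this open set the differential stays invertible, so the local inverse is smooth on its whole
  -- domain and not merely at one point.
  set V : Set Base := Ω₀ ∩ fderiv ℝ α ⁻¹' Set.range ((↑) : (Base ≃L[ℝ] Base) → Base →L[ℝ] Base)
  have oV : IsOpen V := hcont.isOpen_inter_preimage oΩ₀ ContinuousLinearEquiv.isOpen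
  have hV : p₀ ∈ V := ⟨hp, ⟨L, hL⟩⟩
  have cα : ContDiffAt ℝ ∞ α p₀ := contDiffAt_of_open oΩ₀ sα hp
  have fα : HasFDerivAt α (L : Base →L[ℝ] Base) p₀ := by
    rw [hL]; exact (cα.differentiableAt (by simp)).hasFDerivAt
  let e := (cα.toOpenPartialHomeomorph α fα (by simp)).restrOpen V oV
  have he : ∀ p, e p = α p := fun p => rfl
  have hes : e.source ⊆ V := fun p hp => hp.2
  have hpe : p₀ ∈ e.source := ⟨cα.mem_toOpenPartialHomeomorph_source fα (by simp), hV⟩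
  let g : Base → Fiber := fun q => (Φ (e.symm q, f (e.symm q))).2
  have ssymm : ContDiffOn ℝ ∞ e.symm e.target := by
    intro q hq
    have hs := hes (e.map_target hq)
    obtain ⟨L', hL'⟩ := hs.2
    refine (e.contDiffAt_symm (f₀' := L') hq ?_ ?_).contDiffWithinAt
    · rw [hL']
      exact (differentiableAt_of_open oΩ₀ sα hs.1).hasFDerivAt
    · exact contDiffAt_of_open oΩ₀ sα hs.1
  have sg : ContDiffOn ℝ ∞ g e.target :=
    hΦf.snd.comp ssymm fun q hq => (hes (e.map_target hq)).1
  have gα : ∀ p ∈ e.source, (Φ (p, f p)).2 = g (Φ (p, f p)).1 := by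
    intro p hp
    have : e.symm (Φ (p, f p)).1 = p := e.left_inv hp
    simp only [g, this]
  have key := hΦ.solution_iff e.source e.target f g e.open_source e.open_target
    (hf.smooth.mono fun p hp => (hes hp).1.1) sg
    (by rintro _ ⟨p, hp, rfl⟩; exact (hes hp).1.2)
    (by
      ext w
      constructor
      · rintro ⟨_, ⟨p, hp, rfl⟩, rfl⟩
        exact ⟨(Φ (p, f p)).1, e.map_source hp, Prod.ext rfl (gα p hp).symm⟩
      · rintro ⟨q, hq, rfl⟩
        refine ⟨_, ⟨e.symm q, e.map_target hq, rfl⟩, ?_⟩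
        exact Prod.ext (e.right_inv hq) rfl)
  exact ⟨e.source, e.target, g, e.open_source, e.open_target, hpe, fun p hp => (hes hp).1.1,
    key.1 (hf.mono fun p hp => (hes hp).1.1),
    fun p hp => ⟨(hes hp).1.2, e.map_source hp, gα p hp⟩⟩

/-- What the second equation of the system for the image of a solution says about `Φ`. -/
theorem IsPointSymmetry.second_equation {Φ : OpenPartialHomeomorph Total Total}
    (hΦ : IsPointSymmetry Φ) {f : Base → Fiber} {Ω : Set Base} (hΩ : IsOpen Ω) {p₀ : Base}
    (hp₀ : p₀ ∈ Ω) (hf : IsSolutionOn f Ω) (hz : (p₀, f p₀) ∈ Φ.source)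
    (hinj : Function.Injective (baseMap Φ (p₀, f p₀) (fderiv ℝ f p₀))) :
    ∃ l : Base →L[ℝ] ℝ,
      (∀ η, (fderiv ℝ Φ (p₀, f p₀) (η, fderiv ℝ f p₀ η)).2.2 =
        l (fderiv ℝ Φ (p₀, f p₀) (η, fderiv ℝ f p₀ η)).1) ∧
      ∀ ξ a, (fderiv ℝ Φ (p₀, f p₀) (ξ, fderiv ℝ f p₀ ξ)).1 = (0, 1, 0) →
        fderiv ℝ (fderiv ℝ Φ) (p₀, f p₀) (ξ, fderiv ℝ f p₀ ξ) (ξ, fderiv ℝ f p₀ ξ)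
          + fderiv ℝ Φ (p₀, f p₀) (0, fderiv ℝ (fderiv ℝ f) p₀ ξ ξ) = a →
        a.2.2 - l a.1 = l (1, 0, 0) - 2 * (Φ (p₀, f p₀)).2.1 * l (0, 1, 0) := by
  obtain ⟨Ω₁, Ω', g, oΩ₁, oΩ', hp₁, hsub, hg, him⟩ := hΦ.exists_image hΩ hp₀ hf hz hinj
  have sf : ContDiffAt ℝ ∞ f p₀ := contDiffAt_of_open hΩ hf.smooth hp₀
  have sγ : ContDiffAt ℝ ∞ (fun q : Base => (q, f q)) p₀ := contDiffAt_id.prodMk sf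
  have sΦ : ContDiffAt ℝ ∞ Φ (p₀, f p₀) := contDiffAt_of_open Φ.open_source hΦ.smooth hz
  have dγ := (fderiv_graph (sf.differentiableAt (by simp))).fderiv
  have sH : ContDiffAt ℝ ∞ (fun q => Φ (q, f q)) p₀ := sΦ.comp p₀ sγ
  have sα : ContDiffAt ℝ ∞ (fun q => (Φ (q, f q)).1) p₀ := sH.fst
  have sg : ContDiffAt ℝ ∞ (fun q => (g q).2) (Φ (p₀, f p₀)).1 :=
    (contDiffAt_of_open oΩ' hg.smooth (him p₀ hp₁).2.1).snd
  have dH : ∀ η, fderiv ℝ (fun q => Φ (q, f q)) p₀ η =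
      fderiv ℝ Φ (p₀, f p₀) (η, fderiv ℝ f p₀ η) := by
    intro η
    have := dd_comp (g := Φ) (a := fun q : Base => (q, f q)) (p := p₀)
      (sΦ.differentiableAt (by simp)) (sγ.differentiableAt (by simp)) η
    unfold dd at this
    rw [this, dγ]; rfl
  have hev : (fun q => (Φ (q, f q)).2.2) =ᶠ[nhds p₀] fun q => (g (Φ (q, f q)).1).2 := by
    filter_upwards [oΩ₁.mem_nhds hp₁] with q hq
    rw [(him q hq).2.2]
  have d1 : ∀ η, fderiv ℝ (fun q => (Φ (q, f q)).1) p₀ η =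
      (fderiv ℝ Φ (p₀, f p₀) (η, fderiv ℝ f p₀ η)).1 := fun η => by
    rw [← dH, fderiv.fst (sH.differentiableAt (by simp))]; rfl
  have d2 : ∀ η, fderiv ℝ (fun q => (Φ (q, f q)).2.2) p₀ η =
      (fderiv ℝ Φ (p₀, f p₀) (η, fderiv ℝ f p₀ η)).2.2 := fun η => by
    rw [← dH, fderiv.snd (sH.snd.differentiableAt (by simp)),
      fderiv.snd (sH.differentiableAt (by simp))]; rfl
  -- The functional `l` is the differential of the second component of the image solution at the
  -- image point.
  refine ⟨fderiv ℝ (fun q => (g q).2) (Φ (p₀, f p₀)).1, fun η => ?_, fun ξ a hξ ha => ?_⟩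
  · rw [← d2, ← d1, hev.fderiv_eq]
    exact dd_comp (g := fun q => (g q).2) (a := fun q => (Φ (q, f q)).1)
      (sg.differentiableAt (by simp)) (sα.differentiableAt (by simp)) η
  · have a0 : fderiv ℝ (fderiv ℝ fun q => Φ (q, f q)) p₀ ξ ξ = a := by
      rw [← ha, fderiv_fderiv_comp (a := fun q : Base => (q, f q)) sΦ sγ, dγ]
      congr 2
      have h1 : fderiv ℝ (fun q : Base => (q, f q)) =ᶠ[nhds p₀]
          fun q => (ContinuousLinearMap.id ℝ Base).prod (fderiv ℝ f q) := by
        filter_upwards [(sf.of_le (by simp : (1 : ℕ∞ω) ≤ ∞)).eventually (by simp)] with q hq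
        exact (fderiv_graph (hq.differentiableAt (by simp))).fderiv
      have h2 : fderiv ℝ (fderiv ℝ fun q : Base => (q, f q)) p₀ ξ ξ =
          dd ξ (fun q => fderiv ℝ (fun q : Base => (q, f q)) q ξ) p₀ := (dd_dd_eq sγ ξ ξ).symm
      rw [h2]
      unfold dd
      rw [Filter.EventuallyEq.fderiv_eq (f := fun q => (ξ, fderiv ℝ f q ξ))
        (h1.mono fun q hq => by rw [hq]; rfl)]
      have h3 : HasFDerivAt (fun q => fderiv ℝ f q ξ) _ p₀ :=
        (differentiableAt_fderiv sf).hasFDerivAt.clm_apply (hasFDerivAt_const ξ p₀)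
      rw [((hasFDerivAt_const ξ p₀).prodMk h3).fderiv]
      simp
    have a1 : fderiv ℝ (fderiv ℝ fun q => (Φ (q, f q)).1) p₀ ξ ξ = a.1 := by
      rw [← a0, fderiv_fderiv_comp (g := Prod.fst) contDiffAt_fst sH]
      have : fderiv ℝ (Prod.fst : Total → Base) = fun _ => ContinuousLinearMap.fst ℝ Base Fiber := by
        ext1 q; exact fderiv_fst
      rw [this]; simp
    have a2 : fderiv ℝ (fderiv ℝ fun q => (Φ (q, f q)).2.2) p₀ ξ ξ = a.2.2 := by
      have hl : ∀ q : Total, fderiv ℝ (fun z : Total => z.2.2) q =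
          (ContinuousLinearMap.snd ℝ ℝ ℝ).comp (ContinuousLinearMap.snd ℝ Base Fiber) :=
        fun q => ((ContinuousLinearMap.snd ℝ ℝ ℝ).comp (ContinuousLinearMap.snd ℝ Base Fiber)).fderiv
      rw [← a0, fderiv_fderiv_comp (g := fun z : Total => z.2.2)
        (contDiff_snd.comp contDiff_snd).contDiffAt sH, funext hl]
      simp
    have h4 : fderiv ℝ (fderiv ℝ fun q => (Φ (q, f q)).2.2) p₀ ξ ξ =
        fderiv ℝ (fderiv ℝ fun q => (g (Φ (q, f q)).1).2) p₀ ξ ξ := by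
      rw [hev.fderiv.fderiv_eq]
    -- Because ξ is carried to the unit vector of the x̃-axis, differentiating ṽ = g₂(t̃, x̃, ỹ)
    -- twice along ξ gives a_v = ∂_x̃²g₂ + l(a_base). The second equation for the image then
    -- replaces ∂_x̃²g₂ by first derivatives.
    rw [fderiv_fderiv_comp (g := fun q => (g q).2) (a := fun q => (Φ (q, f q)).1) sg sα, a1, a2,
      d1, hξ] at h4
    have h5 := hg.eq_v _ (him p₀ hp₁).2.1
    have h6 : dx (dx fun q => (g q).2) (Φ (p₀, f p₀)).1 = _ := dd_dd_eq sg (0, 1, 0) (0, 1, 0)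
    rw [h6, ← (him p₀ hp₁).2.2] at h5
    have h7 : dt (fun q => (g q).2) (Φ (p₀, f p₀)).1 =
      fderiv ℝ (fun q => (g q).2) (Φ (p₀, f p₀)).1 (1, 0, 0) := rfl
    have h8 : dx (fun q => (g q).2) (Φ (p₀, f p₀)).1 =
      fderiv ℝ (fun q => (g q).2) (Φ (p₀, f p₀)).1 (0, 1, 0) := rfl
    rw [h7, h8] at h5
    rw [h4, h5]; ring

end BLP

/-! ### Transversality of generic jets -/

namespace BLP

/-- The coordinate vectors of the space of all variables. -/
def et : Total := ((1, 0, 0), (0, 0))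
def ex : Total := ((0, 1, 0), (0, 0))
def ey : Total := ((0, 0, 1), (0, 0))
def eu : Total := ((0, 0, 0), (1, 0))
def ev : Total := ((0, 0, 0), (0, 1))

theorem map_total {F : Type*} [AddCommGroup F] [Module ℝ F] [TopologicalSpace F]
    (D : Total →L[ℝ] F) (w : Total) :
    D w = w.1.1 • D et + w.1.2.1 • D ex + w.1.2.2 • D ey + w.2.1 • D eu + w.2.2 • D ev := by
  have : w = w.1.1 • et + w.1.2.1 • ex + w.1.2.2 • ey + w.2.1 • eu + w.2.2 • ev := by
    ext <;> simp [et, ex, ey, eu, ev]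
  conv_lhs => rw [this]
  simp only [map_add, map_smul]

theorem IsPointSymmetry.fderiv_injective {Φ : OpenPartialHomeomorph Total Total}
    (hΦ : IsPointSymmetry Φ) {z : Total} (hz : z ∈ Φ.source) :
    Function.Injective (fderiv ℝ Φ z) := by
  have h1 := (differentiableAt_of_open Φ.open_source hΦ.smooth hz).hasFDerivAt
  have h2 := (differentiableAt_of_open Φ.open_target hΦ.smooth_symm (Φ.map_source hz)).hasFDerivAt
  have h3 : (Φ.symm ∘ Φ) =ᶠ[nhds z] id := by
    filter_upwards [Φ.open_source.mem_nhds hz] with w hw using Φ.left_inv hw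
  have h4 := (h2.comp z h1).unique ((hasFDerivAt_id z).congr_of_eventuallyEq h3)
  intro a b hab
  have := DFunLike.congr_fun h4 a
  have h5 := DFunLike.congr_fun h4 b
  simp only [ContinuousLinearMap.comp_apply, ContinuousLinearMap.id_apply] at this h5
  rw [← this, ← h5, hab]

theorem IsPointSymmetry.fderiv_surjective {Φ : OpenPartialHomeomorph Total Total}
    (hΦ : IsPointSymmetry Φ) {z : Total} (hz : z ∈ Φ.source) :
    Function.Surjective (fderiv ℝ Φ z) :=
  (LinearMap.injective_iff_surjective (f := ((fderiv ℝ Φ z : Total →L[ℝ] Total) :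
    Total →ₗ[ℝ] Total))).1 (hΦ.fderiv_injective hz)

/-- The determinant of three vectors. -/
def det3 (p q r : Base) : ℝ :=
  p.1 * (q.2.1 * r.2.2 - q.2.2 * r.2.1) - p.2.1 * (q.1 * r.2.2 - q.2.2 * r.1)
    + p.2.2 * (q.1 * r.2.1 - q.2.1 * r.1)

/-- A Plücker relation between the maximal minors of a 3 × 5 matrix. It compensates for the
constraint u_y = v_x on the jets in `exists_jet_det3_ne_zero`. -/
theorem det3_plucker (t x y u v : Base) :
    det3 t x y * det3 t u v - det3 t x u * det3 t y v + det3 t x v * det3 t y u = 0 := by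
  unfold det3; ring

theorem det3_perm {p q r : Base} (h : det3 p q r = 0) :
    det3 p q r = 0 ∧ det3 q p r = 0 ∧ det3 p r q = 0 ∧ det3 r q p = 0 ∧ det3 q r p = 0 ∧
      det3 r p q = 0 := by
  unfold det3 at *
  refine ⟨h, ?_, ?_, ?_, ?_, ?_⟩ <;> linarith

theorem det3_self_left (p q : Base) : det3 p p q = 0 := by unfold det3; ring
theorem det3_self_right (p q : Base) : det3 q p p = 0 := by unfold det3; ring
theorem det3_self_outer (p q : Base) : det3 p q p = 0 := by unfold det3; ring

/-- Five vectors spanning the space have a nonvanishing minor. -/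
theorem exists_det3_ne_zero {A : Fin 5 → Base} (hA : ∀ r : Base, ∃ w : Fin 5 → ℝ, r = ∑ i, w i • A i) :
    ∃ i j k, det3 (A i) (A j) (A k) ≠ 0 := by
  by_contra! h
  -- A vector orthogonal to a spanning family is orthogonal to itself.
  have hdot : ∀ C : Base, (∀ i, (A i).1 * C.1 + (A i).2.1 * C.2.1 + (A i).2.2 * C.2.2 = 0) → C = 0 := by
    intro C hC
    obtain ⟨w, hw⟩ := hA C
    have h1 : C.1 * C.1 + C.2.1 * C.2.1 + C.2.2 * C.2.2 =
        ∑ i, w i * ((A i).1 * C.1 + (A i).2.1 * C.2.1 + (A i).2.2 * C.2.2) := by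
      have e1 : C.1 = ∑ i, w i * (A i).1 := by
        conv_lhs => rw [hw]
        simp [Prod.fst_sum]
      have e2 : C.2.1 = ∑ i, w i * (A i).2.1 := by
        conv_lhs => rw [hw]
        simp [Prod.fst_sum, Prod.snd_sum]
      have e3 : C.2.2 = ∑ i, w i * (A i).2.2 := by
        conv_lhs => rw [hw]
        simp [Prod.snd_sum]
      nth_rewrite 1 [e1]
      nth_rewrite 1 [e2]
      nth_rewrite 1 [e3]
      simp only [Finset.sum_mul, ← Finset.sum_add_distrib]
      exact Finset.sum_congr rfl fun i _ => by ring
    simp only [hC, mul_zero, Finset.sum_const_zero] at h1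
    have a1 : C.1 = 0 := by nlinarith [mul_self_nonneg C.1, mul_self_nonneg C.2.1, mul_self_nonneg C.2.2]
    have a2 : C.2.1 = 0 := by nlinarith [mul_self_nonneg C.1, mul_self_nonneg C.2.1, mul_self_nonneg C.2.2]
    have a3 : C.2.2 = 0 := by nlinarith [mul_self_nonneg C.1, mul_self_nonneg C.2.1, mul_self_nonneg C.2.2]
    exact Prod.ext a1 (Prod.ext a2 a3)
  have hcross : ∀ i j, (((A i).2.1 * (A j).2.2 - (A i).2.2 * (A j).2.1,
      (A i).2.2 * (A j).1 - (A i).1 * (A j).2.2, (A i).1 * (A j).2.1 - (A i).2.1 * (A j).1) : Base) = 0 := by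
    intro i j
    refine hdot _ fun k => ?_
    have := h i j k
    unfold det3 at this
    simp only
    linear_combination this
  -- Each coordinate of a cross product `A i × A j` is the product of `A j` with a vector built from
  -- two coordinates of `A i`. As all cross products vanish, these vectors vanish too.
  have hzero : ∀ i, A i = 0 := by
    intro i
    have h1 := hdot (0, -(A i).2.2, (A i).2.1) fun j => by
      have := congrArg (fun p : Base => p.1) (hcross i j)
      simp at this ⊢
      linear_combination this
    have h2 := hdot (-(A i).2.2, 0, (A i).1) fun j => by
      have := congrArg (fun p : Base => p.2.1) (hcross i j)
      simp at this ⊢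
      linear_combination -this
    simp at h1 h2
    exact Prod.ext h2.2 (Prod.ext h1.2 h1.1)
  have := hdot (1, 0, 0) fun i => by simp [hzero]
  simp at this

/-- The determinant is a polynomial in the five jet parameters. If it vanished identically, its
coefficients would kill every maximal minor except `det3 t x u` and `det3 t y v`, of which only the
difference is seen since `k` occurs in two places. The Plücker relation makes the product of these
two equal minors zero, so all minors vanish, which contradicts spanning. -/
theorem exists_jet_det3_ne_zero {t x y u v : Base}
    (hA : ∀ r : Base, ∃ w : Fin 5 → ℝ, r = ∑ i, w i • (![t, x, y, u, v] : Fin 5 → Base) i) :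
    ∃ a b k c d : ℝ,
      det3 (t + a • u + c • v) (x + b • u + k • v) (y + k • u + d • v) ≠ 0 := by
  by_contra! h
  have exp : ∀ a b k c d : ℝ,
      det3 (t + a • u + c • v) (x + b • u + k • v) (y + k • u + d • v) =
      det3 t x y + a * det3 u x y + c * det3 v x y + b * det3 t u y + d * det3 t x v
        + k * (det3 t x u - det3 t y v) - (a * d - c * k) * det3 x u v
        + (a * k - c * b) * det3 u v y + (b * d - k ^ 2) * det3 t u v := by
    intro a b k c d
    simp only [det3, Prod.fst_add, Prod.snd_add, Prod.smul_fst, Prod.smul_snd, smul_eq_mul]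
    ring
  simp only [exp] at h
  have h0 := h 0 0 0 0 0
  have ha := h 1 0 0 0 0
  have hc := h 0 0 0 1 0
  have hb := h 0 1 0 0 0
  have hd := h 0 0 0 0 1
  have hk := h 0 0 1 0 0
  have had := h 1 0 0 0 1
  have hcb := h 0 1 0 1 0
  have hbd := h 0 1 0 0 1
  norm_num at h0 ha hc hb hd hk had hcb hbd
  have txy := h0
  have uxy : det3 u x y = 0 := by linarith
  have vxy : det3 v x y = 0 := by linarith
  have tuy : det3 t u y = 0 := by linarith
  have txv : det3 t x v = 0 := by linarith
  have xuv : det3 x u v = 0 := by linarith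
  have uvy : det3 u v y = 0 := by linarith
  have tuv : det3 t u v = 0 := by linarith
  have hxu : det3 t x u = det3 t y v := by linarith
  have hpl := det3_plucker t x y u v
  rw [txy, txv, hxu] at hpl
  have tyv : det3 t y v = 0 := by nlinarith
  have txu : det3 t x u = 0 := hxu.trans tyv
  obtain ⟨i, j, k, hijk⟩ := exists_det3_ne_zero hA
  clear h exp h0 ha hc hb hd hk had hcb hbd hpl hxu hA
  apply hijk
  have h₁ := det3_perm txy
  have h₂ := det3_perm uxy
  have h₃ := det3_perm vxy
  have h₄ := det3_perm tuy
  have h₅ := det3_perm txv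
  have h₆ := det3_perm xuv
  have h₇ := det3_perm uvy
  have h₈ := det3_perm tuv
  have h₉ := det3_perm tyv
  have h₀ := det3_perm txu
  fin_cases i <;> fin_cases j <;> fin_cases k <;>
    simp only [Matrix.cons_val_zero, Matrix.cons_val_one, Matrix.cons_val, Fin.zero_eta, Fin.mk_one,
      Fin.reduceFinMk, det3_self_left, det3_self_right, det3_self_outer,
      h₀, h₁, h₂, h₃, h₄, h₅, h₆, h₇, h₈, h₉]

theorem injective_of_det3_ne_zero {p q r : Base} (h : det3 p q r ≠ 0) {L : Base →L[ℝ] Base}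
    (hL : ∀ η : Base, L η = η.1 • p + η.2.1 • q + η.2.2 • r) : Function.Injective L := by
  rw [injective_iff_map_eq_zero]
  intro η h0
  rw [hL] at h0
  have e1 := congrArg (fun p : Base => p.1) h0
  have e2 := congrArg (fun p : Base => p.2.1) h0
  have e3 := congrArg (fun p : Base => p.2.2) h0
  simp at e1 e2 e3
  unfold det3 at h
  have a1 : η.1 = 0 := by
    apply (mul_eq_zero.1 (?_ : η.1 * _ = 0)).resolve_right h
    linear_combination (q.2.1 * r.2.2 - q.2.2 * r.2.1) * e1 - (q.1 * r.2.2 - q.2.2 * r.1) * e2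
      + (q.1 * r.2.1 - q.2.1 * r.1) * e3
  have a2 : η.2.1 = 0 := by
    apply (mul_eq_zero.1 (?_ : η.2.1 * _ = 0)).resolve_right h
    linear_combination -(p.2.1 * r.2.2 - p.2.2 * r.2.1) * e1 + (p.1 * r.2.2 - p.2.2 * r.1) * e2
      - (p.1 * r.2.1 - p.2.1 * r.1) * e3
  have a3 : η.2.2 = 0 := by
    apply (mul_eq_zero.1 (?_ : η.2.2 * _ = 0)).resolve_right h
    linear_combination (p.2.1 * q.2.2 - p.2.2 * q.2.1) * e1 - (p.1 * q.2.2 - p.2.2 * q.1) * e2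
      + (p.1 * q.2.1 - p.2.1 * q.1) * e3
  exact Prod.ext a1 (Prod.ext a2 a3)

/-- The first jets of the family of solutions, as linear maps. -/
noncomputable def jet (a b k c d : ℝ) : Base →L[ℝ] Fiber :=
  LinearMap.toContinuousLinearMap
    { toFun := fun η => (a * η.1 + b * η.2.1 + k * η.2.2, c * η.1 + k * η.2.1 + d * η.2.2)
      map_add' := fun η η' => by ext <;> simp <;> ring
      map_smul' := fun r η => by ext <;> simp <;> ring }

@[simp] theorem jet_apply (a b k c d : ℝ) (η : Base) : jet a b k c d η =
    (a * η.1 + b * η.2.1 + k * η.2.2, c * η.1 + k * η.2.1 + d * η.2.2) := rfl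

/-- Transversality and `k ≠ 0` are open conditions, so `b` = u_x and `k` = v_x can be varied
independently near a good jet. Later arguments compare coefficients in these two parameters. -/
theorem IsPointSymmetry.exists_jets {Φ : OpenPartialHomeomorph Total Total}
    (hΦ : IsPointSymmetry Φ) {z : Total} (hz : z ∈ Φ.source) :
    ∃ a b k c d δ : ℝ, 0 < δ ∧ ∀ b' k', |b' - b| < δ → |k' - k| < δ →
      k' ≠ 0 ∧ Function.Injective (baseMap Φ z (jet a b' k' c d)) := by
  set D := fderiv ℝ Φ z
  have hA : ∀ r : Base, ∃ w : Fin 5 → ℝ,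
      r = ∑ i, w i • (![(D et).1, (D ex).1, (D ey).1, (D eu).1, (D ev).1] : Fin 5 → Base) i := by
    intro r
    obtain ⟨w, hw⟩ := hΦ.fderiv_surjective hz (r, 0)
    refine ⟨![w.1.1, w.1.2.1, w.1.2.2, w.2.1, w.2.2], ?_⟩
    have : r = _ := (congrArg Prod.fst ((map_total D w).symm.trans hw)).symm
    rw [this]
    simp [Fin.sum_univ_succ, add_assoc]
  obtain ⟨a, b, k, c, d, h⟩ := exists_jet_det3_ne_zero hA
  let F : ℝ × ℝ → ℝ := fun q => det3 ((D et).1 + a • (D eu).1 + c • (D ev).1)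
    ((D ex).1 + q.1 • (D eu).1 + q.2 • (D ev).1) ((D ey).1 + q.2 • (D eu).1 + d • (D ev).1)
  have hF : Continuous F := by
    simp only [F, det3]; fun_prop
  have oF : IsOpen {q | F q ≠ 0} := isOpen_ne_fun hF continuous_const
  obtain ⟨δ, hδ, hball⟩ := Metric.isOpen_iff.1 oF (b, k) h
  have inj : ∀ b' k', F (b', k') ≠ 0 → Function.Injective (baseMap Φ z (jet a b' k' c d)) := by
    intro b' k' hF'
    refine injective_of_det3_ne_zero hF' fun η => ?_
    rw [baseMap_apply, jet_apply, map_total]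
    ext <;> simp [D] <;> ring
  -- The generic jet may have k = 0; a displacement by less than half the radius avoids this.
  obtain ⟨k₁, hk₁, hk₁0⟩ : ∃ k₁, |k₁ - k| < δ / 2 ∧ k₁ ≠ 0 := by
    by_cases hk : k = 0
    · exact ⟨δ / 4, by rw [hk, sub_zero, abs_of_pos (by positivity)]; linarith, by positivity⟩
    · exact ⟨k, by simpa using hδ, hk⟩
  refine ⟨a, b, k₁, c, d, min (δ / 2) |k₁|, lt_min (by positivity) (abs_pos.2 hk₁0),
    fun b' k' hb hk => ⟨?_, inj b' k' (hball ?_)⟩⟩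
  · rintro rfl
    have := hk.trans_le (min_le_right _ _)
    simp at this
  · rw [Metric.mem_ball, Prod.dist_eq, max_lt_iff, Real.dist_eq, Real.dist_eq]
    have h1 := hb.trans_le (min_le_left _ _)
    have h2 := hk.trans_le (min_le_left _ _)
    constructor
    · linarith
    · calc |k' - k| = |(k' - k₁) + (k₁ - k)| := by ring_nf
        _ ≤ _ := abs_add_le _ _
        _ < δ := by linarith

end BLP

/-! ### The triangular shape of the differential -/

namespace BLP

variable {Φ : OpenPartialHomeomorph Total Total}

/-- The second derivatives of the test solution enter the second equation for the image linearly,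
whereas everything else depends on the first jet only. Hence the five admissible variations must
drop out, which restricts the direction that is carried to the x̃-axis. -/
theorem IsPointSymmetry.second_order (hΦ : IsPointSymmetry Φ) {z : Total} (hz : z ∈ Φ.source)
    {a b k c d : ℝ} (hk : k ≠ 0) (hinj : Function.Injective (baseMap Φ z (jet a b k c d))) :
    (fderiv ℝ Φ z ((0, 1, 0), (b, k))).1.1 = 0 ∧ (fderiv ℝ Φ z ((0, 1, 0), (b, k))).1.2.2 = 0 ∧
    ∃ l : Base →L[ℝ] ℝ, (∀ η, (fderiv ℝ Φ z (η, jet a b k c d η)).2.2 =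
        l (fderiv ℝ Φ z (η, jet a b k c d η)).1) ∧
      (fderiv ℝ Φ z eu).2.2 = l (fderiv ℝ Φ z eu).1 := by
  obtain ⟨p₀, w₀⟩ := z
  obtain ⟨n, f, hf⟩ := exists_solutions_with_jet p₀ w₀ a b k c d hk
  set D := fderiv ℝ Φ (p₀, w₀) with hD
  have hjet : ∀ e, fderiv ℝ (f e) p₀ = jet a b k c d := fun e =>
    ContinuousLinearMap.ext fun η => (hf e).2.2.1 η
  have hsurj : Function.Surjective (baseMap Φ (p₀, w₀) (jet a b k c d)) :=
    (LinearMap.injective_iff_surjective (f := ((baseMap Φ (p₀, w₀) (jet a b k c d) :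
      Base →L[ℝ] Base) : Base →ₗ[ℝ] Base))).1 hinj
  -- The direction along the test solution that becomes the x̃-direction.
  obtain ⟨ξ, hξ⟩ := hsurj (0, 1, 0)
  have hsec : ∀ e, ∃ l : Base →L[ℝ] ℝ,
      (∀ η, (D (η, jet a b k c d η)).2.2 = l (D (η, jet a b k c d η)).1) ∧
      ∀ x, fderiv ℝ (fderiv ℝ Φ) (p₀, w₀) (ξ, jet a b k c d ξ) (ξ, jet a b k c d ξ)
          + D (0, fderiv ℝ (fderiv ℝ (f e)) p₀ ξ ξ) = x →
        x.2.2 - l x.1 = l (1, 0, 0) - 2 * (Φ (p₀, w₀)).2.1 * l (0, 1, 0) := by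
    intro e
    obtain ⟨⟨Ω, oΩ, hp, hsol⟩, h1, -, -⟩ := hf e
    have := hΦ.second_equation oΩ hp hsol (by rw [h1]; exact hz)
      (by rw [h1, hjet]; exact hinj)
    rw [h1, hjet] at this
    obtain ⟨l, hl, hl'⟩ := this
    exact ⟨l, hl, fun x => hl' ξ x hξ⟩
  obtain ⟨l, hl, hl0⟩ := hsec 0
  -- The image functional is determined by the first jet, so it is the same for all values of `e`.
  have hle : ∀ (l' : Base →L[ℝ] ℝ), (∀ η, (D (η, jet a b k c d η)).2.2 =
      l' (D (η, jet a b k c d η)).1) → l' = l := by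
    intro l' hl'
    refine ContinuousLinearMap.ext fun q => ?_
    obtain ⟨η, rfl⟩ := hsurj q
    exact (hl' η).symm.trans (hl η)
  -- The coefficients with which the second derivatives of u and v enter the equation. They are not
  -- both zero: otherwise every vector in the image of the differential would satisfy dṽ = l(dt̃,
  -- dx̃, dỹ), contrary to surjectivity.
  set m₁ := (D eu).2.2 - l (D eu).1 with hm₁
  set m₂ := (D ev).2.2 - l (D ev).1 with hm₂
  have hm : m₁ ≠ 0 ∨ m₂ ≠ 0 := by
    by_contra! hm
    obtain ⟨w, hw⟩ := hΦ.fderiv_surjective hz (0, (0, 1))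
    have h1 : D w = D (w.1, jet a b k c d w.1) + (w.2.1 - (jet a b k c d w.1).1) • D eu
        + (w.2.2 - (jet a b k c d w.1).2) • D ev := by
      rw [← map_smul, ← map_smul, ← map_add, ← map_add]
      congr 1
      ext <;> simp [eu, ev]
    have h2 : (D w).2.2 - l (D w).1 = 0 := by
      rw [h1]
      simp only [Prod.fst_add, Prod.snd_add, Prod.smul_fst, Prod.smul_snd, smul_eq_mul, map_add,
        map_smul, hl]
      linear_combination (w.2.1 - (jet a b k c d w.1).1) * (hm₁.symm.trans hm.1)
        + (w.2.2 - (jet a b k c d w.1).2) * (hm₂.symm.trans hm.2)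
    rw [hw] at h2
    simp at h2
  have hdiff : ∀ e : Fin 5 → ℝ, ∀ q : Fiber, fderiv ℝ (fderiv ℝ (f e)) p₀ ξ ξ
      - fderiv ℝ (fderiv ℝ (f 0)) p₀ ξ ξ = (2 : ℝ) • q → m₁ * q.1 + m₂ * q.2 = 0 := by
    intro e q hq
    obtain ⟨l', hl', hle'⟩ := hsec e
    rw [hle l' hl'] at hle'
    have h1 := hle' _ rfl
    have h0 := hl0 _ rfl
    have h2 : D (0, fderiv ℝ (fderiv ℝ (f e)) p₀ ξ ξ) = D (0, fderiv ℝ (fderiv ℝ (f 0)) p₀ ξ ξ)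
        + ((2 * q.1) • D eu + (2 * q.2) • D ev) := by
      rw [← map_smul, ← map_smul, ← map_add, ← map_add]
      congr 1
      rw [sub_eq_iff_eq_add.1 hq]
      ext <;> simp [eu, ev] <;> ring
    rw [h2] at h1
    simp only [Prod.fst_add, Prod.snd_add, Prod.smul_fst, Prod.smul_snd, smul_eq_mul, map_add,
      map_smul] at h1 h0
    rw [hm₁, hm₂]
    linear_combination (h1 - h0) / 2
  -- The variations along `e 4` and `e 3` exclude ξ_y ≠ 0, those along `e 0` and `e 2` exclude ξ_t ≠
  -- 0, each time because m₁ and m₂ would both vanish. With ξ along the x-axis and nonzero, the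
  -- variation along `e 1` gives m₁ = 0.
  have H : ∀ e : Fin 5 → ℝ, _ := fun e => hdiff e _ ((hf e).2.2.2 ξ)
  have H0 := H ![1, 0, 0, 0, 0]
  have H1 := H ![0, 1, 0, 0, 0]
  have H2 := H ![0, 0, 1, 0, 0]
  have H3 := H ![0, 0, 0, 1, 0]
  have H4 := H ![0, 0, 0, 0, 1]
  simp at H0 H1 H2 H3 H4
  have hξy : ξ.2.2 = 0 := by
    by_contra hne
    have hm2 : m₂ = 0 := H4.resolve_right hne
    rw [hm2] at H3
    simp [hk, hne] at H3
    exact hm.elim (· H3) (· hm2)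
  have hξt : ξ.1 = 0 := by
    by_contra hne
    have hm1 : m₁ = 0 := by
      rcases H0 with h | h
      · exact h
      · simp [hk, hne] at h
    rw [hm1] at H2
    simp [hne] at H2
    exact hm.elim (· hm1) (· H2)
  have hξe : ξ = ξ.2.1 • (0, 1, 0) := by ext <;> simp [hξt, hξy]
  have hbase : baseMap Φ (p₀, w₀) (jet a b k c d) ξ = ξ.2.1 • (D ((0, 1, 0), (b, k))).1 := by
    rw [hξe, map_smul, baseMap_apply, jet_apply]
    simp [D]
  rw [hξ] at hbase
  have hx : ξ.2.1 ≠ 0 := by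
    intro h
    rw [h, zero_smul] at hbase
    simp at hbase
  have hb1 := congrArg (fun p : Base => p.1) hbase
  have hb3 := congrArg (fun p : Base => p.2.2) hbase
  simp [hx] at hb1 hb3
  refine ⟨hb1, hb3, l, hl, ?_⟩
  have : m₁ = 0 := by
    rcases H1 with h | h
    · exact h
    · simp [hk, hx] at h
  linarith

/-- `t̃` and `ỹ` depend on `t` and `y` only, and `x̃` and `ṽ` do not depend on `u`. -/
theorem IsPointSymmetry.triangular (hΦ : IsPointSymmetry Φ) {z : Total} (hz : z ∈ Φ.source) :
    ((fderiv ℝ Φ z ex).1.1 = 0 ∧ (fderiv ℝ Φ z eu).1.1 = 0 ∧ (fderiv ℝ Φ z ev).1.1 = 0) ∧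
    ((fderiv ℝ Φ z ex).1.2.2 = 0 ∧ (fderiv ℝ Φ z eu).1.2.2 = 0 ∧ (fderiv ℝ Φ z ev).1.2.2 = 0) ∧
    (fderiv ℝ Φ z eu).1.2.1 = 0 ∧ (fderiv ℝ Φ z eu).2.2 = 0 := by
  obtain ⟨a, b, k, c, d, δ, hδ, hjets⟩ := hΦ.exists_jets hz
  set D := fderiv ℝ Φ z with hD
  have hδ2 : |δ / 2| < δ := by rw [abs_of_pos (by positivity)]; linarith
  have hex : ∀ b k : ℝ, D ((0, 1, 0), (b, k)) = D ex + b • D eu + k • D ev := by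
    intro b k
    rw [map_total]; simp
  -- Three jets suffice: the base one, one with `b` moved and one with `k` moved. Differences
  -- separate the coefficients of `eu` and `ev`.
  have S : ∀ b' k', |b' - b| < δ → |k' - k| < δ → _ := fun b' k' h h' =>
    hΦ.second_order hz (hjets b' k' h h').1 (hjets b' k' h h').2
  obtain ⟨t0, y0, l0, hl0, hm0⟩ := S b k (by simpa) (by simpa)
  obtain ⟨t1, y1, -⟩ := S (b + δ / 2) k (by simpa using hδ2) (by simpa)
  obtain ⟨t2, y2, l2, hl2, hm2⟩ := S b (k + δ / 2) (by simpa) (by simpa using hδ2)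
  replace hl0 := hl0 (0, 1, 0)
  replace hl2 := hl2 (0, 1, 0)
  simp only [jet_apply, ← hD] at hl0 hl2 hm0 hm2 t0 t1 t2 y0 y1 y2
  norm_num at hl0 hl2
  rw [hex] at hl0 hl2 t0 t1 t2 y0 y1 y2
  simp only [Prod.fst_add, Prod.snd_add, Prod.smul_fst, Prod.smul_snd, smul_eq_mul, map_add,
    map_smul] at hl0 hl2 t0 t1 t2 y0 y1 y2
  have hδ0 : δ / 2 ≠ 0 := by positivity
  have tu : (D eu).1.1 = 0 := by
    apply (mul_eq_zero.1 (?_ : (δ / 2) * _ = 0)).resolve_left hδ0; linarith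
  have tv : (D ev).1.1 = 0 := by
    apply (mul_eq_zero.1 (?_ : (δ / 2) * _ = 0)).resolve_left hδ0; linarith
  have tx : (D ex).1.1 = 0 := by rw [tu, tv] at t0; linarith
  have yu : (D eu).1.2.2 = 0 := by
    apply (mul_eq_zero.1 (?_ : (δ / 2) * _ = 0)).resolve_left hδ0; linarith
  have yv : (D ev).1.2.2 = 0 := by
    apply (mul_eq_zero.1 (?_ : (δ / 2) * _ = 0)).resolve_left hδ0; linarith
  have yx : (D ex).1.2.2 = 0 := by rw [yu, yv] at y0; linarith
  refine ⟨⟨tx, tu, tv⟩, ⟨yx, yu, yv⟩, ?_⟩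
  have eU : (D eu).1 = (D eu).1.2.1 • (0, 1, 0) := by ext <;> simp [tu, yu]
  have eX : (D ex).1 = (D ex).1.2.1 • (0, 1, 0) := by ext <;> simp [tx, yx]
  have eV : (D ev).1 = (D ev).1.2.1 • (0, 1, 0) := by ext <;> simp [tv, yv]
  rw [eU, eX, eV] at hl0 hl2
  rw [eU] at hm0 hm2
  simp only [map_smul, smul_eq_mul] at hl0 hl2 hm0 hm2
  set Xx := (D ex).1.2.1
  set Xu := (D eu).1.2.1
  set Xv := (D ev).1.2.1
  set Vx := (D ex).2.2
  set Vu := (D eu).2.2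
  set Vv := (D ev).2.2
  -- Eliminating the slope l(0,1,0) shows that (Xu, Vu) is parallel to (Xx + kXv, Vx + kVv), for two
  -- values of k.
  have r0 : Xu * (Vx + k * Vv) = Vu * (Xx + k * Xv) := by
    rw [hm0] at hl0 ⊢
    linear_combination Xu * hl0
  have r2 : Xu * (Vx + (k + δ / 2) * Vv) = Vu * (Xx + (k + δ / 2) * Xv) := by
    rw [hm2] at hl2 ⊢
    linear_combination Xu * hl2
  have rv : Xu * Vv = Vu * Xv := by
    apply mul_left_cancel₀ hδ0; linear_combination r2 - r0
  have rx : Xu * Vx = Vu * Xx := by linear_combination r0 - k * rv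
  have inj := hΦ.fderiv_injective hz
  rw [injective_iff_map_eq_zero] at inj
  rw [← hD] at inj
  -- Under these relations α·ex − βx·eu and α·ev − βv·eu are both carried into the ũ-axis. So a
  -- combination of them lies in the kernel of the injective differential, which is possible only
  -- for α = 0. It is applied with α = Xu and with α = Vu.
  have main : ∀ α βx βv : ℝ, α * Xx = βx * Xu → α * Vx = βx * Vu → α * Xv = βv * Xu →
      α * Vv = βv * Vu → α = 0 := by
    intro α βx βv h1 h2 h3 h4
    have d1 : ∀ r s : ℝ, r * (α * (D ex).2.1 - βx * (D eu).2.1)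
        + s * (α * (D ev).2.1 - βv * (D eu).2.1) = 0 → r * α = 0 ∧ s * α = 0 := by
      intro r s hrs
      have := inj ((0, r * α, 0), (-(r * βx) - s * βv, s * α)) (by
        rw [map_total]
        ext
        · simp [tx, tu, tv]
        · simp only [Prod.fst_add, Prod.snd_add, Prod.smul_fst, Prod.smul_snd, smul_eq_mul]
          simp only [Prod.fst_zero, Prod.snd_zero]
          linear_combination r * h1 + s * h3
        · simp [yx, yu, yv]
        · simp only [Prod.fst_add, Prod.snd_add, Prod.smul_fst, Prod.smul_snd, smul_eq_mul]
          simp only [Prod.fst_zero, Prod.snd_zero]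
          linear_combination hrs
        · simp only [Prod.snd_add, Prod.smul_snd, smul_eq_mul]
          simp only [Prod.snd_zero]
          linear_combination r * h2 + s * h4)
      simp only [Prod.mk_eq_zero] at this
      exact ⟨this.1.2.1, this.2.2⟩
    by_contra hα
    have h5 := d1 (α * (D ev).2.1 - βv * (D eu).2.1) (-(α * (D ex).2.1 - βx * (D eu).2.1)) (by ring)
    have h6 := (mul_eq_zero.1 h5.1).resolve_right hα
    have h7 := d1 0 1 (by rw [h6]; ring)
    exact hα (by simpa using h7.2)
  exact ⟨main Xu Xx Xv (by ring) (by linear_combination rx) (by ring) (by linear_combination rv),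
    main Vu Vx Vv (by linear_combination -rx) (by ring) (by linear_combination -rv) (by ring)⟩

end BLP

/-! ### The second equation in coordinates -/

namespace BLP

variable {Φ : OpenPartialHomeomorph Total Total}

/-- The coordinate functionals on the space of all variables. -/
noncomputable def πt : Total →L[ℝ] ℝ :=
  (ContinuousLinearMap.fst ℝ ℝ (ℝ × ℝ)).comp (ContinuousLinearMap.fst ℝ Base Fiber)
noncomputable def πx : Total →L[ℝ] ℝ :=
  ((ContinuousLinearMap.fst ℝ ℝ ℝ).comp (ContinuousLinearMap.snd ℝ ℝ (ℝ × ℝ))).comp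
    (ContinuousLinearMap.fst ℝ Base Fiber)
noncomputable def πy : Total →L[ℝ] ℝ :=
  ((ContinuousLinearMap.snd ℝ ℝ ℝ).comp (ContinuousLinearMap.snd ℝ ℝ (ℝ × ℝ))).comp
    (ContinuousLinearMap.fst ℝ Base Fiber)
noncomputable def πu : Total →L[ℝ] ℝ :=
  (ContinuousLinearMap.fst ℝ ℝ ℝ).comp (ContinuousLinearMap.snd ℝ Base Fiber)
noncomputable def πv : Total →L[ℝ] ℝ :=
  (ContinuousLinearMap.snd ℝ ℝ ℝ).comp (ContinuousLinearMap.snd ℝ Base Fiber)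

@[simp] theorem πt_apply (z : Total) : πt z = z.1.1 := rfl
@[simp] theorem πx_apply (z : Total) : πx z = z.1.2.1 := rfl
@[simp] theorem πy_apply (z : Total) : πy z = z.1.2.2 := rfl
@[simp] theorem πu_apply (z : Total) : πu z = z.2.1 := rfl
@[simp] theorem πv_apply (z : Total) : πv z = z.2.2 := rfl

theorem dd_clm_comp {E F G : Type*} [NormedAddCommGroup E] [NormedSpace ℝ E]
    [NormedAddCommGroup F] [NormedSpace ℝ F] [NormedAddCommGroup G] [NormedSpace ℝ G]
    (π : F →L[ℝ] G) {H : E → F} {z : E} (hH : DifferentiableAt ℝ H z) (w : E) :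
    dd w (fun q => π (H q)) z = π (fderiv ℝ H z w) := by
  rw [dd_comp π.differentiableAt hH, π.fderiv]; rfl

theorem dd_dd_clm_comp {E F G : Type*} [NormedAddCommGroup E] [NormedSpace ℝ E]
    [NormedAddCommGroup F] [NormedSpace ℝ F] [NormedAddCommGroup G] [NormedSpace ℝ G]
    (π : F →L[ℝ] G) {H : E → F} {Ω : Set E} (hΩ : IsOpen Ω) (hH : ContDiffOn ℝ ∞ H Ω) {z : E}
    (hz : z ∈ Ω) (w w' : E) :
    dd w (dd w' (fun q => π (H q))) z = π (fderiv ℝ (fderiv ℝ H) z w w') := by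
  rw [dd_congr hΩ (h := fun q => π (dd w' H q))
    (fun q hq => dd_clm_comp π (differentiableAt_of_open hΩ hH hq) w') hz,
    dd_clm_comp π (differentiableAt_of_open hΩ (contDiffOn_dd hΩ hH w') hz)]
  congr 1
  exact dd_dd_eq (contDiffAt_of_open hΩ hH hz) w w'

/-- The coordinate `π` of the map `Φ`. -/
noncomputable def comp (π : Total →L[ℝ] ℝ) (Φ : OpenPartialHomeomorph Total Total) : Total → ℝ :=
  fun z => π (Φ z)

theorem IsPointSymmetry.contDiffOn_comp (hΦ : IsPointSymmetry Φ) (π : Total →L[ℝ] ℝ) :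
    ContDiffOn ℝ ∞ (comp π Φ) Φ.source := π.contDiff.comp_contDiffOn hΦ.smooth

theorem IsPointSymmetry.dd_comp_eq (hΦ : IsPointSymmetry Φ) (π : Total →L[ℝ] ℝ) {z : Total}
    (hz : z ∈ Φ.source) (w : Total) : dd w (comp π Φ) z = π (fderiv ℝ Φ z w) :=
  dd_clm_comp π (differentiableAt_of_open Φ.open_source hΦ.smooth hz) w

theorem IsPointSymmetry.dd_dd_comp_eq (hΦ : IsPointSymmetry Φ) (π : Total →L[ℝ] ℝ) {z : Total}
    (hz : z ∈ Φ.source) (w w' : Total) :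
    dd w (dd w' (comp π Φ)) z = π (fderiv ℝ (fderiv ℝ Φ) z w w') :=
  dd_dd_clm_comp π Φ.open_source hΦ.smooth hz w w'

theorem IsPointSymmetry.triangular' (hΦ : IsPointSymmetry Φ) {z : Total} (hz : z ∈ Φ.source) :
    (dd ex (comp πt Φ) z = 0 ∧ dd eu (comp πt Φ) z = 0 ∧ dd ev (comp πt Φ) z = 0) ∧
    (dd ex (comp πy Φ) z = 0 ∧ dd eu (comp πy Φ) z = 0 ∧ dd ev (comp πy Φ) z = 0) ∧
    dd eu (comp πx Φ) z = 0 ∧ dd eu (comp πv Φ) z = 0 := by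
  simp only [hΦ.dd_comp_eq _ hz]
  exact hΦ.triangular hz

theorem dd_eq_zero_of_eqOn {E F : Type*} [NormedAddCommGroup E] [NormedSpace ℝ E]
    [NormedAddCommGroup F] [NormedSpace ℝ F] {g : E → F} {Ω : Set E} (hΩ : IsOpen Ω)
    (hg : ∀ z ∈ Ω, g z = 0) {z : E} (hz : z ∈ Ω) (w : E) : dd w g z = 0 := by
  rw [dd_congr hΩ (h := fun _ => 0) hg hz, dd_const]

theorem IsPointSymmetry.coord_fderiv (hΦ : IsPointSymmetry Φ) {z : Total} (hz : z ∈ Φ.source)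
    (π : Total →L[ℝ] ℝ) (w : Total) : π (fderiv ℝ Φ z w) =
      w.1.1 * dd et (comp π Φ) z + w.1.2.1 * dd ex (comp π Φ) z + w.1.2.2 * dd ey (comp π Φ) z
        + w.2.1 * dd eu (comp π Φ) z + w.2.2 * dd ev (comp π Φ) z := by
  rw [map_total (fderiv ℝ Φ z) w]
  simp only [hΦ.dd_comp_eq _ hz, map_add, map_smul, smul_eq_mul]

/-- The differential is block triangular with diagonal blocks in (t,y) and (x,v); surjectivity makes
both blocks invertible. The determinant identities are evaluated on preimages of coordinate vectors.
-/
theorem IsPointSymmetry.minors_ne_zero (hΦ : IsPointSymmetry Φ) {z : Total} (hz : z ∈ Φ.source) :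
    dd et (comp πt Φ) z * dd ey (comp πy Φ) z - dd ey (comp πt Φ) z * dd et (comp πy Φ) z ≠ 0 ∧
    dd ex (comp πx Φ) z * dd ev (comp πv Φ) z - dd ev (comp πx Φ) z * dd ex (comp πv Φ) z ≠ 0 := by
  obtain ⟨⟨tx, tu, tv⟩, ⟨yx, yu, yv⟩, xu, vu⟩ := hΦ.triangular' hz
  have hc := hΦ.coord_fderiv hz
  have hS := hΦ.fderiv_surjective hz
  have hJ : dd et (comp πt Φ) z * dd ey (comp πy Φ) z
      - dd ey (comp πt Φ) z * dd et (comp πy Φ) z ≠ 0 := by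
    obtain ⟨w, hw⟩ := hS ((1, 0, 0), (0, 0))
    obtain ⟨w', hw'⟩ := hS ((0, 0, 1), (0, 0))
    have a1 := hc πt w
    have a2 := hc πy w
    have a3 := hc πt w'
    have a4 := hc πy w'
    rw [hw] at a1 a2
    rw [hw'] at a3 a4
    simp only [tx, tu, tv, yx, yu, yv, πt_apply, πy_apply] at a1 a2 a3 a4
    intro h
    have : (0 : ℝ) = 1 := by
      linear_combination (-(w.1.1 * w'.1.2.2 - w.1.2.2 * w'.1.1)) * h
        - (w'.1.1 * dd et (comp πy Φ) z + w'.1.2.2 * dd ey (comp πy Φ) z) * a1 - a4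
        + (w'.1.1 * dd et (comp πt Φ) z + w'.1.2.2 * dd ey (comp πt Φ) z) * a2
    norm_num at this
  refine ⟨hJ, ?_⟩
  have hz0 : ∀ w : Total, πt (fderiv ℝ Φ z w) = 0 → πy (fderiv ℝ Φ z w) = 0 →
      w.1.1 = 0 ∧ w.1.2.2 = 0 := by
    intro w h1 h2
    rw [hc] at h1 h2
    simp only [tx, tu, tv, yx, yu, yv] at h1 h2
    constructor
    · apply (mul_eq_zero.1 (?_ : _ * w.1.1 = 0)).resolve_left hJ
      linear_combination dd ey (comp πy Φ) z * h1 - dd ey (comp πt Φ) z * h2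
    · apply (mul_eq_zero.1 (?_ : _ * w.1.2.2 = 0)).resolve_left hJ
      linear_combination -dd et (comp πy Φ) z * h1 + dd et (comp πt Φ) z * h2
  obtain ⟨w, hw⟩ := hS ((0, 1, 0), (0, 0))
  obtain ⟨w', hw'⟩ := hS ((0, 0, 0), (0, 1))
  obtain ⟨b1, b2⟩ := hz0 w (by rw [hw]; simp) (by rw [hw]; simp)
  obtain ⟨b3, b4⟩ := hz0 w' (by rw [hw']; simp) (by rw [hw']; simp)
  have a1 := hc πx w
  have a2 := hc πv w
  have a3 := hc πx w'
  have a4 := hc πv w'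
  rw [hw] at a1 a2
  rw [hw'] at a3 a4
  simp only [xu, vu, πx_apply, πv_apply, b1, b2, b3, b4] at a1 a2 a3 a4
  intro h
  have : (0 : ℝ) = 1 := by
    linear_combination (-(w.1.2.1 * w'.2.2 - w.2.2 * w'.1.2.1)) * h
      - (w'.1.2.1 * dd ex (comp πv Φ) z + w'.2.2 * dd ev (comp πv Φ) z) * a1 - a4
      + (w'.1.2.1 * dd ex (comp πx Φ) z + w'.2.2 * dd ev (comp πx Φ) z) * a2
  norm_num at this

/-- The second equation of the system, written in terms of the coordinates of `Φ`. -/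
theorem IsPointSymmetry.second_equation_coords (hΦ : IsPointSymmetry Φ) {z : Total}
    (hz : z ∈ Φ.source) {k r : ℝ} (hk : k ≠ 0)
    (hr : dd ex (comp πx Φ) z + k * dd ev (comp πx Φ) z = r) (hr0 : r ≠ 0) (c d : ℝ) :
    ∃ τ q υ : ℝ,
      dd ex (comp πv Φ) z + k * dd ev (comp πv Φ) z = q * r ∧
      dd et (comp πv Φ) z + c * dd ev (comp πv Φ) z = τ * dd et (comp πt Φ) z
        + q * (dd et (comp πx Φ) z + c * dd ev (comp πx Φ) z) + υ * dd et (comp πy Φ) z ∧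
      dd ey (comp πv Φ) z + d * dd ev (comp πv Φ) z = τ * dd ey (comp πt Φ) z
        + q * (dd ey (comp πx Φ) z + d * dd ev (comp πx Φ) z) + υ * dd ey (comp πy Φ) z ∧
      r ^ 2 * (τ - 2 * (Φ z).2.1 * q) =
        (dd ex (dd ex (comp πv Φ)) z + 2 * k * dd ex (dd ev (comp πv Φ)) z
          + k ^ 2 * dd ev (dd ev (comp πv Φ)) z + (c - 2 * z.2.1 * k) * dd ev (comp πv Φ) z)
        - q * (dd ex (dd ex (comp πx Φ)) z + 2 * k * dd ex (dd ev (comp πx Φ)) z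
          + k ^ 2 * dd ev (dd ev (comp πx Φ)) z + (c - 2 * z.2.1 * k) * dd ev (comp πx Φ) z) := by
  obtain ⟨p₀, w₀⟩ := z
  obtain ⟨n, F, hF⟩ := exists_solutions_with_jet p₀ w₀ 0 0 k c d hk
  obtain ⟨⟨Ω, oΩ, hp, hsol⟩, hval, hder, -⟩ := hF 0
  generalize F 0 = f at *
  clear hF
  have hjet : fderiv ℝ f p₀ = jet 0 0 k c d := ContinuousLinearMap.ext hder
  have hT := hΦ.triangular' hz
  obtain ⟨⟨tx, tu, tv⟩, ⟨yx, yu, yv⟩, xu, vu⟩ := hT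
  have hc := hΦ.coord_fderiv hz
  have hJ := (hΦ.minors_ne_zero hz).1
  have hinj : Function.Injective (baseMap Φ (p₀, w₀) (jet 0 0 k c d)) := by
    rw [injective_iff_map_eq_zero]
    intro η h0
    have e1 := hc πt (η, jet 0 0 k c d η)
    have e2 := hc πx (η, jet 0 0 k c d η)
    have e3 := hc πy (η, jet 0 0 k c d η)
    rw [baseMap_apply] at h0
    rw [πt_apply, h0] at e1
    rw [πx_apply, h0] at e2
    rw [πy_apply, h0] at e3
    simp only [tx, tu, tv, yx, yu, yv, xu, jet_apply,
      Prod.fst_zero, Prod.snd_zero] at e1 e2 e3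
    have a1 : η.1 = 0 := by
      apply (mul_eq_zero.1 (?_ : _ * η.1 = 0)).resolve_left hJ
      linear_combination -dd ey (comp πy Φ) (p₀, w₀) * e1 + dd ey (comp πt Φ) (p₀, w₀) * e3
    have a3 : η.2.2 = 0 := by
      apply (mul_eq_zero.1 (?_ : _ * η.2.2 = 0)).resolve_left hJ
      linear_combination dd et (comp πy Φ) (p₀, w₀) * e1 - dd et (comp πt Φ) (p₀, w₀) * e3
    have a2 : η.2.1 = 0 := by
      apply (mul_eq_zero.1 (?_ : r * η.2.1 = 0)).resolve_left hr0
      rw [a1, a3] at e2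
      rw [← hr]
      linear_combination -e2
    exact Prod.ext a1 (Prod.ext a2 a3)
  have hsec := hΦ.second_equation oΩ hp hsol (by rw [hval]; exact hz)
    (by rw [hval, hjet]; exact hinj)
  rw [hval, hjet] at hsec
  obtain ⟨l, hl, hl2⟩ := hsec
  have hl' : ∀ s : Base, l s = s.1 * l (1, 0, 0) + s.2.1 * l (0, 1, 0) + s.2.2 * l (0, 0, 1) := by
    intro s
    have : s = s.1 • ((1, 0, 0) : Base) + s.2.1 • ((0, 1, 0) : Base)
        + s.2.2 • ((0, 0, 1) : Base) := by simp
    conv_lhs => rw [this]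
    simp only [map_add, map_smul, smul_eq_mul]
  have hl3 : ∀ η : Base, πv (fderiv ℝ Φ (p₀, w₀) (η, jet 0 0 k c d η)) =
      πt (fderiv ℝ Φ (p₀, w₀) (η, jet 0 0 k c d η)) * l (1, 0, 0)
      + πx (fderiv ℝ Φ (p₀, w₀) (η, jet 0 0 k c d η)) * l (0, 1, 0)
      + πy (fderiv ℝ Φ (p₀, w₀) (η, jet 0 0 k c d η)) * l (0, 0, 1) :=
    fun η => (hl η).trans (hl' _)
  simp only [hc, tx, tu, tv, yx, yu, yv, xu, vu, jet_apply] at hl3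
  have H1 := hl3 (1, 0, 0)
  have H2 := hl3 (0, 1, 0)
  have H3 := hl3 (0, 0, 1)
  norm_num at H1 H2 H3
  -- τ, q, υ are the derivatives of the image solution ṽ in t̃, x̃, ỹ, and `r` is the total
  -- x-derivative of x̃; so r⁻¹ times the x-direction is carried to the x̃-direction.
  refine ⟨l (1, 0, 0), l (0, 1, 0), l (0, 0, 1), ?_, ?_, ?_, ?_⟩
  · rw [H2, ← hr]; ring
  · rw [H1]; ring
  · rw [H3]; ring
  · have h1 : (fderiv ℝ Φ (p₀, w₀) (((0, r⁻¹, 0) : Base), jet 0 0 k c d (0, r⁻¹, 0))).1 =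
        (0, 1, 0) := by
      have e1 := hc πt ((0, r⁻¹, 0), jet 0 0 k c d (0, r⁻¹, 0))
      have e2 := hc πx ((0, r⁻¹, 0), jet 0 0 k c d (0, r⁻¹, 0))
      have e3 := hc πy ((0, r⁻¹, 0), jet 0 0 k c d (0, r⁻¹, 0))
      simp only [πt_apply, πx_apply, πy_apply, tx, tu, tv, yx, yu, yv, xu, jet_apply] at e1 e2 e3
      refine Prod.ext ?_ (Prod.ext ?_ ?_)
      · simpa using e1
      · rw [jet_apply]
        refine e2.trans ?_
        have : r⁻¹ * (dd ex (comp πx Φ) (p₀, w₀) + k * dd ev (comp πx Φ) (p₀, w₀)) = 1 := by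
          rw [hr]; exact inv_mul_cancel₀ hr0
        linear_combination this
      · simpa using e3
    have h2 := hl2 _ _ h1 rfl
    set a := fderiv ℝ (fderiv ℝ Φ) (p₀, w₀) (((0, r⁻¹, 0) : Base), jet 0 0 k c d (0, r⁻¹, 0))
      (((0, r⁻¹, 0) : Base), jet 0 0 k c d (0, r⁻¹, 0)) + fderiv ℝ Φ (p₀, w₀)
      (0, fderiv ℝ (fderiv ℝ f) p₀ (0, r⁻¹, 0) (0, r⁻¹, 0)) with ha
    have hxi : (((0, r⁻¹, 0) : Base), jet 0 0 k c d (0, r⁻¹, 0)) = r⁻¹ • (ex + k • ev) := by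
      rw [jet_apply]
      ext <;> simp [ex, ev]; ring
    have sf : ContDiffAt ℝ ∞ f p₀ := contDiffAt_of_open oΩ hsol.smooth hp
    -- The test solution satisfies the second equation itself, which expresses v_xx through v_t = c,
    -- u and v_x = k.
    have hvxx : (fderiv ℝ (fderiv ℝ f) p₀ (0, 1, 0) (0, 1, 0)).2 = c - 2 * w₀.1 * k := by
      have e1 := hsol.eq_v p₀ hp
      have e2 : dx (dx fun q => (f q).2) p₀ = (fderiv ℝ (fderiv ℝ f) p₀ (0, 1, 0) (0, 1, 0)).2 :=
        dd_dd_clm_comp (ContinuousLinearMap.snd ℝ ℝ ℝ) oΩ hsol.smooth hp _ _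
      have e3 : ∀ w, dd w (fun q => (f q).2) p₀ = (fderiv ℝ f p₀ w).2 := fun w =>
        dd_clm_comp (ContinuousLinearMap.snd ℝ ℝ ℝ) (sf.differentiableAt (by simp)) w
      rw [e2, dt_eq, dx_eq, e3, e3, hjet, jet_apply, jet_apply, hval] at e1
      simp at e1
      linarith
    have hπ : ∀ π : Total →L[ℝ] ℝ, dd eu (comp π Φ) (p₀, w₀) = 0 → π a = r⁻¹ ^ 2 *
        (dd ex (dd ex (comp π Φ)) (p₀, w₀) + 2 * k * dd ex (dd ev (comp π Φ)) (p₀, w₀)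
          + k ^ 2 * dd ev (dd ev (comp π Φ)) (p₀, w₀)
          + (c - 2 * w₀.1 * k) * dd ev (comp π Φ) (p₀, w₀)) := by
      intro π hu
      have hff : (0, fderiv ℝ (fderiv ℝ f) p₀ (0, r⁻¹, 0) (0, r⁻¹, 0)) =
          r⁻¹ ^ 2 • (((0 : Base), fderiv ℝ (fderiv ℝ f) p₀ (0, 1, 0) (0, 1, 0)) : Total) := by
        have : ((0, r⁻¹, 0) : Base) = r⁻¹ • (0, 1, 0) := by simp
        rw [this, map_smul, map_smul, smul_apply, smul_smul, ← pow_two]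
        ext <;> simp
      rw [ha, hxi, hff]
      simp only [map_add, map_smul, smul_apply, add_apply,
        smul_eq_mul, ← hΦ.dd_dd_comp_eq π hz, hc, hu]
      rw [hvxx, dd_comm Φ.open_source (hΦ.contDiffOn_comp π) hz ev ex]
      simp
      ring
    have z2 : ∀ (π : Total →L[ℝ] ℝ), (∀ z ∈ Φ.source, dd ex (comp π Φ) z = 0 ∧
        dd eu (comp π Φ) z = 0 ∧ dd ev (comp π Φ) z = 0) → π a = 0 := by
      intro π h
      rw [hπ π (h _ hz).2.1, dd_eq_zero_of_eqOn Φ.open_source (fun z hz => (h z hz).1) hz,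
        dd_eq_zero_of_eqOn Φ.open_source (fun z hz => (h z hz).2.2) hz,
        dd_eq_zero_of_eqOn Φ.open_source (fun z hz => (h z hz).2.2) hz, (h _ hz).2.2]
      ring
    have b1 : a.1.1 = 0 := z2 πt fun z hz => (hΦ.triangular' hz).1
    have b3 : a.1.2.2 = 0 := z2 πy fun z hz => (hΦ.triangular' hz).2.1
    have b2 : a.1.2.1 = _ := hπ πx xu
    have b4 : a.2.2 = _ := hπ πv vu
    rw [hl' a.1, b1, b3, b2, b4] at h2
    field_simp at h2
    linear_combination -h2

end BLP

/-! ### Consequences of the second equation -/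

namespace BLP

variable {Φ : OpenPartialHomeomorph Total Total}

/-- Three test solutions with the same k are compared. Changing v_y alone leaves q and τ fixed and
moves only υ, which forces ỹ_t = 0. Changing v_t alone moves both sides of the equation by the same
amount and gives r² = t̃_t. As r = x̃_x + k x̃_v for every admissible k, a cubic polynomial in k
vanishes, and so x̃_v = 0. -/
theorem IsPointSymmetry.coords_first (hΦ : IsPointSymmetry Φ) {z : Total} (hz : z ∈ Φ.source) :
    dd et (comp πy Φ) z = 0 ∧ dd ev (comp πx Φ) z = 0 ∧ dd ex (comp πx Φ) z ≠ 0 ∧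
      dd ex (comp πx Φ) z ^ 2 = dd et (comp πt Φ) z := by
  have hΔ := (hΦ.minors_ne_zero hz).2
  have key : ∀ k r : ℝ, k ≠ 0 → dd ex (comp πx Φ) z + k * dd ev (comp πx Φ) z = r → r ≠ 0 →
      dd et (comp πy Φ) z = 0 ∧ r ^ 2 = dd et (comp πt Φ) z := by
    intro k r hk hr hr0
    obtain ⟨τ, q, υ, h1, h2, h3, h4⟩ := hΦ.second_equation_coords hz hk hr hr0 0 0
    obtain ⟨τ', q', υ', h1', h2', h3', h4'⟩ := hΦ.second_equation_coords hz hk hr hr0 0 1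
    obtain ⟨τ'', q'', υ'', h1'', h2'', h3'', h4''⟩ := hΦ.second_equation_coords hz hk hr hr0 1 0
    have hq' : q' = q := mul_right_cancel₀ hr0 (h1'.symm.trans h1)
    have hq'' : q'' = q := mul_right_cancel₀ hr0 (h1''.symm.trans h1)
    subst hq' hq''
    have hτ : τ' = τ := by
      have : r ^ 2 * (τ' - 2 * (Φ z).2.1 * q'') = r ^ 2 * (τ - 2 * (Φ z).2.1 * q'') :=
        h4'.trans h4.symm
      have := mul_left_cancel₀ (pow_ne_zero 2 hr0) this
      linarith
    subst hτ
    have hne : dd ev (comp πv Φ) z - q'' * dd ev (comp πx Φ) z ≠ 0 := by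
      intro h
      apply hΔ
      have h5 : dd ev (comp πv Φ) z = q'' * dd ev (comp πx Φ) z := by linarith
      rw [h5] at h1 ⊢
      linear_combination -dd ev (comp πx Φ) z * h1 + q'' * dd ev (comp πx Φ) z * hr
    have hy : dd et (comp πy Φ) z = 0 := by
      have e1 : (υ' - υ) * dd et (comp πy Φ) z = 0 := by linear_combination h2 - h2'
      have e2 : (υ' - υ) * dd ey (comp πy Φ) z =
          dd ev (comp πv Φ) z - q'' * dd ev (comp πx Φ) z := by linear_combination h3 - h3'
      rcases mul_eq_zero.1 e1 with h | h
      · rw [h, zero_mul] at e2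
        exact absurd e2.symm hne
      · exact h
    refine ⟨hy, ?_⟩
    rw [hy] at h2 h2''
    have e1 : (τ'' - τ') * dd et (comp πt Φ) z =
        dd ev (comp πv Φ) z - q'' * dd ev (comp πx Φ) z := by linear_combination h2 - h2''
    have e2 : (τ'' - τ') * r ^ 2 =
        dd ev (comp πv Φ) z - q'' * dd ev (comp πx Φ) z := by linear_combination h4'' - h4
    have e3 : τ'' - τ' ≠ 0 := by
      intro h
      rw [h, zero_mul] at e1
      exact hne e1.symm
    exact mul_left_cancel₀ e3 (e2.trans e1.symm)
  have cub : ∀ k : ℝ, k ≠ 0 → (dd ex (comp πx Φ) z + k * dd ev (comp πx Φ) z) *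
      ((dd ex (comp πx Φ) z + k * dd ev (comp πx Φ) z) ^ 2 - dd et (comp πt Φ) z) = 0 := by
    intro k hk
    by_cases h : dd ex (comp πx Φ) z + k * dd ev (comp πx Φ) z = 0
    · rw [h, zero_mul]
    · rw [(key k _ hk rfl h).2, sub_self, mul_zero]
  have hv : dd ev (comp πx Φ) z = 0 := by
    -- The third finite difference of the cubic isolates six times its leading coefficient x̃_v³.
    have c1 := cub 1 (by norm_num)
    have c2 := cub 2 (by norm_num)
    have c3 := cub 3 (by norm_num)
    have c4 := cub 4 (by norm_num)
    have : dd ev (comp πx Φ) z ^ 3 = 0 := by linear_combination (c4 - 3 * c3 + 3 * c2 - c1) / 6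
    exact pow_eq_zero_iff (by norm_num) |>.1 this
  have hx : dd ex (comp πx Φ) z ≠ 0 := by
    intro h
    rw [h, hv] at hΔ
    simp at hΔ
  obtain ⟨h1, h2⟩ := key 1 _ one_ne_zero rfl (by rwa [hv, mul_zero, add_zero])
  rw [hv, mul_zero, add_zero] at h2
  exact ⟨h1, hv, hx, h2⟩

theorem IsPointSymmetry.dv_ne_zero (hΦ : IsPointSymmetry Φ) {z : Total} (hz : z ∈ Φ.source) :
    dd ev (comp πv Φ) z ≠ 0 := by
  have hΔ := (hΦ.minors_ne_zero hz).2
  rw [(hΦ.coords_first hz).2.1] at hΔ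
  intro h
  rw [h] at hΔ
  simp at hΔ

/-- Now r = x̃_x does not involve k, and the second equation is a polynomial identity in k = v_x of
degree two. The three relations are its coefficients, the constant one after elimination of ũ by
means of the linear one. -/
theorem IsPointSymmetry.coords_poly (hΦ : IsPointSymmetry Φ) {z : Total} (hz : z ∈ Φ.source) :
    dd ev (dd ev (comp πv Φ)) z = 0 ∧
    - dd ev (comp πv Φ) z * dd et (comp πx Φ) z
        - 2 * (Φ z).2.1 * dd ev (comp πv Φ) z * dd ex (comp πx Φ) z ^ 2 =
      dd ex (comp πx Φ) z * (2 * dd ex (dd ev (comp πv Φ)) z - 2 * z.2.1 * dd ev (comp πv Φ) z) ∧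
    dd et (comp πv Φ) z * dd ev (comp πv Φ) z
        - 2 * z.2.1 * dd ex (comp πv Φ) z * dd ev (comp πv Φ) z
        + 2 * dd ex (comp πv Φ) z * dd ex (dd ev (comp πv Φ)) z =
      dd ex (dd ex (comp πv Φ)) z * dd ev (comp πv Φ) z := by
  obtain ⟨hy, hxv, hx, hxt⟩ := hΦ.coords_first hz
  have oS := Φ.open_source
  have sX := hΦ.contDiffOn_comp πx
  have sT := hΦ.contDiffOn_comp πt
  have xxv : dd ex (dd ev (comp πx Φ)) z = 0 :=
    dd_eq_zero_of_eqOn oS (fun z hz => (hΦ.coords_first hz).2.1) hz _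
  have xvv : dd ev (dd ev (comp πx Φ)) z = 0 :=
    dd_eq_zero_of_eqOn oS (fun z hz => (hΦ.coords_first hz).2.1) hz _
  -- x̃_x² = t̃_t does not depend on x, and x̃_x ≠ 0.
  have xxx : dd ex (dd ex (comp πx Φ)) z = 0 := by
    have h1 : dd ex (fun z => dd ex (comp πx Φ) z ^ 2) z = 0 := by
      rw [dd_congr oS (h := dd et (comp πt Φ)) (fun z hz => (hΦ.coords_first hz).2.2.2) hz,
        dd_comm oS sT hz]
      exact dd_eq_zero_of_eqOn oS (fun z hz => (hΦ.triangular' hz).1.1) hz _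
    rw [dd_pow _ (differentiableAt_of_open oS (contDiffOn_dd oS sX _) hz)] at h1
    simpa [hx] using h1
  have key : ∀ k : ℝ, k ≠ 0 →
      dd ex (comp πx Φ) z * dd et (comp πv Φ) z
        - (dd ex (comp πv Φ) z + k * dd ev (comp πv Φ) z) * dd et (comp πx Φ) z
        - 2 * (Φ z).2.1 * (dd ex (comp πv Φ) z + k * dd ev (comp πv Φ) z) * dd ex (comp πx Φ) z ^ 2 =
      dd ex (comp πx Φ) z * (dd ex (dd ex (comp πv Φ)) z + 2 * k * dd ex (dd ev (comp πv Φ)) z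
          + k ^ 2 * dd ev (dd ev (comp πv Φ)) z - 2 * z.2.1 * k * dd ev (comp πv Φ) z) := by
    intro k hk
    obtain ⟨τ, q, υ, h1, h2, -, h4⟩ := hΦ.second_equation_coords hz hk rfl
      (by rwa [hxv, mul_zero, add_zero]) 0 0
    rw [hxv] at h1 h2 h4
    rw [xxv, xvv, xxx] at h4
    rw [hy, ← hxt] at h2
    simp only [mul_zero, add_zero] at h1 h2 h4
    linear_combination (dd ex (comp πx Φ) z) * h2 + dd ex (comp πx Φ) z * h4
      + (- dd et (comp πx Φ) z - 2 * (Φ z).2.1 * dd ex (comp πx Φ) z ^ 2) * h1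
  have k1 := key 1 (by norm_num)
  have k2 := key 2 (by norm_num)
  have k3 := key 3 (by norm_num)
  have c2 : dd ev (dd ev (comp πv Φ)) z = 0 := by
    apply mul_left_cancel₀ hx
    linear_combination -(k3 - 2 * k2 + k1) / 2
  rw [c2] at k1 k2
  have c1 : - dd ev (comp πv Φ) z * dd et (comp πx Φ) z
        - 2 * (Φ z).2.1 * dd ev (comp πv Φ) z * dd ex (comp πx Φ) z ^ 2 =
      dd ex (comp πx Φ) z * (2 * dd ex (dd ev (comp πv Φ)) z - 2 * z.2.1 * dd ev (comp πv Φ) z) := by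
    linear_combination k2 - k1
  refine ⟨c2, c1, ?_⟩
  apply mul_left_cancel₀ hx
  linear_combination dd ev (comp πv Φ) z * k1 - (dd ex (comp πv Φ) z + dd ev (comp πv Φ) z) * c1

/-- All coordinates in the last relation of `coords_poly` are independent of u, so the explicit
factor u must have coefficient zero: ṽ_x ṽ_v = 0. With ṽ_x = 0 the relation reduces to ṽ_t = 0, and
the linear coefficient is solved for ũ. -/
theorem IsPointSymmetry.coords_second (hΦ : IsPointSymmetry Φ) {z : Total} (hz : z ∈ Φ.source) :
    dd ex (comp πv Φ) z = 0 ∧ dd et (comp πv Φ) z = 0 ∧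
    (Φ z).2.1 = (z.2.1 - dd et (comp πx Φ) z / (2 * dd ex (comp πx Φ) z)) / dd ex (comp πx Φ) z := by
  have oS := Φ.open_source
  have sV := hΦ.contDiffOn_comp πv
  have vx : ∀ z ∈ Φ.source, dd ex (comp πv Φ) z = 0 := by
    intro z hz
    have z1 : ∀ w, ∀ z ∈ Φ.source, dd eu (dd w (comp πv Φ)) z = 0 := fun w z hz => by
      rw [dd_comm oS sV hz]
      exact dd_eq_zero_of_eqOn oS (fun z hz => (hΦ.triangular' hz).2.2.2) hz _
    have z2 : ∀ w w', dd eu (dd w (dd w' (comp πv Φ))) z = 0 := fun w w' => by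
      rw [dd_comm oS (contDiffOn_dd oS sV _) hz]
      exact dd_eq_zero_of_eqOn oS (z1 w') hz _
    have D1 : ∀ w, DifferentiableAt ℝ (dd w (comp πv Φ)) z := fun w =>
      differentiableAt_of_open oS (contDiffOn_dd oS sV w) hz
    have D2 : ∀ w w', DifferentiableAt ℝ (dd w (dd w' (comp πv Φ))) z := fun w w' =>
      differentiableAt_of_open oS (contDiffOn_dd oS (contDiffOn_dd oS sV w') w) hz
    have Du : DifferentiableAt ℝ (fun z : Total => z.2.1) z := by fun_prop
    have du : dd eu (fun z : Total => z.2.1) z = 1 := by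
      have : (fun z : Total => z.2.1) = fun z => πu z := rfl
      unfold dd
      rw [this, ContinuousLinearMap.fderiv]; rfl
    -- Differentiation of that relation with respect to u.
    have h1 := dd_congr oS (g := fun z => dd et (comp πv Φ) z * dd ev (comp πv Φ) z
        - 2 * z.2.1 * dd ex (comp πv Φ) z * dd ev (comp πv Φ) z
        + 2 * dd ex (comp πv Φ) z * dd ex (dd ev (comp πv Φ)) z)
      (h := fun z => dd ex (dd ex (comp πv Φ)) z * dd ev (comp πv Φ) z)
      (fun z hz => (hΦ.coords_poly hz).2.2) hz eu
    have Dp := (Du.const_mul 2).fun_mul (D1 ex)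
    rw [dd_add _ (((D1 _).fun_mul (D1 _)).fun_sub (Dp.fun_mul (D1 _)))
        (((D1 _).const_mul 2).fun_mul (D2 _ _)),
      dd_sub _ ((D1 _).fun_mul (D1 _)) (Dp.fun_mul (D1 _)), dd_mul _ (D1 _) (D1 _),
      dd_mul _ (D2 _ _) (D1 _), dd_mul _ ((D1 _).const_mul 2) (D2 _ _), dd_mul _ Dp (D1 _),
      dd_mul _ (Du.const_mul 2) (D1 _), dd_const_mul _ Du, dd_const_mul _ (D1 _)] at h1
    simp only [z1 _ z hz, z2, du] at h1
    have h2 : dd ex (comp πv Φ) z * dd ev (comp πv Φ) z = 0 := by linarith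
    exact (mul_eq_zero.1 h2).resolve_right (hΦ.dv_ne_zero hz)
  obtain ⟨-, h1, h2⟩ := hΦ.coords_poly hz
  have hv := hΦ.dv_ne_zero hz
  obtain ⟨-, -, hx, -⟩ := hΦ.coords_first hz
  have e1 : dd ex (dd ex (comp πv Φ)) z = 0 := dd_eq_zero_of_eqOn oS vx hz _
  have e2 : dd ex (dd ev (comp πv Φ)) z = 0 := by
    rw [dd_comm oS sV hz]; exact dd_eq_zero_of_eqOn oS vx hz _
  rw [e1, e2, vx z hz] at h2
  rw [e2] at h1
  refine ⟨vx z hz, ?_, ?_⟩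
  · have : dd et (comp πv Φ) z * dd ev (comp πv Φ) z = 0 := by linarith
    exact (mul_eq_zero.1 this).resolve_right hv
  · have h3 : dd ev (comp πv Φ) z * (2 * (Φ z).2.1 * dd ex (comp πx Φ) z ^ 2) =
        dd ev (comp πv Φ) z * (2 * z.2.1 * dd ex (comp πx Φ) z - dd et (comp πx Φ) z) := by
      linear_combination -h1
    have h4 := mul_left_cancel₀ hv h3
    field_simp
    linear_combination h4

end BLP

/-! ### Transformation of the system under changes of the independent variables -/

namespace BLP

/-- The expression whose `y`-derivative occurs in the first equation of the system. -/
noncomputable def burgers (u : Base → ℝ) : Base → ℝ :=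
  fun p => dt u p - dx (fun q => u q ^ 2 - dx u q) p

theorem contDiffOn_burgers {Ω : Set Base} (hΩ : IsOpen Ω) {u : Base → ℝ}
    (hu : ContDiffOn ℝ ∞ u Ω) : ContDiffOn ℝ ∞ (burgers u) Ω :=
  (contDiffOn_dt hΩ hu).sub (contDiffOn_dx hΩ ((hu.pow 2).sub (contDiffOn_dx hΩ hu)))

theorem eq_u_iff {Ω : Set Base} (hΩ : IsOpen Ω) {u v : Base → ℝ} (hu : ContDiffOn ℝ ∞ u Ω)
    {p : Base} (hp : p ∈ Ω) :
    dy (dt u) p = dy (dx fun q => u q ^ 2 - dx u q) p + 2 * dx (dx (dx v)) p ↔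
      dy (burgers u) p = 2 * dx (dx (dx v)) p := by
  have h : dy (burgers u) p = dy (dt u) p - dy (dx fun q => u q ^ 2 - dx u q) p :=
    dd_sub _ (differentiableAt_of_open hΩ (contDiffOn_dt hΩ hu) hp)
      (differentiableAt_of_open hΩ (contDiffOn_dx hΩ ((hu.pow 2).sub (contDiffOn_dx hΩ hu))) hp)
  rw [h, sub_eq_iff_eq_add']

/-- A change `(T, X, Y)` of the independent variables of the form that occurs in point symmetries,
with `s = 1 / X_x`. -/
structure BaseChange (Ω Ω' : Set Base) (T X Y s : Base → ℝ) : Prop where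
  isOpen : IsOpen Ω
  isOpen' : IsOpen Ω'
  sT : ContDiffOn ℝ ∞ T Ω
  sX : ContDiffOn ℝ ∞ X Ω
  sY : ContDiffOn ℝ ∞ Y Ω
  ss : ContDiffOn ℝ ∞ s Ω
  maps : ∀ p ∈ Ω, (T p, X p, Y p) ∈ Ω'
  Tx : ∀ p ∈ Ω, dx T p = 0
  Yt : ∀ p ∈ Ω, dt Y p = 0
  Yx : ∀ p ∈ Ω, dx Y p = 0
  s_mul : ∀ p ∈ Ω, s p * dx X p = 1
  sq_mul : ∀ p ∈ Ω, s p ^ 2 * dt T p = 1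

namespace BaseChange

variable {Ω Ω' : Set Base} {T X Y s : Base → ℝ}

theorem diff (B : BaseChange Ω Ω' T X Y s)
    {h : Base → ℝ} (hh : ContDiffOn ℝ ∞ h Ω) {p : Base} (hp : p ∈ Ω) :
    DifferentiableAt ℝ h p := differentiableAt_of_open B.isOpen hh hp

theorem contDiffOn_pullback (B : BaseChange Ω Ω' T X Y s)
    {h : Base → ℝ} (hh : ContDiffOn ℝ ∞ h Ω') :
    ContDiffOn ℝ ∞ (fun q => h (T q, X q, Y q)) Ω :=
  hh.comp (B.sT.prodMk (B.sX.prodMk B.sY)) B.maps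

theorem chain (B : BaseChange Ω Ω' T X Y s)
    {h : Base → ℝ} (hh : ContDiffOn ℝ ∞ h Ω') {p : Base} (hp : p ∈ Ω) (e : Base) :
    dd e (fun q => h (T q, X q, Y q)) p = dd e T p * dt h (T p, X p, Y p)
      + dd e X p * dx h (T p, X p, Y p) + dd e Y p * dy h (T p, X p, Y p) := by
  have hT := B.diff B.sT hp
  have hX := B.diff B.sX hp
  have hY := B.diff B.sY hp
  rw [dd_comp (a := fun q => (T q, X q, Y q)) (differentiableAt_of_open B.isOpen' hh (B.maps p hp))
    (hT.prodMk (hX.prodMk hY)), fderiv_base]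
  have : dd e (fun q => (T q, X q, Y q)) p = (dd e T p, dd e X p, dd e Y p) := by
    unfold dd
    rw [(hT.hasFDerivAt.prodMk (hX.hasFDerivAt.prodMk hY.hasFDerivAt)).fderiv]; rfl
  rw [this]

theorem chain_dx (B : BaseChange Ω Ω' T X Y s)
    {h : Base → ℝ} (hh : ContDiffOn ℝ ∞ h Ω') {p : Base} (hp : p ∈ Ω) :
    dx h (T p, X p, Y p) = s p * dx (fun q => h (T q, X q, Y q)) p := by
  have h1 : dx (fun q => h (T q, X q, Y q)) p = dx T p * dt h (T p, X p, Y p)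
      + dx X p * dx h (T p, X p, Y p) + dx Y p * dy h (T p, X p, Y p) := B.chain hh hp _
  rw [h1, B.Tx p hp, B.Yx p hp]
  linear_combination (- dx h (T p, X p, Y p)) * B.s_mul p hp

theorem chain_dt (B : BaseChange Ω Ω' T X Y s)
    {h : Base → ℝ} (hh : ContDiffOn ℝ ∞ h Ω') {p : Base} (hp : p ∈ Ω) :
    dt h (T p, X p, Y p) = s p ^ 2 * (dt (fun q => h (T q, X q, Y q)) p
      - dt X p * s p * dx (fun q => h (T q, X q, Y q)) p) := by
  have h1 : dt (fun q => h (T q, X q, Y q)) p = dt T p * dt h (T p, X p, Y p)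
      + dt X p * dx h (T p, X p, Y p) + dt Y p * dy h (T p, X p, Y p) := B.chain hh hp _
  rw [mul_assoc (dt X p), ← B.chain_dx hh hp, h1, B.Yt p hp]
  linear_combination (- dt h (T p, X p, Y p)) * B.sq_mul p hp

theorem s_ne (B : BaseChange Ω Ω' T X Y s)
    {p : Base} (hp : p ∈ Ω) : s p ≠ 0 := left_ne_zero_of_mul_eq_one (B.s_mul p hp)

/-- s⁻² = T_t, and T_t is independent of x because T is. -/
theorem dx_s (B : BaseChange Ω Ω' T X Y s) {p : Base} (hp : p ∈ Ω) : dx s p = 0 := by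
  have h1 : dx (fun q => s q ^ 2 * dt T q) p = 0 := by
    rw [dx_eq, dd_congr B.isOpen (h := fun _ => (1 : ℝ)) B.sq_mul hp, dd_const]
  have h2 : dx (dt T) p = 0 := by
    rw [dx_eq, dt_eq, dd_comm B.isOpen B.sT hp]
    exact dd_eq_zero_of_eqOn B.isOpen B.Tx hp _
  rw [dx_eq, dd_mul _ ((B.diff B.ss hp).fun_pow 2) (B.diff (contDiffOn_dt B.isOpen B.sT) hp),
    dd_pow _ (B.diff B.ss hp), ← dx_eq, ← dx_eq, h2] at h1
  have h3 : dt T p ≠ 0 := right_ne_zero_of_mul_eq_one (B.sq_mul p hp)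
  have h4 := B.s_ne hp
  simpa [h3, h4] using h1

theorem dx_s_mul (B : BaseChange Ω Ω' T X Y s)
    {h : Base → ℝ} (hh : ContDiffOn ℝ ∞ h Ω) {p : Base} (hp : p ∈ Ω) :
    dx (fun q => s q * h q) p = s p * dx h p := by
  rw [dx_eq, dd_mul _ (B.diff B.ss hp) (B.diff hh hp), ← dx_eq, ← dx_eq, B.dx_s hp]; ring

theorem chain_dx_dx (B : BaseChange Ω Ω' T X Y s)
    {h : Base → ℝ} (hh : ContDiffOn ℝ ∞ h Ω') {p : Base} (hp : p ∈ Ω) :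
    dx (dx h) (T p, X p, Y p) = s p ^ 2 * dx (dx fun q => h (T q, X q, Y q)) p := by
  rw [B.chain_dx (contDiffOn_dx B.isOpen' hh) hp, dx_eq (fun q => _),
    dd_congr B.isOpen (fun q hq => B.chain_dx hh hq) hp, ← dx_eq (fun q => _),
    B.dx_s_mul (contDiffOn_dx B.isOpen (B.contDiffOn_pullback hh)) hp]
  ring

theorem chain_dx_dx_dx (B : BaseChange Ω Ω' T X Y s)
    {h : Base → ℝ} (hh : ContDiffOn ℝ ∞ h Ω') {p : Base} (hp : p ∈ Ω) :
    dx (dx (dx h)) (T p, X p, Y p) = s p ^ 3 * dx (dx (dx fun q => h (T q, X q, Y q))) p := by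
  have hs := contDiffOn_dx B.isOpen (B.contDiffOn_pullback hh)
  rw [B.chain_dx_dx (contDiffOn_dx B.isOpen' hh) hp]
  have h1 : ∀ q ∈ Ω, dx (fun q => dx h (T q, X q, Y q)) q =
      s q * dx (dx fun q => h (T q, X q, Y q)) q := fun q hq => by
    rw [dx_eq (fun q => _), dd_congr B.isOpen (fun q hq => B.chain_dx hh hq) hq, ← dx_eq (fun q => _),
      B.dx_s_mul hs hq]
  rw [dx_eq (dx fun q => dx h (T q, X q, Y q)), dd_congr B.isOpen h1 hp, ← dx_eq (fun q => _),
    B.dx_s_mul (contDiffOn_dx B.isOpen hs) hp]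
  ring

/-- Smoothness of `X_t / (2 X_x²)`. -/
theorem shift_smooth (B : BaseChange Ω Ω' T X Y s) :
    ContDiffOn ℝ ∞ (fun q => dt X q * s q ^ 2 / 2) Ω :=
  ((contDiffOn_dt B.isOpen B.sX).mul (B.ss.pow 2)).div_const 2

theorem dx_shift (B : BaseChange Ω Ω' T X Y s)
    {p : Base} (hp : p ∈ Ω) : dx (fun q => dt X q * s q ^ 2 / 2) p = - dt s p / 2 := by
  have h1 : dt (fun q => s q * dx X q) p = 0 := by
    rw [dt_eq, dd_congr B.isOpen (h := fun _ => (1 : ℝ)) B.s_mul hp, dd_const]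
  have dXx := B.diff (contDiffOn_dx B.isOpen B.sX) hp
  have dXt := B.diff (contDiffOn_dt B.isOpen B.sX) hp
  have ds := B.diff B.ss hp
  rw [dt_eq, dd_mul _ ds dXx, ← dt_eq, ← dt_eq] at h1
  have h2 : dx (dt X) p = dt (dx X) p := dd_comm B.isOpen B.sX hp _ _
  have h3 : (fun q => dt X q * s q ^ 2 / 2) = fun q => (1 / 2) * (dt X q * s q ^ 2) := by
    ext q; ring
  rw [h3, dx_eq, dd_const_mul _ (dXt.fun_mul (ds.fun_pow 2)), dd_mul _ dXt (ds.fun_pow 2),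
    dd_pow _ ds, ← dx_eq, ← dx_eq, B.dx_s hp, h2]
  have := B.s_mul p hp
  linear_combination s p / 2 * h1 - dt s p / 2 * this

/-- The Burgers expression is covariant of weight s³ up to a term free of u. The shift X_t s²/2 in g
cancels the terms with u_x that the moving frame x̃ = X(t,x) produces. -/
theorem burgers_comp (B : BaseChange Ω Ω' T X Y s)
    {g u : Base → ℝ} (hg : ContDiffOn ℝ ∞ g Ω') (hu : ContDiffOn ℝ ∞ u Ω)
    (hgu : ∀ p ∈ Ω, g (T p, X p, Y p) = u p * s p - dt X p * s p ^ 2 / 2) {p : Base} (hp : p ∈ Ω) :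
    burgers g (T p, X p, Y p) = s p ^ 3 * burgers u p
      - s p ^ 2 * dt (fun q => dt X q * s q ^ 2 / 2) p := by
  have oΩ := B.isOpen
  have sG := B.contDiffOn_pullback hg
  have sω := B.shift_smooth
  have sux := contDiffOn_dx oΩ hu
  have sgx := contDiffOn_dx B.isOpen' hg
  have sh : ContDiffOn ℝ ∞ (fun q => g q ^ 2 - dx g q) Ω' := (hg.pow 2).sub sgx
  have sus : ContDiffOn ℝ ∞ (fun q => u q * s q) Ω := hu.mul B.ss
  have Gx : ∀ q ∈ Ω, dx (fun q => g (T q, X q, Y q)) q = s q * dx u q + dt s q / 2 := by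
    intro q hq
    rw [dx_eq, dd_congr oΩ hgu hq, dd_sub _ (B.diff sus hq) (B.diff sω hq),
      dd_mul _ (B.diff hu hq) (B.diff B.ss hq), ← dx_eq, ← dx_eq, ← dx_eq, B.dx_s hq, B.dx_shift hq]
    ring
  have Gt : dt (fun q => g (T q, X q, Y q)) p = dt u p * s p + u p * dt s p
      - dt (fun q => dt X q * s q ^ 2 / 2) p := by
    rw [dt_eq, dd_congr oΩ hgu hp, dd_sub _ (B.diff sus hp) (B.diff sω hp),
      dd_mul _ (B.diff hu hp) (B.diff B.ss hp)]
    rfl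
  have Gxx : dx (dx fun q => g (T q, X q, Y q)) p = s p * dx (dx u) p := by
    rw [dx_eq (dx _), dd_congr oΩ (h := fun q => s q * dx u q + (1 / 2) * dt s q)
      (fun q hq => (Gx q hq).trans (by ring)) hp,
      dd_add _ (B.diff (B.ss.mul sux) hp) ((B.diff (contDiffOn_dt oΩ B.ss) hp).const_mul _),
      dd_const_mul _ (B.diff (contDiffOn_dt oΩ B.ss) hp), ← dx_eq, B.dx_s_mul sux hp, dt_eq, dx_eq,
      dd_comm oΩ B.ss hp, dd_eq_zero_of_eqOn (g := dd (0, 1, 0) s) oΩ (fun q hq => B.dx_s hq) hp]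
    ring
  have e1 : dx (fun q => g q ^ 2 - dx g q) (T p, X p, Y p) =
      s p * (2 * g (T p, X p, Y p) * (s p * dx u p + dt s p / 2) - s p * (s p * dx (dx u) p)) := by
    rw [B.chain_dx sh hp, dx_eq (fun q => _),
      dd_congr oΩ (h := fun q => g (T q, X q, Y q) ^ 2 - s q * dx (fun q => g (T q, X q, Y q)) q)
        (fun q hq => by simp only; rw [B.chain_dx hg hq]) hp,
      dd_sub _ ((B.diff sG hp).fun_pow 2) (B.diff (B.ss.mul (contDiffOn_dx oΩ sG)) hp),
      dd_pow _ (B.diff sG hp), ← dx_eq, ← dx_eq (fun q => _ * _), B.dx_s_mul (contDiffOn_dx oΩ sG) hp,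
      Gxx, Gx p hp]
    norm_num
  have e2 : dx (fun q => u q ^ 2 - dx u q) p = 2 * u p * dx u p - dx (dx u) p := by
    rw [dx_eq, dd_sub _ ((B.diff hu hp).fun_pow 2) (B.diff sux hp), dd_pow _ (B.diff hu hp)]
    norm_num [dx_eq]
  unfold burgers
  rw [B.chain_dt hg hp, e1, e2, Gt, Gx p hp, hgu p hp]
  ring

theorem second_eq_comp (B : BaseChange Ω Ω' T X Y s)
    {g u v a : Base → ℝ} {w : Base → ℝ} (hw : ContDiffOn ℝ ∞ w Ω')
    (hv : ContDiffOn ℝ ∞ v Ω) (ha : ContDiffOn ℝ ∞ a Ω)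
    (hgu : ∀ p ∈ Ω, g (T p, X p, Y p) = u p * s p - dt X p * s p ^ 2 / 2)
    (hat : ∀ p ∈ Ω, dt (fun q => w (T q, X q, Y q)) p = a p * dt v p)
    (hax : ∀ p ∈ Ω, dx (fun q => w (T q, X q, Y q)) p = a p * dx v p)
    (hdx : ∀ p ∈ Ω, dx a p = 0) {p : Base} (hp : p ∈ Ω) :
    dt w (T p, X p, Y p) - (dx (dx w) (T p, X p, Y p)
        + 2 * g (T p, X p, Y p) * dx w (T p, X p, Y p)) =
      s p ^ 2 * a p * (dt v p - (dx (dx v) p + 2 * u p * dx v p)) := by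
  have e : dx (dx fun q => w (T q, X q, Y q)) p = a p * dx (dx v) p := by
    rw [dx_eq (dx _), dd_congr B.isOpen hax hp,
      dd_mul _ (B.diff ha hp) (B.diff (contDiffOn_dx B.isOpen hv) hp), ← dx_eq, ← dx_eq, hdx p hp]
    ring
  rw [B.chain_dt hw hp, B.chain_dx_dx hw hp, B.chain_dx hw hp, hgu p hp, hat p hp, hax p hp, e]
  ring

theorem dx_dx_dx_comp (B : BaseChange Ω Ω' T X Y s)
    {v a : Base → ℝ} {w : Base → ℝ} (hw : ContDiffOn ℝ ∞ w Ω')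
    (hv : ContDiffOn ℝ ∞ v Ω) (ha : ContDiffOn ℝ ∞ a Ω)
    (hax : ∀ p ∈ Ω, dx (fun q => w (T q, X q, Y q)) p = a p * dx v p)
    (hdx : ∀ p ∈ Ω, dx a p = 0) {p : Base} (hp : p ∈ Ω) :
    dx (dx (dx w)) (T p, X p, Y p) = s p ^ 3 * a p * dx (dx (dx v)) p := by
  have e : ∀ p ∈ Ω, dx (dx fun q => w (T q, X q, Y q)) p = a p * dx (dx v) p := by
    intro p hp
    rw [dx_eq (dx _), dd_congr B.isOpen hax hp,
      dd_mul _ (B.diff ha hp) (B.diff (contDiffOn_dx B.isOpen hv) hp), ← dx_eq, ← dx_eq, hdx p hp]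
    ring
  rw [B.chain_dx_dx_dx hw hp, dx_eq (dx (dx _)), dd_congr B.isOpen e hp,
    dd_mul _ (B.diff ha hp) (B.diff (contDiffOn_dx B.isOpen (contDiffOn_dx B.isOpen hv)) hp),
    ← dx_eq, ← dx_eq, hdx p hp]
  ring

/-- Once T and X are independent of y, so are s and the inhomogeneous term of `burgers_comp`, and
differentiation in y leaves only the covariant part. -/
theorem dy_burgers_comp (B : BaseChange Ω Ω' T X Y s)
    {g u : Base → ℝ} (hg : ContDiffOn ℝ ∞ g Ω') (hu : ContDiffOn ℝ ∞ u Ω)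
    (hgu : ∀ p ∈ Ω, g (T p, X p, Y p) = u p * s p - dt X p * s p ^ 2 / 2)
    (hTy : ∀ p ∈ Ω, dy T p = 0) (hXy : ∀ p ∈ Ω, dy X p = 0) {p : Base} (hp : p ∈ Ω) :
    dy Y p * dy (burgers g) (T p, X p, Y p) = s p ^ 3 * dy (burgers u) p := by
  have oΩ := B.isOpen
  have sy : ∀ q ∈ Ω, dy s q = 0 := by
    intro q hq
    have h1 : dy (fun q => s q * dx X q) q = 0 := by
      rw [dy_eq, dd_congr oΩ (h := fun _ => (1 : ℝ)) B.s_mul hq, dd_const]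
    have h2 : dy (dx X) q = 0 := by
      rw [dy_eq, dx_eq, dd_comm oΩ B.sX hq]; exact dd_eq_zero_of_eqOn oΩ hXy hq _
    rw [dy_eq, dd_mul _ (B.diff B.ss hq) (B.diff (contDiffOn_dx oΩ B.sX) hq), ← dy_eq, ← dy_eq,
      h2] at h1
    have h3 : dx X q ≠ 0 := right_ne_zero_of_mul_eq_one (B.s_mul q hq)
    simpa [h3] using h1
  have sω := B.shift_smooth
  have ωy : ∀ q ∈ Ω, dy (fun q => dt X q * s q ^ 2 / 2) q = 0 := by
    intro q hq
    have h2 : dy (dt X) q = 0 := by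
      rw [dy_eq, dt_eq, dd_comm oΩ B.sX hq]; exact dd_eq_zero_of_eqOn oΩ hXy hq _
    have h3 : (fun q => dt X q * s q ^ 2 / 2) = fun q => (1 / 2) * (dt X q * s q ^ 2) := by
      ext q; ring
    have dXt := B.diff (contDiffOn_dt oΩ B.sX) hq
    have ds := B.diff B.ss hq
    rw [h3, dy_eq, dd_const_mul _ (dXt.fun_mul (ds.fun_pow 2)), dd_mul _ dXt (ds.fun_pow 2),
      dd_pow _ ds, ← dy_eq, ← dy_eq, sy q hq, h2]
    ring
  have ωty : dy (dt fun q => dt X q * s q ^ 2 / 2) p = 0 := by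
    rw [dy_eq, dt_eq (fun q => _ / _), dd_comm oΩ sω hp]
    exact dd_eq_zero_of_eqOn oΩ ωy hp _
  have h1 : dd (0, 0, 1) (fun q => burgers g (T q, X q, Y q)) p =
      dy T p * dt (burgers g) (T p, X p, Y p) + dy X p * dx (burgers g) (T p, X p, Y p)
        + dy Y p * dy (burgers g) (T p, X p, Y p) :=
    B.chain (contDiffOn_burgers B.isOpen' hg) hp (0, 0, 1)
  rw [hTy p hp, hXy p hp] at h1
  have dωt := B.diff (contDiffOn_dt oΩ sω) hp
  have du := B.diff (contDiffOn_burgers oΩ hu) hp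
  have ds := B.diff B.ss hp
  rw [dd_congr oΩ (fun q hq => B.burgers_comp hg hu hgu hq) hp,
    dd_sub _ ((ds.fun_pow 3).fun_mul du) ((ds.fun_pow 2).fun_mul dωt),
    dd_mul _ (ds.fun_pow 3) du, dd_mul _ (ds.fun_pow 2) dωt, dd_pow _ ds, dd_pow _ ds,
    ← dy_eq, ← dy_eq, ← dy_eq, ωty, sy p hp] at h1
  linear_combination -h1

end BaseChange

end BLP

/-! ### Point symmetries as changes of the independent variables -/

namespace BLP

/-- A function on a convex set is unchanged along directions in which its derivative vanishes. -/
theorem eq_of_fderiv_eq_zero {E : Type*} [NormedAddCommGroup E] [NormedSpace ℝ E] {W : Set E}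
    (hW : Convex ℝ W) {h : E → ℝ} (hh : ∀ z ∈ W, DifferentiableAt ℝ h z) {z z' : E} (hz : z ∈ W)
    (hz' : z' ∈ W) (h0 : ∀ y ∈ W, fderiv ℝ h y (z' - z) = 0) : h z' = h z := by
  obtain ⟨y, hy, e⟩ := domain_mvt (f' := fderiv ℝ h)
    (fun x hx => (hh x hx).hasFDerivAt.hasFDerivWithinAt) hW hz hz'
  rw [h0 y (hW.segment_subset hz hz' hy)] at e
  linarith

variable {Φ : OpenPartialHomeomorph Total Total}

theorem IsPointSymmetry.dy_ne_zero (hΦ : IsPointSymmetry Φ) {z : Total} (hz : z ∈ Φ.source) :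
    dd ey (comp πy Φ) z ≠ 0 := by
  have hJ := (hΦ.minors_ne_zero hz).1
  rw [(hΦ.coords_first hz).1] at hJ
  intro h
  rw [h] at hJ
  simp at hJ

/-- The base part of the differential no longer sees u and v and has nonzero diagonal entries t̃_t,
x̃_x, ỹ_y; eliminating dy, dt, dx in this order shows that every graph is transversal. From here on
any solution may serve as a test. -/
theorem IsPointSymmetry.baseMap_injective (hΦ : IsPointSymmetry Φ) {z : Total} (hz : z ∈ Φ.source)
    (A : Base →L[ℝ] Fiber) : Function.Injective (baseMap Φ z A) := by
  rw [injective_iff_map_eq_zero]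
  intro η h0
  obtain ⟨⟨tx, tu, tv⟩, ⟨yx, yu, yv⟩, xu, vu⟩ := hΦ.triangular' hz
  obtain ⟨yt, xv, hx, hxt⟩ := hΦ.coords_first hz
  have hy := hΦ.dy_ne_zero hz
  have ht : dd et (comp πt Φ) z ≠ 0 := by rw [← hxt]; exact pow_ne_zero 2 hx
  have e1 := hΦ.coord_fderiv hz πt (η, A η)
  have e2 := hΦ.coord_fderiv hz πx (η, A η)
  have e3 := hΦ.coord_fderiv hz πy (η, A η)
  rw [baseMap_apply] at h0
  rw [πt_apply, h0] at e1
  rw [πx_apply, h0] at e2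
  rw [πy_apply, h0] at e3
  simp only [tx, tu, tv, yx, yu, yv, xu, yt, xv, Prod.fst_zero, Prod.snd_zero, mul_zero, add_zero,
    zero_add] at e1 e2 e3
  have a3 : η.2.2 = 0 := (mul_eq_zero.1 e3.symm).resolve_right hy
  rw [a3, zero_mul, add_zero] at e1 e2
  have a1 : η.1 = 0 := (mul_eq_zero.1 e1.symm).resolve_right ht
  rw [a1, zero_mul, zero_add] at e2
  exact Prod.ext a1 (Prod.ext ((mul_eq_zero.1 e2.symm).resolve_right hx) a3)

theorem dd_slice {h : Total → ℝ} {p : Base} {w : Fiber} (hh : DifferentiableAt ℝ h (p, w))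
    (e : Base) : dd e (fun q => h (q, w)) p = dd (e, 0) h (p, w) := by
  have h1 : HasFDerivAt (fun q : Base => (q, w)) (ContinuousLinearMap.inl ℝ Base Fiber) p :=
    hasFDerivAt_prodMk_left p w
  rw [dd_comp (a := fun q => (q, w)) hh h1.differentiableAt]
  unfold dd
  rw [h1.fderiv]; rfl

theorem dd_graph {h : Total → ℝ} {p : Base} {f : Base → Fiber}
    (hh : DifferentiableAt ℝ h (p, f p)) (hf : DifferentiableAt ℝ f p) (e : Base) :
    dd e (fun q => h (q, f q)) p = dd (e, 0) h (p, f p) + dd e (fun q => (f q).1) p * dd eu h (p, f p)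
      + dd e (fun q => (f q).2) p * dd ev h (p, f p) := by
  have e1 : dd e (fun q => (f q).1) p = (fderiv ℝ f p e).1 :=
    dd_clm_comp (ContinuousLinearMap.fst ℝ ℝ ℝ) hf e
  have e2 : dd e (fun q => (f q).2) p = (fderiv ℝ f p e).2 :=
    dd_clm_comp (ContinuousLinearMap.snd ℝ ℝ ℝ) hf e
  rw [dd_comp (a := fun q => (q, f q)) hh (fderiv_graph hf).differentiableAt, e1, e2]
  unfold dd
  rw [(fderiv_graph hf).fderiv]
  simp only [ContinuousLinearMap.prod_apply, ContinuousLinearMap.id_apply]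
  have : (e, fderiv ℝ f p e) = ((e, 0) : Total) + (fderiv ℝ f p e).1 • eu
      + (fderiv ℝ f p e).2 • ev := by
    ext <;> simp [eu, ev]
  rw [this]
  simp only [map_add, map_smul, smul_eq_mul]

/-- The coordinate `π` of `Φ` on the slice `w = w₀`. -/
noncomputable def slice (π : Total →L[ℝ] ℝ) (Φ : OpenPartialHomeomorph Total Total) (w₀ : Fiber) :
    Base → ℝ := fun p => comp π Φ (p, w₀)

/-- Near a point, a point symmetry acts on solutions through a change of the independent
variables. -/
theorem IsPointSymmetry.exists_baseChange (hΦ : IsPointSymmetry Φ) {p₀ : Base} {w₀ : Fiber}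
    (hz : (p₀, w₀) ∈ Φ.source) {f : Base → Fiber} {Ω : Set Base} (hΩ : IsOpen Ω) (hp₀ : p₀ ∈ Ω)
    (hf : IsSolutionOn f Ω) (hf₀ : f p₀ = w₀) :
    ∃ (Ω₁ Ω' : Set Base) (g : Base → Fiber) (a : Base → ℝ), p₀ ∈ Ω₁ ∧ Ω₁ ⊆ Ω ∧
      IsSolutionOn g Ω' ∧
      BaseChange Ω₁ Ω' (slice πt Φ w₀) (slice πx Φ w₀) (slice πy Φ w₀)
        (fun p => (dx (slice πx Φ w₀) p)⁻¹) ∧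
      (∀ p ∈ Ω₁, (p, w₀) ∈ Φ.source) ∧
      (∀ p ∈ Ω₁, (g (slice πt Φ w₀ p, slice πx Φ w₀ p, slice πy Φ w₀ p)).1 =
        (f p).1 * (dx (slice πx Φ w₀) p)⁻¹
          - dt (slice πx Φ w₀) p * (dx (slice πx Φ w₀) p)⁻¹ ^ 2 / 2) ∧
      ContDiffOn ℝ ∞ a Ω₁ ∧ (∀ p ∈ Ω₁, a p = dd ev (comp πv Φ) (p, w₀)) ∧
      (∀ p ∈ Ω₁, dx a p = 0) ∧
      (∀ p ∈ Ω₁, dx (fun q => (g (slice πt Φ w₀ q, slice πx Φ w₀ q, slice πy Φ w₀ q)).2) p =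
        a p * dx (fun q => (f q).2) p) := by
  obtain ⟨Ω₀, Ω', g, oΩ₀, oΩ', hp₁, hsub, hg, him⟩ := hΦ.exists_image hΩ hp₀ hf
    (by rw [hf₀]; exact hz) (by rw [hf₀]; exact hΦ.baseMap_injective hz _)
  have oS := Φ.open_source
  obtain ⟨r, hr, hball⟩ := Metric.isOpen_iff.1 oS _ hz
  have hcf : ContinuousOn f Ω₀ := hf.smooth.continuousOn.mono hsub
  -- Over this set the points (p, f p) and (p, w₀) lie in one ball inside the domain, so functions
  -- with vanishing u- and v-derivatives agree at them. Freezing the fibre variable at w₀ is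
  -- therefore harmless.
  set Ω₁ : Set Base := (Ω₀ ∩ f ⁻¹' Metric.ball w₀ r) ∩ Metric.ball p₀ r with hΩ₁
  have oΩ₁ : IsOpen Ω₁ := (hcf.isOpen_inter_preimage oΩ₀ Metric.isOpen_ball).inter Metric.isOpen_ball
  have hp : p₀ ∈ Ω₁ := ⟨⟨hp₁, by simp [hf₀, hr]⟩, by simp [hr]⟩
  have hsub₁ : Ω₁ ⊆ Ω₀ := fun p hp => hp.1.1
  have hmem : ∀ p ∈ Metric.ball p₀ r, ∀ w ∈ Metric.ball w₀ r, (p, w) ∈ Metric.ball (p₀, w₀) r := by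
    intro p hp w hw
    rw [← ball_prod_same]; exact ⟨hp, hw⟩
  have hslice : ∀ p ∈ Ω₁, (p, w₀) ∈ Φ.source := fun p hp =>
    hball (hmem p hp.2 w₀ (by simp [hr]))
  have hconst : ∀ h : Total → ℝ, ContDiffOn ℝ ∞ h Φ.source →
      (∀ z ∈ Φ.source, dd eu h z = 0 ∧ dd ev h z = 0) → ∀ p ∈ Ω₁, h (p, f p) = h (p, w₀) := by
    intro h sh h0 p hp
    refine eq_of_fderiv_eq_zero (convex_ball (p₀, w₀) r)
      (fun z hz => differentiableAt_of_open oS sh (hball hz)) (hmem p hp.2 w₀ (by simp [hr]))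
      (hmem p hp.2 (f p) hp.1.2) fun y hy => ?_
    have : ((p, f p) : Total) - (p, w₀) = (f p - w₀).1 • eu + (f p - w₀).2 • ev := by
      ext <;> simp [eu, ev]
    rw [this, map_add, map_smul, map_smul]
    have := h0 y (hball hy)
    unfold dd at this
    rw [this.1, this.2]; simp
  have sc : ∀ π, ContDiffOn ℝ ∞ (comp π Φ) Φ.source := hΦ.contDiffOn_comp
  have ssl : ∀ h : Total → ℝ, ContDiffOn ℝ ∞ h Φ.source → ContDiffOn ℝ ∞ (fun p => h (p, w₀)) Ω₁ :=
    fun h sh => sh.comp (contDiff_id.prodMk contDiff_const).contDiffOn hslice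
  have dsl : ∀ (h : Total → ℝ), ContDiffOn ℝ ∞ h Φ.source → ∀ p ∈ Ω₁, ∀ e,
      dd e (fun p => h (p, w₀)) p = dd (e, 0) h (p, w₀) := fun h sh p hp e =>
    dd_slice (differentiableAt_of_open oS sh (hslice p hp)) e
  have dxX : ∀ p ∈ Ω₁, dx (slice πx Φ w₀) p = dd ex (comp πx Φ) (p, w₀) := fun p hp =>
    dsl _ (sc πx) p hp _
  have dtX : ∀ p ∈ Ω₁, dt (slice πx Φ w₀) p = dd et (comp πx Φ) (p, w₀) := fun p hp =>
    dsl _ (sc πx) p hp _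
  have dtT : ∀ p ∈ Ω₁, dt (slice πt Φ w₀) p = dd et (comp πt Φ) (p, w₀) := fun p hp =>
    dsl _ (sc πt) p hp _
  have xne : ∀ p ∈ Ω₁, dx (slice πx Φ w₀) p ≠ 0 := fun p hp => by
    rw [dxX p hp]; exact (hΦ.coords_first (hslice p hp)).2.2.1
  have hα : ∀ p ∈ Ω₁, (Φ (p, f p)).1 = (slice πt Φ w₀ p, slice πx Φ w₀ p, slice πy Φ w₀ p) := by
    intro p hp
    refine Prod.ext ?_ (Prod.ext ?_ ?_)
    · exact hconst _ (sc πt) (fun z hz => ⟨(hΦ.triangular' hz).1.2.1, (hΦ.triangular' hz).1.2.2⟩) p hp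
    · exact hconst _ (sc πx) (fun z hz => ⟨(hΦ.triangular' hz).2.2.1, (hΦ.coords_first hz).2.1⟩) p hp
    · exact hconst _ (sc πy) (fun z hz =>
        ⟨(hΦ.triangular' hz).2.1.2.1, (hΦ.triangular' hz).2.1.2.2⟩) p hp
  have xconst : ∀ w, ∀ p ∈ Ω₁, dd w (comp πx Φ) (p, f p) = dd w (comp πx Φ) (p, w₀) := by
    intro w p hp
    refine hconst _ (contDiffOn_dd oS (sc πx) w) (fun z hz => ⟨?_, ?_⟩) p hp
    · rw [dd_comm oS (sc πx) hz]
      exact dd_eq_zero_of_eqOn oS (fun z hz => (hΦ.triangular' hz).2.2.1) hz _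
    · rw [dd_comm oS (sc πx) hz]
      exact dd_eq_zero_of_eqOn oS (fun z hz => (hΦ.coords_first hz).2.1) hz _
  have vconst : ∀ p ∈ Ω₁, dd ev (comp πv Φ) (p, f p) = dd ev (comp πv Φ) (p, w₀) := by
    intro p hp
    refine hconst _ (contDiffOn_dd oS (sc πv) ev) (fun z hz => ⟨?_, ?_⟩) p hp
    · rw [dd_comm oS (sc πv) hz]
      exact dd_eq_zero_of_eqOn oS (fun z hz => (hΦ.triangular' hz).2.2.2) hz _
    · exact (hΦ.coords_poly hz).1
  have hfs : ∀ p ∈ Ω₁, (p, f p) ∈ Φ.source := fun p hp => (him p (hsub₁ hp)).1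
  refine ⟨Ω₁, Ω', g, fun p => dd ev (comp πv Φ) (p, w₀), hp, fun p hp => hsub (hsub₁ hp), hg,
    { isOpen := oΩ₁
      isOpen' := oΩ'
      sT := ssl _ (sc πt)
      sX := ssl _ (sc πx)
      sY := ssl _ (sc πy)
      ss := (contDiffOn_dx oΩ₁ (ssl _ (sc πx))).inv xne
      maps := fun p hp => ?_
      Tx := fun p hp => (dsl _ (sc πt) p hp _).trans (hΦ.triangular' (hslice p hp)).1.1
      Yt := fun p hp => (dsl _ (sc πy) p hp _).trans (hΦ.coords_first (hslice p hp)).1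
      Yx := fun p hp => (dsl _ (sc πy) p hp _).trans (hΦ.triangular' (hslice p hp)).2.1.1
      s_mul := fun p hp => inv_mul_cancel₀ (xne p hp)
      sq_mul := fun p hp => ?_ }, hslice, ?_, ssl _ (contDiffOn_dd oS (sc πv) ev), fun p hp => rfl, ?_, ?_⟩
  · rw [← hα p hp]; exact (him p (hsub₁ hp)).2.1
  · have := (hΦ.coords_first (hslice p hp)).2.2.2
    rw [dtT p hp, ← this, ← dxX p hp, ← mul_pow, inv_mul_cancel₀ (xne p hp), one_pow]
  · intro p hp
    have h1 := (hΦ.coords_second (hfs p hp)).2.2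
    have h2 := xne p hp
    rw [xconst _ p hp, xconst _ p hp, ← dxX p hp, ← dtX p hp, (him p (hsub₁ hp)).2.2, hα p hp] at h1
    rw [h1]
    field_simp
  · intro p hp
    have h1 : dx (fun p => dd ev (comp πv Φ) (p, w₀)) p = dd ex (dd ev (comp πv Φ)) (p, w₀) :=
      dsl _ (contDiffOn_dd oS (sc πv) ev) p hp _
    rw [h1, dd_comm oS (sc πv) (hslice p hp)]
    exact dd_eq_zero_of_eqOn oS (fun z hz => (hΦ.coords_second hz).1) (hslice p hp) _
  · intro p hp
    have h1 : Set.EqOn (fun q => (g (slice πt Φ w₀ q, slice πx Φ w₀ q, slice πy Φ w₀ q)).2)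
        (fun q => comp πv Φ (q, f q)) Ω₁ := by
      intro q hq
      simp only
      rw [← hα q hq, ← (him q (hsub₁ hq)).2.2]; rfl
    rw [dx_eq (fun q => _), dd_congr oΩ₁ h1 hp,
      dd_graph (differentiableAt_of_open oS (sc πv) (hfs p hp))
        (differentiableAt_of_open hΩ hf.smooth (hsub (hsub₁ hp))), (hΦ.triangular' (hfs p hp)).2.2.2,
      vconst p hp]
    have h2 : dd ((0, 1, 0), 0) (comp πv Φ) (p, f p) = 0 := (hΦ.coords_second (hfs p hp)).1
    rw [h2, dx_eq]; ring

end BLP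

/-! ### The first equation: dependence on y -/

namespace BLP

variable {Φ : OpenPartialHomeomorph Total Total}

/-- A polynomial function of `t` and `x`. -/
noncomputable def testU (p₀ : Base) (u₀ lam mu : ℝ) : Base → ℝ :=
  fun p => u₀ + mu * (p.1 - p₀.1) * (p.2.1 - p₀.2.1) + lam * (p.1 - p₀.1) ^ 2 / 2

theorem contDiff_testU (p₀ : Base) (u₀ lam mu : ℝ) : ContDiff ℝ ∞ (testU p₀ u₀ lam mu) := by
  unfold testU; fun_prop

theorem dx_testU (p₀ : Base) (u₀ lam mu : ℝ) (p : Base) :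
    dx (testU p₀ u₀ lam mu) p = mu * (p.1 - p₀.1) := by
  refine dx_of_hasDerivAt ((contDiff_testU p₀ u₀ lam mu).differentiable (by simp) p) ?_
  unfold testU
  dsimp only
  simpa using (((((hasDerivAt_id' p.2.1).sub_const p₀.2.1).const_mul (mu * (p.1 - p₀.1))).const_add
    u₀).add_const (lam * (p.1 - p₀.1) ^ 2 / 2))

theorem dt_testU (p₀ : Base) (u₀ lam mu : ℝ) (p : Base) :
    dt (testU p₀ u₀ lam mu) p = mu * (p.2.1 - p₀.2.1) + lam * (p.1 - p₀.1) := by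
  refine dt_of_hasDerivAt ((contDiff_testU p₀ u₀ lam mu).differentiable (by simp) p) ?_
  unfold testU
  dsimp only
  have h := (hasDerivAt_id' p.1).sub_const p₀.1
  refine ((((h.const_mul mu).mul_const (p.2.1 - p₀.2.1)).const_add u₀).fun_add
    (((h.fun_pow 2).const_mul lam).div_const 2)).congr_deriv ?_
  norm_num
  ring

theorem dy_testU (p₀ : Base) (u₀ lam mu : ℝ) (p : Base) : dy (testU p₀ u₀ lam mu) p = 0 := by
  refine dy_of_hasDerivAt ((contDiff_testU p₀ u₀ lam mu).differentiable (by simp) p) ?_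
  unfold testU
  dsimp only
  exact hasDerivAt_const p.2.2
    (u₀ + mu * (p.1 - p₀.1) * (p.2.1 - p₀.2.1) + lam * (p.1 - p₀.1) ^ 2 / 2)

theorem burgers_testU (p₀ : Base) (u₀ lam mu : ℝ) : burgers (testU p₀ u₀ lam mu) =
    fun p => mu * (p.2.1 - p₀.2.1) + lam * (p.1 - p₀.1)
      - 2 * testU p₀ u₀ lam mu p * (mu * (p.1 - p₀.1)) := by
  funext p
  have hd := (contDiff_testU p₀ u₀ lam mu).differentiable (by simp) p
  have h1 : dx (testU p₀ u₀ lam mu) = fun p => mu * (p.1 - p₀.1) := funext (dx_testU p₀ u₀ lam mu)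
  have h2 : DifferentiableAt ℝ (fun p : Base => mu * (p.1 - p₀.1)) p := by fun_prop
  have h3 : dx (fun p : Base => mu * (p.1 - p₀.1)) p = 0 :=
    dx_of_hasDerivAt h2 (by dsimp only; exact hasDerivAt_const p.2.1 (mu * (p.1 - p₀.1)))
  unfold burgers
  rw [dt_testU, h1, dx_eq, dd_sub _ (hd.fun_pow 2) h2, dd_pow _ hd, ← dx_eq, ← dx_eq, h3, dx_testU]
  norm_num

/-- `mu` prescribes the x-derivative of the Burgers expression at the centre and, for fixed `mu`,
`lam` prescribes its t-derivative, while its value and its y-derivative vanish there. -/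
theorem dd_burgers_testU (p₀ : Base) (u₀ lam mu : ℝ) :
    burgers (testU p₀ u₀ lam mu) p₀ = 0 ∧
    dt (burgers (testU p₀ u₀ lam mu)) p₀ = lam - 2 * u₀ * mu ∧
    dx (burgers (testU p₀ u₀ lam mu)) p₀ = mu ∧ dy (burgers (testU p₀ u₀ lam mu)) p₀ = 0 := by
  have hu := contDiff_testU p₀ u₀ lam mu
  have hs : DifferentiableAt ℝ (burgers (testU p₀ u₀ lam mu)) p₀ := differentiableAt_of_open isOpen_univ
    (contDiffOn_burgers isOpen_univ hu.contDiffOn) (Set.mem_univ p₀)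
  rw [burgers_testU] at hs ⊢
  refine ⟨by simp, dt_of_hasDerivAt hs ?_, dx_of_hasDerivAt hs ?_, dy_of_hasDerivAt hs ?_⟩
  · simp only [sub_self, mul_zero, zero_add, testU, add_zero]
    have h := (hasDerivAt_id' p₀.1).sub_const p₀.1
    refine ((h.const_mul lam).fun_sub (((((h.fun_pow 2).const_mul lam).div_const 2).const_add
      u₀).const_mul 2 |>.fun_mul (h.const_mul mu))).congr_deriv ?_
    norm_num
  · simp only [sub_self, mul_zero, add_zero, sub_zero]
    simpa using ((hasDerivAt_id' p₀.2.1).sub_const p₀.2.1).const_mul mu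
  · simp only [sub_self, mul_zero, add_zero]
    exact hasDerivAt_const p₀.2.2 (0 : ℝ)

/-- `t̃` and `x̃` do not depend on `y`. -/
theorem IsPointSymmetry.coords_y (hΦ : IsPointSymmetry Φ) {z : Total} (hz : z ∈ Φ.source) :
    dd ey (comp πt Φ) z = 0 ∧ dd ey (comp πx Φ) z = 0 := by
  obtain ⟨p₀, w₀⟩ := z
  set T := slice πt Φ w₀
  set X := slice πx Φ w₀
  set s : Base → ℝ := fun p => (dx X p)⁻¹
  have oS := Φ.open_source
  -- τ and χ are the t̃- and x̃-derivatives of the Burgers expression of the image; its ỹ-derivative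
  -- vanishes by the first equation, since v is constant. The three identities are the y-, x- and
  -- t-derivatives of `burgers_comp`.
  have key : ∀ lam mu : ℝ, ∃ τ χ : ℝ,
      - dy (fun q => s q ^ 2 * dt (fun q => dt X q * s q ^ 2 / 2) q) p₀ = dy T p₀ * τ + dy X p₀ * χ ∧
      s p₀ ^ 3 * mu - dx (fun q => s q ^ 2 * dt (fun q => dt X q * s q ^ 2 / 2) q) p₀ =
        dx X p₀ * χ ∧
      s p₀ ^ 3 * (lam - 2 * w₀.1 * mu)
        - dt (fun q => s q ^ 2 * dt (fun q => dt X q * s q ^ 2 / 2) q) p₀ =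
        dt T p₀ * τ + dt X p₀ * χ ∧ s p₀ ≠ 0 ∧ dx X p₀ ≠ 0 ∧ dt T p₀ ≠ 0 := by
    intro lam mu
    have hsol := isSolutionOn_of_separated (contDiff_testU p₀ w₀.1 lam mu)
      (dy_testU p₀ w₀.1 lam mu) w₀.2 Set.univ
    obtain ⟨Ω₁, Ω', g, a, hp, -, hg, B, -, hgu, sa, -, hax0, hax⟩ := hΦ.exists_baseChange hz isOpen_univ
      (Set.mem_univ p₀) hsol (by simp [testU])
    obtain ⟨b0, bt, bx, bY⟩ := dd_burgers_testU p₀ w₀.1 lam mu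
    have su : ContDiffOn ℝ ∞ (testU p₀ w₀.1 lam mu) Ω₁ := (contDiff_testU p₀ w₀.1 lam mu).contDiffOn
    have hchain : ∀ e, dd e (fun q => burgers (fun q => (g q).1) (T q, X q, slice πy Φ w₀ q)) p₀ =
        s p₀ ^ 3 * dd e (burgers (testU p₀ w₀.1 lam mu)) p₀
        - dd e (fun q => s q ^ 2 * dt (fun q => dt X q * s q ^ 2 / 2) q) p₀ := by
      intro e
      have ds := B.diff B.ss hp
      have db := B.diff (contDiffOn_burgers B.isOpen su) hp
      have dω := B.diff (contDiffOn_dt B.isOpen B.shift_smooth) hp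
      rw [dd_congr B.isOpen (fun q hq => B.burgers_comp hg.smooth.fst su hgu hq) hp,
        dd_sub _ ((ds.fun_pow 3).fun_mul db) ((ds.fun_pow 2).fun_mul dω),
        dd_mul _ (ds.fun_pow 3) db, b0]
      ring
    have hb := contDiffOn_burgers B.isOpen' hg.smooth.fst
    have ht := hchain (1, 0, 0)
    have hx := hchain (0, 1, 0)
    have hy := hchain (0, 0, 1)
    rw [B.chain hb hp] at ht hx hy
    have ehu := (eq_u_iff B.isOpen' hg.smooth.fst (B.maps p₀ hp)).1 (hg.eq_u _ (B.maps p₀ hp))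
    rw [B.dx_dx_dx_comp hg.smooth.snd contDiffOn_const sa hax hax0 hp] at ehu
    have hv0 : dx (dx (dx fun _ : Base => w₀.2)) p₀ = 0 := by
      have : dx (fun _ : Base => w₀.2) = fun _ => 0 := funext fun p => dd_const _ _
      rw [this]
      have : dx (fun _ : Base => (0 : ℝ)) = fun _ => 0 := funext fun p => dd_const _ _
      rw [this, this]
    rw [hv0, mul_zero, mul_zero] at ehu
    simp only [← dt_eq, ← dx_eq, ← dy_eq, bt, bx, bY, B.Tx p₀ hp, B.Yx p₀ hp, B.Yt p₀ hp, ehu] at ht hx hy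
    refine ⟨dt (burgers fun q => (g q).1) (T p₀, X p₀, slice πy Φ w₀ p₀),
      dx (burgers fun q => (g q).1) (T p₀, X p₀, slice πy Φ w₀ p₀), ?_, ?_, ?_, B.s_ne hp, right_ne_zero_of_mul_eq_one (B.s_mul p₀ hp),
      right_ne_zero_of_mul_eq_one (B.sq_mul p₀ hp)⟩
    · linear_combination -hy
    · linear_combination -hx
    · linear_combination -ht
  -- Raising `lam` changes τ but not χ, which forces T_y = 0; raising `mu` then changes χ, which
  -- forces X_y = 0.
  obtain ⟨τ, χ, y0, x0, t0, hs, hX, hT⟩ := key 0 0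
  obtain ⟨τ', χ', y1, x1, t1, -⟩ := key 1 0
  obtain ⟨τ'', χ'', y2, x2, t2, -⟩ := key 0 1
  have hs3 : s p₀ ^ 3 ≠ 0 := pow_ne_zero 3 hs
  have Ty : dy T p₀ = 0 := by
    have c1 : χ' = χ := mul_left_cancel₀ hX (by linear_combination x0 - x1)
    rw [c1] at y1 t1
    have e1 : dy T p₀ * (τ' - τ) = 0 := by linear_combination y0 - y1
    refine (mul_eq_zero.1 e1).resolve_right fun h => hs3 ?_
    linear_combination t1 - t0 + dt T p₀ * h
  have Xy : dy X p₀ = 0 := by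
    rw [Ty] at y0 y2
    have e1 : dy X p₀ * (χ'' - χ) = 0 := by linear_combination y0 - y2
    refine (mul_eq_zero.1 e1).resolve_right fun h => hs3 ?_
    linear_combination x2 - x0 + dx X p₀ * h
  have dsl : ∀ π, dy (slice π Φ w₀) p₀ = dd ey (comp π Φ) (p₀, w₀) := fun π =>
    dd_slice (differentiableAt_of_open oS (hΦ.contDiffOn_comp π) hz) _
  exact ⟨(dsl πt).symm.trans Ty, (dsl πx).symm.trans Xy⟩

/-- There are solutions with `v_xxx ≠ 0` through each point. -/
theorem exists_solution_dx_dx_dx_ne_zero (p₀ : Base) (w₀ : Fiber) :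
    ∃ (f : Base → Fiber) (Ω : Set Base), IsOpen Ω ∧ p₀ ∈ Ω ∧ IsSolutionOn f Ω ∧ f p₀ = w₀ ∧
      dx (dx (dx fun q => (f q).2)) p₀ ≠ 0 := by
  -- Here ψ + c is the affine function Q below, u = α/2 + 1/Q and v is 1/Q plus a constant, so that
  -- v_xxx = −6/Q⁴. The choice of α and d₀ gives the prescribed value at the centre.
  let P : JetParams := 
    { α := 2 * (w₀.1 - 1), β := 1, σ := 0, ρ := 0, A := 0, d₀ := w₀.2 - 1, d₁ := 0, e := 0 }
  have oΩ := P.isOpen_dom p₀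
  have hp := P.mem_dom p₀ one_ne_zero
  have hs := P.isSolutionOn_sol p₀
  refine ⟨P.sol p₀, P.dom p₀, oΩ, hp, hs, ?_, ?_⟩
  · rw [P.sol_center]
    ext <;> simp [P]
  · let Q : Base → ℝ := fun p => 1 + 2 * (w₀.1 - 1) * (p.1 - p₀.1) + (p.2.1 - p₀.2.1) + (p.2.2 - p₀.2.2)
    have sQ : ContDiff ℝ ∞ Q := by simp only [Q]; fun_prop
    have dQ : ∀ p, DifferentiableAt ℝ Q p := fun p => sQ.differentiable (by simp) p
    have hQx : ∀ p, dx Q p = 1 := fun p => dx_of_hasDerivAt (dQ p) (by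
      simpa [Q] using ((((hasDerivAt_id' p.2.1).sub_const p₀.2.1).const_add
        (1 + 2 * (w₀.1 - 1) * (p.1 - p₀.1))).add_const (p.2.2 - p₀.2.2)))
    let V : Set Base := {p | Q p ≠ 0}
    have oV : IsOpen V := isOpen_ne_fun sQ.continuous continuous_const
    have hV : p₀ ∈ V := by simp [V, Q]
    have hw : ∀ p ∈ V, DifferentiableAt ℝ (fun q => (Q q)⁻¹) p := fun p hp => (dQ p).fun_inv hp
    have hwx : ∀ p ∈ V, dx (fun q => (Q q)⁻¹) p = (-1) * (Q p)⁻¹ ^ 2 := fun p hp => by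
      have hp' : Q p ≠ 0 := hp
      rw [dx_eq, dd_inv _ (dQ p) hp', ← dx_eq, hQx]; field_simp
    have hpow : ∀ (c : ℝ) (n : ℕ), ∀ p ∈ V, dx (fun q => c * (Q q)⁻¹ ^ n) p =
        (-c * n) * (Q p)⁻¹ ^ (n - 1 + 2) := fun c n p hp => by
      rw [dx_eq, dd_const_mul _ ((hw p hp).fun_pow n), dd_pow _ (hw p hp), ← dx_eq, hwx p hp]; ring
    have h0 : (fun q => (P.sol p₀ q).2) = fun q => (Q q)⁻¹ + (w₀.2 - 1) := by
      funext q
      simp [JetParams.sol, JetParams.c', JetParams.ψ, JetParams.c, JetParams.d, P, Q]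
    have h1 : ∀ p ∈ V, dx (fun q => (P.sol p₀ q).2) p = (-1) * (Q p)⁻¹ ^ 2 := fun p hp => by
      rw [h0, dx_eq, dd_add _ (hw p hp) (differentiableAt_const _), dd_const, ← dx_eq, hwx p hp,
        add_zero]
    have h2 : ∀ p ∈ V, dx (dx fun q => (P.sol p₀ q).2) p = 2 * (Q p)⁻¹ ^ 3 := fun p hp => by
      rw [dx_eq (dx _), dd_congr oV h1 hp, ← dx_eq, hpow _ _ p hp]; norm_num
    rw [dx_eq (dx _), dd_congr oV h2 hV, ← dx_eq, hpow _ _ p₀ hV]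
    have : Q p₀ ≠ 0 := hV
    simp [this]

/-- In B_y = 2v_xxx the left side scales by s³/ỹ_y and the right side by s³ṽ_v. A solution with
v_xxx ≠ 0 makes the factors equal. -/
theorem IsPointSymmetry.dv_mul_dy (hΦ : IsPointSymmetry Φ) {z : Total} (hz : z ∈ Φ.source) :
    dd ey (comp πy Φ) z * dd ev (comp πv Φ) z = 1 := by
  obtain ⟨p₀, w₀⟩ := z
  obtain ⟨f, Ω, oΩ, hp₀, hf, hf₀, hne⟩ := exists_solution_dx_dx_dx_ne_zero p₀ w₀
  obtain ⟨Ω₁, Ω', g, a, hp, hsub, hg, B, hsl, hgu, sa, ha, hax0, hax⟩ :=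
    hΦ.exists_baseChange hz oΩ hp₀ hf hf₀
  have oS := Φ.open_source
  have dsl : ∀ π, ∀ p ∈ Ω₁, dy (slice π Φ w₀) p = dd ey (comp π Φ) (p, w₀) := fun π p hp =>
    dd_slice (differentiableAt_of_open oS (hΦ.contDiffOn_comp π) (hsl p hp)) _
  have sf : ContDiffOn ℝ ∞ f Ω₁ := hf.smooth.mono hsub
  have h1 := B.dy_burgers_comp hg.smooth.fst sf.fst hgu
    (fun p hp => (dsl πt p hp).trans (hΦ.coords_y (hsl p hp)).1)
    (fun p hp => (dsl πx p hp).trans (hΦ.coords_y (hsl p hp)).2) hp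
  have e1 := (eq_u_iff oΩ hf.smooth.fst hp₀).1 (hf.eq_u p₀ hp₀)
  have e2 := (eq_u_iff B.isOpen' hg.smooth.fst (B.maps p₀ hp)).1 (hg.eq_u _ (B.maps p₀ hp))
  rw [B.dx_dx_dx_comp hg.smooth.snd sf.snd sa hax hax0 hp] at e2
  rw [e1, e2, dsl πy p₀ hp, ha p₀ hp] at h1
  have hs := pow_ne_zero 3 (B.s_ne hp)
  have : (dx (slice πx Φ w₀) p₀)⁻¹ ^ 3 * dx (dx (dx fun q => (f q).2)) p₀ ≠ 0 := mul_ne_zero hs hne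
  apply mul_right_cancel₀ this
  linear_combination h1 / 2

end BLP

/-! ### Normal form of point symmetries -/

namespace BLP

/-- The form of the differential of a point symmetry at a point: here `ξ = x̃_t`, `σ = x̃_x`,
`η = ỹ_y` and `ν = ṽ_y`. -/
structure NormalAt (F : Total → Total) (z : Total) (ξ σ η ν : ℝ) : Prop where
  σ_ne : σ ≠ 0
  η_ne : η ≠ 0
  map_t : ∀ w, (fderiv ℝ F z w).1.1 = σ ^ 2 * w.1.1
  map_x : ∀ w, (fderiv ℝ F z w).1.2.1 = ξ * w.1.1 + σ * w.1.2.1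
  map_y : ∀ w, (fderiv ℝ F z w).1.2.2 = η * w.1.2.2
  map_v : ∀ w, (fderiv ℝ F z w).2.2 = ν * w.1.2.2 + η⁻¹ * w.2.2
  value_u : (F z).2.1 = (z.2.1 - ξ / (2 * σ)) / σ

variable {Φ : OpenPartialHomeomorph Total Total}

/-- Point symmetries are of normal form. -/
theorem IsPointSymmetry.normalAt (hΦ : IsPointSymmetry Φ) {z : Total} (hz : z ∈ Φ.source) :
    NormalAt Φ z (dd et (comp πx Φ) z) (dd ex (comp πx Φ) z) (dd ey (comp πy Φ) z)
      (dd ey (comp πv Φ) z) := by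
  obtain ⟨⟨tx, tu, tv⟩, ⟨yx, yu, yv⟩, xu, vu⟩ := hΦ.triangular' hz
  obtain ⟨yt, xv, hx, hxt⟩ := hΦ.coords_first hz
  obtain ⟨vx, vt, hu⟩ := hΦ.coords_second hz
  obtain ⟨ty, xy⟩ := hΦ.coords_y hz
  have hvy := hΦ.dv_mul_dy hz
  refine ⟨hx, hΦ.dy_ne_zero hz, fun w => ?_, fun w => ?_, fun w => ?_, fun w => ?_, hu⟩
  · rw [← πt_apply, hΦ.coord_fderiv hz, tx, tu, tv, ty, hxt]; ring
  · rw [← πx_apply, hΦ.coord_fderiv hz, xu, xv, xy]; ring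
  · rw [← πy_apply, hΦ.coord_fderiv hz, yx, yu, yv, yt]; ring
  · rw [← πv_apply, hΦ.coord_fderiv hz, vx, vt, vu, ← eq_inv_of_mul_eq_one_right hvy]; ring

/-- Diffeomorphisms of normal form are point symmetries. -/
theorem isPointSymmetry_of_normalAt (hs : ContDiffOn ℝ ∞ Φ Φ.source)
    (hs' : ContDiffOn ℝ ∞ Φ.symm Φ.target)
    (hN : ∀ z ∈ Φ.source, ∃ ξ σ η ν, NormalAt Φ z ξ σ η ν) : IsPointSymmetry Φ := by
  refine ⟨hs, hs', fun Ω Ω' f g oΩ oΩ' sf sg hsub him => ?_⟩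
  have hmem : ∀ p ∈ Ω, (p, f p) ∈ Φ.source := fun p hp => hsub ⟨p, hp, rfl⟩
  let T : Base → ℝ := fun p => (Φ (p, f p)).1.1
  let X : Base → ℝ := fun p => (Φ (p, f p)).1.2.1
  let Y : Base → ℝ := fun p => (Φ (p, f p)).1.2.2
  let V : Base → ℝ := fun p => (Φ (p, f p)).2.2
  have sΦ : ContDiffOn ℝ ∞ (fun p => Φ (p, f p)) Ω := hs.comp (contDiffOn_id.prodMk sf) hmem
  have sT : ContDiffOn ℝ ∞ T Ω := sΦ.fst.fst
  have sX : ContDiffOn ℝ ∞ X Ω := sΦ.fst.snd.fst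
  have sY : ContDiffOn ℝ ∞ Y Ω := sΦ.fst.snd.snd
  have hd : ∀ (π : Total →L[ℝ] ℝ), ∀ p ∈ Ω, ∀ e,
      dd e (fun p => π (Φ (p, f p))) p = π (fderiv ℝ Φ (p, f p) (e, fderiv ℝ f p e)) := by
    intro π p hp e
    have h1 := fderiv_graph (differentiableAt_of_open oΩ sf hp)
    have h2 := differentiableAt_of_open Φ.open_source hs (hmem p hp)
    rw [dd_clm_comp π (differentiableAt_of_open oΩ sΦ hp)]
    congr 1
    have h3 : dd e (fun p => Φ (p, f p)) p = _ := dd_comp (a := fun p => (p, f p)) h2 h1.differentiableAt e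
    unfold dd at h3
    rw [h3, h1.fderiv]; rfl
  have hgr : ∀ p ∈ Ω, (T p, X p, Y p) ∈ Ω' ∧ g (T p, X p, Y p) = (Φ (p, f p)).2 := by
    intro p hp
    have : Φ (p, f p) ∈ graphOver g Ω' := by rw [← him]; exact ⟨_, ⟨p, hp, rfl⟩, rfl⟩
    obtain ⟨q, hq, e⟩ := this
    have e1 : q = (T p, X p, Y p) := congrArg Prod.fst e
    rw [← e1]
    exact ⟨hq, congrArg Prod.snd e⟩
  have hsurj : ∀ q ∈ Ω', ∃ p ∈ Ω, (T p, X p, Y p) = q := by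
    intro q hq
    have : (q, g q) ∈ Φ '' graphOver f Ω := by rw [him]; exact ⟨q, hq, rfl⟩
    obtain ⟨_, ⟨p, hp, rfl⟩, e⟩ := this
    exact ⟨p, hp, congrArg Prod.fst e⟩
  have hder : ∀ p ∈ Ω, dx T p = 0 ∧ dy T p = 0 ∧ dt Y p = 0 ∧ dx Y p = 0 ∧ dy X p = 0 ∧
      dx X p ≠ 0 ∧ dy Y p ≠ 0 ∧ dx X p ^ 2 = dt T p ∧
      dt V p = (dy Y p)⁻¹ * dt (fun q => (f q).2) p ∧
      dx V p = (dy Y p)⁻¹ * dx (fun q => (f q).2) p ∧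
      (Φ (p, f p)).2.1 = (f p).1 * (dx X p)⁻¹ - dt X p * (dx X p)⁻¹ ^ 2 / 2 := by
    intro p hp
    obtain ⟨ξ, σ, η, ν, N⟩ := hN _ (hmem p hp)
    have fT : ∀ e, dd e T p = σ ^ 2 * e.1 := fun e => (hd πt p hp e).trans (N.map_t _)
    have fX : ∀ e, dd e X p = ξ * e.1 + σ * e.2.1 := fun e => (hd πx p hp e).trans (N.map_x _)
    have fY : ∀ e, dd e Y p = η * e.2.2 := fun e => (hd πy p hp e).trans (N.map_y _)
    have fV : ∀ e, dd e V p = ν * e.2.2 + η⁻¹ * (fderiv ℝ f p e).2 :=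
      fun e => (hd πv p hp e).trans (N.map_v _)
    have f2 : ∀ e, dd e (fun q => (f q).2) p = (fderiv ℝ f p e).2 := fun e =>
      dd_clm_comp (ContinuousLinearMap.snd ℝ ℝ ℝ) (differentiableAt_of_open oΩ sf hp) e
    have hσ := N.σ_ne
    have hη := N.η_ne
    simp only [dt_eq, dx_eq, dy_eq, fT, fX, fY, fV, f2]
    refine ⟨by simp, by simp, by simp, by simp, by simp, by simpa, by simpa, by simp, by simp,
      by simp, ?_⟩
    rw [N.value_u]
    simp only [mul_one, mul_zero, zero_add, add_zero]
    field_simp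
  have B : BaseChange Ω Ω' T X Y (fun p => (dx X p)⁻¹) :=
    { isOpen := oΩ
      isOpen' := oΩ'
      sT := sT
      sX := sX
      sY := sY
      ss := (contDiffOn_dx oΩ sX).inv fun p hp => (hder p hp).2.2.2.2.2.1
      maps := fun p hp => (hgr p hp).1
      Tx := fun p hp => (hder p hp).1
      Yt := fun p hp => (hder p hp).2.2.1
      Yx := fun p hp => (hder p hp).2.2.2.1
      s_mul := fun p hp => inv_mul_cancel₀ (hder p hp).2.2.2.2.2.1
      sq_mul := fun p hp => by
        obtain ⟨-, -, -, -, -, h1, -, h2, -⟩ := hder p hp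
        rw [← h2, ← mul_pow, inv_mul_cancel₀ h1, one_pow] }
  have sa : ContDiffOn ℝ ∞ (fun p => (dy Y p)⁻¹) Ω :=
    (contDiffOn_dy oΩ sY).inv fun p hp => (hder p hp).2.2.2.2.2.2.1
  have ax : ∀ p ∈ Ω, dx (fun p => (dy Y p)⁻¹) p = 0 := by
    intro p hp
    rw [dx_eq, dd_inv _ (B.diff (contDiffOn_dy oΩ sY) hp) (hder p hp).2.2.2.2.2.2.1, dy_eq Y,
      dd_comm oΩ sY hp, dd_eq_zero_of_eqOn (g := dd (0, 1, 0) Y) oΩ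
        (fun q hq => (hder q hq).2.2.2.1) hp]
    simp
  have hgu : ∀ p ∈ Ω, (g (T p, X p, Y p)).1 =
      (f p).1 * (dx X p)⁻¹ - dt X p * (dx X p)⁻¹ ^ 2 / 2 := fun p hp => by
    rw [(hgr p hp).2, (hder p hp).2.2.2.2.2.2.2.2.2.2]
  have hV : Set.EqOn (fun q => (g (T q, X q, Y q)).2) V Ω := fun q hq => by
    simp only [(hgr q hq).2]; rfl
  have hat : ∀ p ∈ Ω, dt (fun q => (g (T q, X q, Y q)).2) p = (dy Y p)⁻¹ * dt (fun q => (f q).2) p :=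
    fun p hp => (dd_congr oΩ hV hp _).trans (hder p hp).2.2.2.2.2.2.2.2.1
  have hax : ∀ p ∈ Ω, dx (fun q => (g (T q, X q, Y q)).2) p = (dy Y p)⁻¹ * dx (fun q => (f q).2) p :=
    fun p hp => (dd_congr oΩ hV hp _).trans (hder p hp).2.2.2.2.2.2.2.2.2.1
  -- At corresponding points each equation for the image is a nonzero multiple of the same equation
  -- for the original pair, which gives both implications at once.
  have key : ∀ p ∈ Ω,
      ((dy (dt fun q => (f q).1) p = dy (dx fun q => (f q).1 ^ 2 - dx (fun q' => (f q').1) q) p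
          + 2 * dx (dx (dx fun q => (f q).2)) p) ↔
        (dy (dt fun q => (g q).1) (T p, X p, Y p) =
          dy (dx fun q => (g q).1 ^ 2 - dx (fun q' => (g q').1) q) (T p, X p, Y p)
          + 2 * dx (dx (dx fun q => (g q).2)) (T p, X p, Y p))) ∧
      (dt (fun q => (f q).2) p = dx (dx fun q => (f q).2) p + 2 * (f p).1 * dx (fun q => (f q).2) p ↔
        dt (fun q => (g q).2) (T p, X p, Y p) = dx (dx fun q => (g q).2) (T p, X p, Y p)
          + 2 * (g (T p, X p, Y p)).1 * dx (fun q => (g q).2) (T p, X p, Y p)) := by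
    intro p hp
    have hσ := B.s_ne hp
    have hη := (hder p hp).2.2.2.2.2.2.1
    constructor
    · rw [eq_u_iff oΩ sf.fst hp, eq_u_iff oΩ' sg.fst (B.maps p hp)]
      have h1 := B.dy_burgers_comp sg.fst sf.fst hgu (fun p hp => (hder p hp).2.1)
        (fun p hp => (hder p hp).2.2.2.2.1) hp
      have h2 := B.dx_dx_dx_comp sg.snd sf.snd sa hax ax hp
      have hs3 := pow_ne_zero 3 hσ
      have hηη := mul_inv_cancel₀ hη
      rw [h2]
      constructor
      · intro h
        apply mul_left_cancel₀ hη
        rw [h] at h1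
        linear_combination h1 - 2 * (dx X p)⁻¹ ^ 3 * dx (dx (dx fun q => (f q).2)) p * hηη
      · intro h
        apply mul_left_cancel₀ hs3
        rw [h] at h1
        linear_combination -h1 + 2 * (dx X p)⁻¹ ^ 3 * dx (dx (dx fun q => (f q).2)) p * hηη
    · have h := B.second_eq_comp (g := fun q => (g q).1) (u := fun q => (f q).1) sg.snd sf.snd sa hgu
        hat hax ax hp
      rw [← sub_eq_zero, ← sub_eq_zero (a := dt (fun q => (g q).2) (T p, X p, Y p)), h,
        mul_eq_zero, or_iff_right (mul_ne_zero (pow_ne_zero 2 hσ) (inv_ne_zero hη))]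
  constructor
  · rintro ⟨-, h1, h2⟩
    refine ⟨sg, fun q hq => ?_, fun q hq => ?_⟩
    · obtain ⟨p, hp, rfl⟩ := hsurj q hq
      exact (key p hp).1.1 (h1 p hp)
    · obtain ⟨p, hp, rfl⟩ := hsurj q hq
      exact (key p hp).2.1 (h2 p hp)
  · rintro ⟨-, h1, h2⟩
    exact ⟨sf, fun p hp => (key p hp).1.2 (h1 _ (B.maps p hp)),
      fun p hp => (key p hp).2.2 (h2 _ (B.maps p hp))⟩

end BLP

/-! ### Signs as obstructions; discreteness of the reflections -/

namespace BLP

theorem pos_of_isPreconnected {α : Type*} [TopologicalSpace α] {C : Set α} (hC : IsPreconnected C)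
    {h : α → ℝ} (hh : ContinuousOn h C) (hne : ∀ c ∈ C, h c ≠ 0) {a b : α} (ha : a ∈ C) (hb : b ∈ C)
    (hpos : 0 < h a) : 0 < h b := by
  by_contra hlt
  obtain ⟨c, hc, h0⟩ := hC.intermediate_value hb ha hh ⟨not_lt.1 hlt, hpos.le⟩
  exact hne c hc h0

/-- The sign of a nonvanishing directional derivative of a coordinate cannot change along a
continuous path of maps. -/
theorem dd_pos_of_path {W : Set Total} (hW : IsOpen W) {F : ℝ → Total → Total} (π : Total →L[ℝ] ℝ)
    (w : Total) (hw : 0 < π w) (hs : ∀ s ∈ Set.Icc (0 : ℝ) 1, ContDiffOn ℝ ∞ (fun z => π (F s z)) W)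
    (hne : ∀ s ∈ Set.Icc (0 : ℝ) 1, ∀ z ∈ W, dd w (fun z => π (F s z)) z ≠ 0)
    (h0 : Set.EqOn (F 0) id W)
    (hc : ContinuousOn (fun q : ℝ × Total => F q.1 q.2) (Set.Icc (0 : ℝ) 1 ×ˢ W)) {z : Total}
    (hz : z ∈ W) : 0 < dd w (fun z => π (F 1 z)) z := by
  obtain ⟨ρ, hρ, hball⟩ := Metric.isOpen_iff.1 hW z hz
  obtain ⟨h, hh, hz'⟩ : ∃ h : ℝ, 0 < h ∧ z + h • w ∈ Metric.ball z ρ := by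
    have hcont : Continuous fun h : ℝ => z + h • w := by fun_prop
    have : ∀ᶠ h in nhds (0 : ℝ), z + h • w ∈ Metric.ball z ρ :=
      hcont.continuousAt.eventually_mem (by simpa using Metric.ball_mem_nhds z hρ)
    obtain ⟨ε, hε, hb⟩ := Metric.eventually_nhds_iff.1 this
    refine ⟨ε / 2, by positivity, hb ?_⟩
    rw [Real.dist_eq, sub_zero, abs_of_pos (by positivity)]; linarith
  have hzb : z ∈ Metric.ball z ρ := Metric.mem_ball_self hρ
  -- For r = 0 the derivative need not be continuous in s, so the sign is followed on a difference
  -- quotient. This is continuous in s and nonzero, being a value of the derivative.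
  have mvt : ∀ s ∈ Set.Icc (0 : ℝ) 1, ∃ y ∈ Metric.ball z ρ,
      π (F s (z + h • w)) - π (F s z) = h * dd w (fun z => π (F s z)) y := by
    intro s hsI
    obtain ⟨y, hy, e⟩ := domain_mvt (f := fun z => π (F s z)) (f' := fderiv ℝ fun z => π (F s z))
      (fun x hx => (differentiableAt_of_open hW (hs s hsI) (hball hx)).hasFDerivAt.hasFDerivWithinAt)
      (convex_ball z ρ) hzb hz'
    refine ⟨y, (convex_ball z ρ).segment_subset hzb hz' hy, ?_⟩
    rw [e, add_sub_cancel_left, map_smul, smul_eq_mul]; rfl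
  have hcs : ∀ y ∈ W, ContinuousOn (fun s => F s y) (Set.Icc (0 : ℝ) 1) := fun y hy =>
    hc.comp (f := fun s => (s, y)) (by fun_prop) fun s hs => ⟨hs, hy⟩
  have hpos : 0 < π (F 1 (z + h • w)) - π (F 1 z) := by
    refine pos_of_isPreconnected (h := fun s => π (F s (z + h • w)) - π (F s z))
      (a := (0 : ℝ)) (b := 1) isPreconnected_Icc
      ((π.continuous.comp_continuousOn (hcs _ (hball hz'))).sub
        (π.continuous.comp_continuousOn (hcs _ hz))) (fun s hsI => ?_) (by simp) (by simp) ?_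
    · obtain ⟨y, hy, e⟩ := mvt s hsI
      simp only [e]
      exact mul_ne_zero hh.ne' (hne s hsI y (hball hy))
    · simp only [h0 hz, h0 (hball hz'), id, map_add, map_smul, smul_eq_mul, add_sub_cancel_left]
      positivity
  have h1 : (1 : ℝ) ∈ Set.Icc (0 : ℝ) 1 := by simp
  -- At s = 1 the sign is known at the intermediate point y only; the derivative has no zero on the
  -- ball, so the sign carries over to z.
  obtain ⟨y, hy, e⟩ := mvt 1 h1
  rw [e] at hpos
  exact pos_of_isPreconnected (convex_ball z ρ).isPreconnected
    ((contDiffOn_dd hW (hs 1 h1) w).continuousOn.mono hball) (fun c hc => hne 1 h1 c (hball hc)) hy hzb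
    (pos_of_mul_pos_right hpos hh.le)

theorem IsContinuousPointSymmetry.dd_pos {r : ℕ∞} {Ψ : OpenPartialHomeomorph Total Total}
    (hΨ : IsContinuousPointSymmetry r Ψ) {z : Total} (hz : z ∈ Ψ.source) :
    0 < dd ex (comp πx Ψ) z ∧ 0 < dd ey (comp πy Ψ) z := by
  obtain ⟨F, hF, h0, h1, hc⟩ := hΨ
  have hs : ∀ (π : Total →L[ℝ] ℝ), ∀ s ∈ Set.Icc (0 : ℝ) 1,
      ContDiffOn ℝ ∞ (fun z => π (F s z)) Ψ.source := fun π s hs => by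
    rw [← (hF s hs).2]; exact (hF s hs).1.contDiffOn_comp π
  have hN : ∀ s ∈ Set.Icc (0 : ℝ) 1, ∀ z ∈ Ψ.source,
      dd ex (comp πx (F s)) z ≠ 0 ∧ dd ey (comp πy (F s)) z ≠ 0 := fun s hs z hz => by
    have hz' : z ∈ (F s).source := by rw [(hF s hs).2]; exact hz
    exact ⟨((hF s hs).1.normalAt hz').σ_ne, ((hF s hs).1.normalAt hz').η_ne⟩
  have heq : ∀ π : Total →L[ℝ] ℝ, Set.EqOn (comp π Ψ) (fun z => π (F 1 z)) Ψ.source := fun π z hz =>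
    congrArg π (h1 hz).symm
  rw [dd_congr Ψ.open_source (heq πx) hz, dd_congr Ψ.open_source (heq πy) hz]
  exact ⟨dd_pos_of_path Ψ.open_source πx ex (by simp [ex]) (hs πx) (fun s hs z hz => (hN s hs z hz).1)
      h0 hc.continuousOn hz,
    dd_pos_of_path Ψ.open_source πy ey (by simp [ey]) (hs πy) (fun s hs z hz => (hN s hs z hz).2)
      h0 hc.continuousOn hz⟩

/-- The map `(t, x, y, u, v) ↦ (t, a x, b y, a u, b v)`. -/
noncomputable def signMap (a b : ℝ) : Total →L[ℝ] Total :=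
  (πt.prod ((a • πx).prod (b • πy))).prod ((a • πu).prod (b • πv))

theorem signMap_apply (a b : ℝ) (z : Total) :
    signMap a b z = ((z.1.1, a * z.1.2.1, b * z.1.2.2), (a * z.2.1, b * z.2.2)) := rfl

theorem signMap_signMap (a b a' b' : ℝ) (z : Total) :
    signMap a b (signMap a' b' z) = signMap (a * a') (b * b') z := by
  simp only [signMap_apply, mul_assoc]

@[simp] theorem signMap_one (z : Total) : signMap 1 1 z = z := by simp [signMap_apply]

theorem NormalAt.signMap_comp {F : Total → Total} {z : Total} {ξ σ η ν : ℝ}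
    (h : NormalAt F z ξ σ η ν) (hd : DifferentiableAt ℝ F z) {a b : ℝ} (ha : a * a = 1)
    (hb : b * b = 1) :
    NormalAt (fun z => signMap a b (F z)) z (a * ξ) (a * σ) (b * η) (b * ν) := by
  have ha0 : a ≠ 0 := left_ne_zero_of_mul_eq_one ha
  have hb0 : b ≠ 0 := left_ne_zero_of_mul_eq_one hb
  have hb' : b⁻¹ = b := inv_eq_of_mul_eq_one_right hb
  have hf : ∀ w, fderiv ℝ (fun z => signMap a b (F z)) z w = signMap a b (fderiv ℝ F z w) :=
    fun w => dd_clm_comp (signMap a b) hd w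
  have hσ := h.σ_ne
  refine ⟨mul_ne_zero ha0 h.σ_ne, mul_ne_zero hb0 h.η_ne, fun w => ?_, fun w => ?_, fun w => ?_,
    fun w => ?_, ?_⟩
  · rw [hf, signMap_apply, h.map_t]; linear_combination (- σ ^ 2 * w.1.1) * ha
  · rw [hf, signMap_apply]; simp only [h.map_x]; ring
  · rw [hf, signMap_apply]; simp only [h.map_y]; ring
  · rw [hf, signMap_apply, mul_inv, hb']; simp only [h.map_v]; ring
  · rw [signMap_apply]
    simp only [h.value_u]
    field_simp
    linear_combination (2 * z.2.1 * σ - ξ) * ha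

theorem normalAt_id (z : Total) : NormalAt id z 0 1 1 0 := by
  refine ⟨one_ne_zero, one_ne_zero, fun w => ?_, fun w => ?_, fun w => ?_, fun w => ?_, ?_⟩ <;> simp

theorem signMap_of_mem_closure {δ : Total ≃ₜ Total} (hδ : δ ∈ Subgroup.closure {reflX, reflY}) :
    ∃ a b : ℝ, a * a = 1 ∧ b * b = 1 ∧ ∀ z, δ z = signMap a b z := by
  induction hδ using Subgroup.closure_induction with
  | mem δ h =>
    rcases h with rfl | rfl
    · exact ⟨-1, 1, by norm_num, by norm_num, fun z => by simp [signMap_apply, reflX]⟩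
    · exact ⟨1, -1, by norm_num, by norm_num, fun z => by simp [signMap_apply, reflY]⟩
  | one => exact ⟨1, 1, by norm_num, by norm_num, fun z => by rw [signMap_one]; rfl⟩
  | mul δ ε _ _ h h' =>
    obtain ⟨a, b, ha, hb, h⟩ := h
    obtain ⟨a', b', ha', hb', h'⟩ := h'
    refine ⟨a * a', b * b', ?_, ?_, fun z => ?_⟩
    · linear_combination a' * a' * ha + ha'
    · linear_combination b' * b' * hb + hb'
    · rw [← signMap_signMap, ← h', ← h]; rfl
  | inv δ _ h =>
    obtain ⟨a, b, ha, hb, h⟩ := h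
    refine ⟨a, b, ha, hb, fun z => ?_⟩
    change δ.symm z = _
    rw [δ.symm_apply_eq, h, signMap_signMap, ha, hb, signMap_one]

theorem eq_one_or_neg_one {a : ℝ} (ha : a * a = 1) : a = 1 ∨ a = -1 := mul_self_eq_one_iff.1 ha

theorem exists_signMap {a b : ℝ} (ha : a * a = 1) (hb : b * b = 1) :
    ∃ δ ∈ Subgroup.closure {reflX, reflY}, ∀ z, δ z = signMap a b z := by
  have hX : reflX ∈ Subgroup.closure {reflX, reflY} := Subgroup.subset_closure (by simp)
  have hY : reflY ∈ Subgroup.closure {reflX, reflY} := Subgroup.subset_closure (by simp)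
  rcases eq_one_or_neg_one ha with rfl | rfl <;> rcases eq_one_or_neg_one hb with rfl | rfl
  · exact ⟨1, one_mem _, fun z => by rw [signMap_one]; rfl⟩
  · exact ⟨reflY, hY, fun z => by simp [signMap_apply, reflY]⟩
  · exact ⟨reflX, hX, fun z => by simp [signMap_apply, reflX]⟩
  · exact ⟨reflX * reflY, mul_mem hX hY, fun z => by
      change reflX (reflY z) = _
      simp [signMap_apply, reflX, reflY]⟩

variable {Φ : OpenPartialHomeomorph Total Total}

theorem IsPointSymmetry.transHomeomorph (hΦ : IsPointSymmetry Φ) {δ : Total ≃ₜ Total} {a b : ℝ}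
    (ha : a * a = 1) (hb : b * b = 1) (hδ : ∀ z, δ z = signMap a b z) :
    IsPointSymmetry (Φ.transHomeomorph δ) := by
  have hδ' : ∀ z, δ.symm z = signMap a b z := fun z => by
    rw [δ.symm_apply_eq, hδ, signMap_signMap, ha, hb, signMap_one]
  have hfun : ⇑(Φ.transHomeomorph δ) = fun z => signMap a b (Φ z) := funext fun z => hδ (Φ z)
  refine isPointSymmetry_of_normalAt ?_ ?_ fun z hz => ?_
  · rw [hfun]; exact (signMap a b).contDiff.comp_contDiffOn hΦ.smooth
  · have h1 : ⇑(Φ.transHomeomorph δ).symm = fun z => Φ.symm (signMap a b z) :=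
      funext fun z => congrArg Φ.symm (hδ' z)
    rw [h1]
    refine hΦ.smooth_symm.comp (signMap a b).contDiff.contDiffOn fun z hz => ?_
    rw [← hδ']; exact hz
  · rw [hfun]
    exact ⟨_, _, _, _, (hΦ.normalAt hz).signMap_comp
      (differentiableAt_of_open Φ.open_source hΦ.smooth hz) ha hb⟩

theorem isPointSymmetry_refl : IsPointSymmetry (OpenPartialHomeomorph.refl Total) :=
  isPointSymmetry_of_normalAt contDiff_id.contDiffOn contDiff_id.contDiffOn
    fun z _ => ⟨_, _, _, _, normalAt_id z⟩

theorem IsPointSymmetry.restr (hΦ : IsPointSymmetry Φ) (W : Set Total) :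
    IsPointSymmetry (Φ.restr W) := by
  refine isPointSymmetry_of_normalAt (hΦ.smooth.mono ?_) (hΦ.smooth_symm.mono ?_) fun z hz => ?_
  · rw [Φ.restr_source]; exact Set.inter_subset_left
  · exact fun z hz => hz.1
  · rw [Φ.restr_source] at hz
    exact ⟨_, _, _, _, hΦ.normalAt hz.1⟩

theorem dd_signMap_comp (hΦ : IsPointSymmetry Φ) {δ : Total ≃ₜ Total} {a b : ℝ}
    (hδ : ∀ z, δ z = signMap a b z) {z : Total} (hz : z ∈ Φ.source) :
    dd ex (comp πx (Φ.transHomeomorph δ)) z = a * dd ex (comp πx Φ) z ∧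
    dd ey (comp πy (Φ.transHomeomorph δ)) z = b * dd ey (comp πy Φ) z := by
  have h1 : comp πx (Φ.transHomeomorph δ) = fun z => a * comp πx Φ z := funext fun z => by
    change πx (δ (Φ z)) = _
    rw [hδ]; rfl
  have h2 : comp πy (Φ.transHomeomorph δ) = fun z => b * comp πy Φ z := funext fun z => by
    change πy (δ (Φ z)) = _
    rw [hδ]; rfl
  have hd : ∀ π, DifferentiableAt ℝ (comp π Φ) z := fun π =>
    differentiableAt_of_open Φ.open_source (hΦ.contDiffOn_comp π) hz
  rw [h1, h2, dd_const_mul _ (hd πx), dd_const_mul _ (hd πy)]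
  exact ⟨rfl, rfl⟩

/-- For a sign map x̃_x = a and ỹ_y = b, and a continuous restriction to any open set would make
both positive. -/
theorem isDiscretePointSymmetry_of_signMap (r : ℕ∞) {δ : Total ≃ₜ Total} {a b : ℝ}
    (ha : a * a = 1) (hb : b * b = 1) (hδ : ∀ z, δ z = signMap a b z) (hneg : a = -1 ∨ b = -1) :
    IsDiscretePointSymmetry r δ.toOpenPartialHomeomorph := by
  have hI := isPointSymmetry_refl
  have h1 : (OpenPartialHomeomorph.refl Total).transHomeomorph δ = δ.toOpenPartialHomeomorph := by
    ext <;> simp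
  rw [← h1]
  refine ⟨hI.transHomeomorph ha hb hδ, fun W hW hne hcont => ?_⟩
  obtain ⟨z, hz, hzW⟩ := hne
  have hz' : z ∈ (((OpenPartialHomeomorph.refl Total).transHomeomorph δ).restr W).source := by
    rw [OpenPartialHomeomorph.restr_source, hW.interior_eq]; exact ⟨hz, hzW⟩
  obtain ⟨p1, p2⟩ := hcont.dd_pos hz'
  obtain ⟨q1, q2⟩ := dd_signMap_comp hI hδ hz
  have e1 : dd ex (comp πx (OpenPartialHomeomorph.refl Total)) z = 1 := by
    change fderiv ℝ πx z ex = 1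
    rw [πx.fderiv]; rfl
  have e2 : dd ey (comp πy (OpenPartialHomeomorph.refl Total)) z = 1 := by
    change fderiv ℝ πy z ey = 1
    rw [πy.fderiv]; rfl
  rw [e1, mul_one] at q1
  rw [e2, mul_one] at q2
  have p1' : 0 < a := q1 ▸ p1
  have p2' : 0 < b := q2 ▸ p2
  rcases hneg with h | h <;> linarith

end BLP

/-! ### Paths of point symmetries from functions of one variable -/

namespace BLP

/-- An injective smooth map with injective differentials is a diffeomorphism onto an open set. -/
theorem exists_openPartialHomeomorph {E : Type*} [NormedAddCommGroup E] [NormedSpace ℝ E]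
    [FiniteDimensional ℝ E] {G : E → E} {W : Set E} (hW : IsOpen W) (hG : ContDiffOn ℝ ∞ G W)
    (hinj : Set.InjOn G W) (hd : ∀ z ∈ W, Function.Injective (fderiv ℝ G z)) :
    ∃ Φ : OpenPartialHomeomorph E E, Φ.source = W ∧ ⇑Φ = G ∧ ContDiffOn ℝ ∞ Φ.symm Φ.target := by
  have : CompleteSpace E := FiniteDimensional.complete ℝ E
  have hL : ∀ z ∈ W, ∃ L : E ≃L[ℝ] E, (L : E →L[ℝ] E) = fderiv ℝ G z := fun z hz =>
    ⟨(LinearEquiv.ofInjectiveEndo ((fderiv ℝ G z : E →L[ℝ] E) : E →ₗ[ℝ] E)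
      (hd z hz)).toContinuousLinearEquiv, by ext; rfl⟩
  -- The inverse function theorem makes the map locally open; with injectivity this gives a global
  -- inverse on the image.
  have ho : IsOpenMap (W.domRestrict G) := by
    rw [isOpenMap_iff_nhds_le]
    rintro ⟨z, hz⟩
    obtain ⟨L, hL⟩ := hL z hz
    have hs : HasStrictFDerivAt G (L : E →L[ℝ] E) z := by
      rw [hL]
      exact (contDiffAt_of_open hW hG hz).hasStrictFDerivAt (by simp)
    have h1 := hs.map_nhds_eq_of_equiv
    change nhds (G z) ≤ Filter.map (G ∘ Subtype.val) _
    rw [← h1, ← Filter.map_map, map_nhds_subtype_coe_eq_nhds hz (hW.mem_nhds hz)]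
  let Φ := OpenPartialHomeomorph.ofContinuousOpenRestrict (hinj.toPartialEquiv G W) hG.continuousOn ho hW
  refine ⟨Φ, rfl, rfl, fun q hq => ?_⟩
  have hs : Φ.symm q ∈ W := Φ.map_target hq
  obtain ⟨L, hL⟩ := hL _ hs
  refine (Φ.contDiffAt_symm (f₀' := L) hq ?_ (contDiffAt_of_open hW hG hs)).contDiffWithinAt
  rw [hL]
  exact (differentiableAt_of_open hW hG hs).hasFDerivAt

/-- The functions of one variable that occur in a point symmetry. -/
structure NormalData where
  (T S S₁ X X₁ Y Y₁ V : ℝ → ℝ)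

namespace NormalData

/-- The point transformation
`(T, S x + X, Y, (u - (S₁ x + X₁) / (2 S)) / S, v / Y₁ + V)`. -/
noncomputable def map (N : NormalData) (z : Total) : Total :=
  ((N.T z.1.1, N.S z.1.1 * z.1.2.1 + N.X z.1.1, N.Y z.1.2.2),
    ((z.2.1 - (N.S₁ z.1.1 * z.1.2.1 + N.X₁ z.1.1) / (2 * N.S z.1.1)) / N.S z.1.1,
      (N.Y₁ z.1.2.2)⁻¹ * z.2.2 + N.V z.1.2.2))

/-- The relations between the functions of one variable that make the transformation a point
symmetry. -/
structure IsOn (N : NormalData) (I J : Set ℝ) : Prop where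
  isOpen_left : IsOpen I
  isOpen_right : IsOpen J
  convex_left : Convex ℝ I
  convex_right : Convex ℝ J
  smooth_T : ContDiffOn ℝ ∞ N.T I
  smooth_S : ContDiffOn ℝ ∞ N.S I
  smooth_S₁ : ContDiffOn ℝ ∞ N.S₁ I
  smooth_X : ContDiffOn ℝ ∞ N.X I
  smooth_X₁ : ContDiffOn ℝ ∞ N.X₁ I
  smooth_Y : ContDiffOn ℝ ∞ N.Y J
  smooth_Y₁ : ContDiffOn ℝ ∞ N.Y₁ J
  smooth_V : ContDiffOn ℝ ∞ N.V J
  deriv_T : ∀ t ∈ I, HasDerivAt N.T (N.S t ^ 2) t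
  deriv_S : ∀ t ∈ I, HasDerivAt N.S (N.S₁ t) t
  deriv_X : ∀ t ∈ I, HasDerivAt N.X (N.X₁ t) t
  deriv_Y : ∀ y ∈ J, HasDerivAt N.Y (N.Y₁ y) y
  S_pos : ∀ t ∈ I, 0 < N.S t
  Y₁_pos : ∀ y ∈ J, 0 < N.Y₁ y

variable {N : NormalData} {I J : Set ℝ}

theorem injOn_of_hasDerivAt_pos (hI : IsOpen I) (hI' : Convex ℝ I) {f f' : ℝ → ℝ}
    (hf : ∀ t ∈ I, HasDerivAt f (f' t) t) (hpos : ∀ t ∈ I, 0 < f' t) : Set.InjOn f I := by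
  refine (strictMonoOn_of_deriv_pos hI' (fun t ht => (hf t ht).continuousAt.continuousWithinAt)
    fun t ht => ?_).injOn
  rw [hI.interior_eq] at ht
  rw [(hf t ht).deriv]
  exact hpos t ht

theorem IsOn.injOn (h : N.IsOn I J) {W : Set Total}
    (hWI : ∀ z ∈ W, z.1.1 ∈ I ∧ z.1.2.2 ∈ J) : Set.InjOn N.map W := by
  intro z hz z' hz' e
  obtain ⟨e1, e2⟩ := Prod.ext_iff.1 e
  obtain ⟨e3, e4⟩ := Prod.ext_iff.1 e1
  obtain ⟨e5, e6⟩ := Prod.ext_iff.1 e4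
  obtain ⟨e7, e8⟩ := Prod.ext_iff.1 e2
  simp only [map] at e3 e5 e6 e7 e8
  have ht : z.1.1 = z'.1.1 := injOn_of_hasDerivAt_pos h.isOpen_left h.convex_left h.deriv_T
    (fun t ht => pow_pos (h.S_pos t ht) 2) (hWI z hz).1 (hWI z' hz').1 e3
  have hy : z.1.2.2 = z'.1.2.2 := injOn_of_hasDerivAt_pos h.isOpen_right h.convex_right h.deriv_Y
    h.Y₁_pos (hWI z hz).2 (hWI z' hz').2 e6
  have hS := (h.S_pos _ (hWI z' hz').1).ne'
  have hY := inv_ne_zero (h.Y₁_pos _ (hWI z' hz').2).ne'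
  rw [ht] at e5 e7
  rw [hy] at e8
  have hx : z.1.2.1 = z'.1.2.1 := mul_left_cancel₀ hS (add_right_cancel e5)
  have hv : z.2.2 = z'.2.2 := mul_left_cancel₀ hY (add_right_cancel e8)
  rw [hx, div_left_inj' hS, sub_left_inj] at e7
  exact Prod.ext (Prod.ext ht (Prod.ext hx hy)) (Prod.ext e7 hv)

theorem IsOn.contDiffOn_map (h : N.IsOn I J) {W : Set Total}
    (hWI : ∀ z ∈ W, z.1.1 ∈ I ∧ z.1.2.2 ∈ J) : ContDiffOn ℝ ∞ N.map W := by
  have ct : ∀ f : ℝ → ℝ, ContDiffOn ℝ ∞ f I → ContDiffOn ℝ ∞ (fun z : Total => f z.1.1) W :=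
    fun f hf => hf.comp (g := f) (f := fun z : Total => z.1.1) (by fun_prop) fun z hz => (hWI z hz).1
  have cy : ∀ f : ℝ → ℝ, ContDiffOn ℝ ∞ f J → ContDiffOn ℝ ∞ (fun z : Total => f z.1.2.2) W :=
    fun f hf => hf.comp (g := f) (f := fun z : Total => z.1.2.2) (by fun_prop) fun z hz => (hWI z hz).2
  have hx : ContDiffOn ℝ ∞ (fun z : Total => z.1.2.1) W := by fun_prop
  have hu : ContDiffOn ℝ ∞ (fun z : Total => z.2.1) W := by fun_prop
  have hv : ContDiffOn ℝ ∞ (fun z : Total => z.2.2) W := by fun_prop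
  have hS : ∀ z ∈ W, N.S z.1.1 ≠ 0 := fun z hz => (h.S_pos _ (hWI z hz).1).ne'
  exact ((ct _ h.smooth_T).prodMk ((((ct _ h.smooth_S).mul hx).add (ct _ h.smooth_X)).prodMk
    (cy _ h.smooth_Y))).prodMk (((hu.sub ((((ct _ h.smooth_S₁).mul hx).add (ct _ h.smooth_X₁)).div
      (contDiffOn_const.mul (ct _ h.smooth_S)) fun z hz => mul_ne_zero two_ne_zero (hS z hz))).div
      (ct _ h.smooth_S) hS).prodMk ((((cy _ h.smooth_Y₁).inv fun z hz =>
        (h.Y₁_pos _ (hWI z hz).2).ne').mul hv).add (cy _ h.smooth_V)))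

theorem IsOn.fderiv_map (h : N.IsOn I J) {z : Total} (ht : z.1.1 ∈ I) (hy : z.1.2.2 ∈ J) :
    ∃ ν, NormalAt N.map z (N.S₁ z.1.1 * z.1.2.1 + N.X₁ z.1.1) (N.S z.1.1) (N.Y₁ z.1.2.2) ν ∧
      (fderiv ℝ N.map z eu).2.1 = (N.S z.1.1)⁻¹ := by
  have hS := (h.S_pos _ ht).ne'
  have ct : ∀ (f : ℝ → ℝ) (f' : ℝ), HasDerivAt f f' z.1.1 →
      HasFDerivAt (fun z : Total => f z.1.1) (f' • πt) z :=
    fun f f' hf => HasDerivAt.comp_hasFDerivAt (f := πt) z hf πt.hasFDerivAt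
  have cy : ∀ (f : ℝ → ℝ) (f' : ℝ), HasDerivAt f f' z.1.2.2 →
      HasFDerivAt (fun z : Total => f z.1.2.2) (f' • πy) z :=
    fun f f' hf => HasDerivAt.comp_hasFDerivAt (f := πy) z hf πy.hasFDerivAt
  have hx : HasFDerivAt (fun z : Total => z.1.2.1) πx z := πx.hasFDerivAt
  have hu : HasFDerivAt (fun z : Total => z.2.1) πu z := πu.hasFDerivAt
  have hv : HasFDerivAt (fun z : Total => z.2.2) πv z := πv.hasFDerivAt
  have oI := h.isOpen_left
  have dd1 : ∀ f : ℝ → ℝ, ContDiffOn ℝ ∞ f I → HasDerivAt f (deriv f z.1.1) z.1.1 := fun f hf =>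
    (differentiableAt_of_open oI hf ht).hasDerivAt
  have dd2 : ∀ f : ℝ → ℝ, ContDiffOn ℝ ∞ f J → HasDerivAt f (deriv f z.1.2.2) z.1.2.2 := fun f hf =>
    (differentiableAt_of_open h.isOpen_right hf hy).hasDerivAt
  have sS : ∀ t ∈ I, 2 * N.S t ≠ 0 := fun t ht => mul_ne_zero two_ne_zero (h.S_pos t ht).ne'
  have L1 := ct _ _ (h.deriv_T _ ht)
  have L2 := ((ct _ _ (h.deriv_S _ ht)).fun_mul hx).fun_add (ct _ _ (h.deriv_X _ ht))
  have L3 := cy _ _ (h.deriv_Y _ hy)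
  have L4 := (hu.fun_mul (ct _ _ (dd1 _ (h.smooth_S.inv fun t ht => (h.S_pos t ht).ne')))).fun_sub
    (((ct _ _ (dd1 _ ((h.smooth_S₁.div (contDiffOn_const.mul h.smooth_S) sS).div h.smooth_S
      fun t ht => (h.S_pos t ht).ne'))).fun_mul hx).fun_add
      (ct _ _ (dd1 _ ((h.smooth_X₁.div (contDiffOn_const.mul h.smooth_S) sS).div h.smooth_S
      fun t ht => (h.S_pos t ht).ne'))))
  have L5 := ((cy _ _ (dd2 _ (h.smooth_Y₁.inv fun y hy => (h.Y₁_pos y hy).ne'))).fun_mul hv).fun_add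
    (cy _ _ (dd2 _ h.smooth_V))
  have L := (L1.prodMk (L2.prodMk L3)).prodMk (L4.prodMk L5)
  -- The u-component is written as a sum of products of functions of t with x, u or 1, which is the
  -- shape differentiated above. Only its derivative in u is needed, so the derivatives of the
  -- coefficients stay unevaluated.
  have hG : N.map = fun z : Total => ((N.T z.1.1, N.S z.1.1 * z.1.2.1 + N.X z.1.1, N.Y z.1.2.2),
    (z.2.1 * (N.S z.1.1)⁻¹ - (N.S₁ z.1.1 / (2 * N.S z.1.1) / N.S z.1.1 * z.1.2.1 +
      N.X₁ z.1.1 / (2 * N.S z.1.1) / N.S z.1.1), (N.Y₁ z.1.2.2)⁻¹ * z.2.2 + N.V z.1.2.2)) := by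
    funext z
    simp only [map]
    congr 2
    ring
  have hf := (hG ▸ L : HasFDerivAt N.map _ z).fderiv
  refine ⟨deriv N.Y₁⁻¹ z.1.2.2 * z.2.2 + deriv N.V z.1.2.2,
    ⟨hS, (h.Y₁_pos _ hy).ne', fun w => ?_, fun w => ?_, fun w => ?_, fun w => ?_, rfl⟩, ?_⟩
  · rw [hf]; simp
  · rw [hf]; simp; ring
  · rw [hf]; simp
  · rw [hf]; simp; ring
  · rw [hf]; simp [eu]

theorem IsOn.exists_pointSymmetry (h : N.IsOn I J) {W : Set Total} (hW : IsOpen W)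
    (hWI : ∀ z ∈ W, z.1.1 ∈ I ∧ z.1.2.2 ∈ J) :
    ∃ Φ : OpenPartialHomeomorph Total Total, Φ.source = W ∧ ⇑Φ = N.map ∧ IsPointSymmetry Φ := by
  have hs := h.contDiffOn_map hWI
  obtain ⟨Φ, rfl, hΦ, hs'⟩ := exists_openPartialHomeomorph hW hs (h.injOn hWI) fun z hz => by
    obtain ⟨ν, A, hu⟩ := h.fderiv_map (hWI z hz).1 (hWI z hz).2
    rw [injective_iff_map_eq_zero]
    intro w hw
    have a1 := A.map_t w
    have a2 := A.map_x w
    have a3 := A.map_y w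
    have a4 := A.map_v w
    have hS := A.σ_ne
    have hY := inv_ne_zero A.η_ne
    rw [hw] at a1 a2 a3 a4
    have b1 : w.1.1 = 0 := (mul_eq_zero.1 a1.symm).resolve_left (pow_ne_zero 2 hS)
    have b3 : w.1.2.2 = 0 := (mul_eq_zero.1 a3.symm).resolve_left A.η_ne
    rw [b1, mul_zero, zero_add] at a2
    rw [b3, mul_zero, zero_add] at a4
    have b2 : w.1.2.1 = 0 := (mul_eq_zero.1 a2.symm).resolve_left hS
    have b4 : w.2.2 = 0 := (mul_eq_zero.1 a4.symm).resolve_left hY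
    rw [map_total, b1, b2, b3, b4] at hw
    have b5 : w.2.1 * (N.S z.1.1)⁻¹ = 0 := by
      have := congrArg (fun z : Total => z.2.1) hw
      simpa [hu] using this
    exact Prod.ext (Prod.ext b1 (Prod.ext b2 b3))
      (Prod.ext ((mul_eq_zero.1 b5).resolve_right (inv_ne_zero hS)) b4)
  refine ⟨Φ, rfl, hΦ, isPointSymmetry_of_normalAt (hΦ ▸ hs) hs' fun z hz => ?_⟩
  obtain ⟨ν, A, -⟩ := h.fderiv_map (hWI z hz).1 (hWI z hz).2
  rw [hΦ]
  exact ⟨_, _, _, _, A⟩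

/-- A path from the identity to a given transformation. -/
noncomputable def path (N : NormalData) (s : ℝ) : NormalData where
  T t := (1 - s) * t + s * N.T t
  -- T is interpolated linearly, and the relation T' = S² then dictates S; `S₁` below is its
  -- derivative. The radicand is a convex combination of 1 and S², hence positive.
  S t := √(1 - s + s * N.S t ^ 2)
  S₁ t := s * N.S t * N.S₁ t / √(1 - s + s * N.S t ^ 2)
  X t := s * N.X t
  X₁ t := s * N.X₁ t
  Y y := (1 - s) * y + s * N.Y y
  Y₁ y := 1 - s + s * N.Y₁ y
  V y := s * N.V y

theorem path_pos {s a : ℝ} (hs : s ∈ Set.Icc (0 : ℝ) 1) (ha : 0 < a) : 0 < 1 - s + s * a := by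
  rcases hs.1.eq_or_lt with rfl | h
  · simp
  · have := hs.2
    have := mul_pos h ha
    linarith

theorem IsOn.path (h : N.IsOn I J) {s : ℝ} (hs : s ∈ Set.Icc (0 : ℝ) 1) :
    (N.path s).IsOn I J := by
  have hpos : ∀ t ∈ I, 0 < 1 - s + s * N.S t ^ 2 := fun t ht =>
    path_pos hs (pow_pos (h.S_pos t ht) 2)
  have sq : ContDiffOn ℝ ∞ (fun t => 1 - s + s * N.S t ^ 2) I :=
    contDiffOn_const.add (contDiffOn_const.mul (h.smooth_S.pow 2))
  have sR := sq.sqrt fun t ht => (hpos t ht).ne'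
  exact
    { isOpen_left := h.isOpen_left
      isOpen_right := h.isOpen_right
      convex_left := h.convex_left
      convex_right := h.convex_right
      smooth_T := (contDiffOn_const.mul contDiffOn_id).add (contDiffOn_const.mul h.smooth_T)
      smooth_S := sR
      smooth_S₁ := ((contDiffOn_const.mul h.smooth_S).mul h.smooth_S₁).div sR
        fun t ht => (Real.sqrt_pos.2 (hpos t ht)).ne'
      smooth_X := contDiffOn_const.mul h.smooth_X
      smooth_X₁ := contDiffOn_const.mul h.smooth_X₁
      smooth_Y := (contDiffOn_const.mul contDiffOn_id).add (contDiffOn_const.mul h.smooth_Y)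
      smooth_Y₁ := contDiffOn_const.add (contDiffOn_const.mul h.smooth_Y₁)
      smooth_V := contDiffOn_const.mul h.smooth_V
      deriv_T := fun t ht => by
        refine (((hasDerivAt_id' t).const_mul (1 - s)).fun_add
          ((h.deriv_T t ht).const_mul s)).congr_deriv ?_
        rw [NormalData.path, Real.sq_sqrt (hpos t ht).le, mul_one]
      deriv_S := fun t ht => by
        refine (((((h.deriv_S t ht).fun_pow 2).const_mul s).const_add (1 - s)).sqrt
          (hpos t ht).ne').congr_deriv ?_
        simp only [NormalData.path]
        have := (Real.sqrt_pos.2 (hpos t ht)).ne'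
        field_simp
        norm_num
        ring
      deriv_X := fun t ht => (h.deriv_X t ht).const_mul s
      deriv_Y := fun y hy => by
        refine (((hasDerivAt_id' y).const_mul (1 - s)).fun_add
          ((h.deriv_Y y hy).const_mul s)).congr_deriv ?_
        rw [NormalData.path, mul_one]
      S_pos := fun t ht => Real.sqrt_pos.2 (hpos t ht)
      Y₁_pos := fun y hy => path_pos hs (h.Y₁_pos y hy) }

theorem map_path_zero (N : NormalData) (z : Total) : (N.path 0).map z = z := by
  simp [map, path]

theorem IsOn.map_path_one (h : N.IsOn I J) {z : Total} (hz : z.1.1 ∈ I) :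
    (N.path 1).map z = N.map z := by
  have hS := h.S_pos _ hz
  have : N.S z.1.1 * N.S₁ z.1.1 / N.S z.1.1 = N.S₁ z.1.1 := by field_simp
  simp [map, NormalData.path, Real.sqrt_sq hS.le, this]

theorem IsOn.contDiffOn_map_path (h : N.IsOn I J) {W : Set Total}
    (hWI : ∀ z ∈ W, z.1.1 ∈ I ∧ z.1.2.2 ∈ J) :
    ContDiffOn ℝ ∞ (fun q : ℝ × Total => (N.path q.1).map q.2) (Set.Icc (0 : ℝ) 1 ×ˢ W) := by
  set D : Set (ℝ × Total) := Set.Icc (0 : ℝ) 1 ×ˢ W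
  have ct : ∀ f : ℝ → ℝ, ContDiffOn ℝ ∞ f I → ContDiffOn ℝ ∞ (fun q : ℝ × Total => f q.2.1.1) D :=
    fun f hf => hf.comp (g := f) (f := fun q : ℝ × Total => q.2.1.1) (by fun_prop)
      fun q hq => (hWI _ hq.2).1
  have cy : ∀ f : ℝ → ℝ, ContDiffOn ℝ ∞ f J → ContDiffOn ℝ ∞ (fun q : ℝ × Total => f q.2.1.2.2) D :=
    fun f hf => hf.comp (g := f) (f := fun q : ℝ × Total => q.2.1.2.2) (by fun_prop)
      fun q hq => (hWI _ hq.2).2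
  have hs : ContDiffOn ℝ ∞ (fun q : ℝ × Total => q.1) D := by fun_prop
  have hs' : ContDiffOn ℝ ∞ (fun q : ℝ × Total => 1 - q.1) D := by fun_prop
  have ht : ContDiffOn ℝ ∞ (fun q : ℝ × Total => q.2.1.1) D := by fun_prop
  have hx : ContDiffOn ℝ ∞ (fun q : ℝ × Total => q.2.1.2.1) D := by fun_prop
  have hy : ContDiffOn ℝ ∞ (fun q : ℝ × Total => q.2.1.2.2) D := by fun_prop
  have hu : ContDiffOn ℝ ∞ (fun q : ℝ × Total => q.2.2.1) D := by fun_prop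
  have hv : ContDiffOn ℝ ∞ (fun q : ℝ × Total => q.2.2.2) D := by fun_prop
  have pos : ∀ q ∈ D, 0 < 1 - q.1 + q.1 * N.S q.2.1.1 ^ 2 := fun q hq =>
    path_pos hq.1 (pow_pos (h.S_pos _ (hWI _ hq.2).1) 2)
  have pos' : ∀ q ∈ D, 0 < 1 - q.1 + q.1 * N.Y₁ q.2.1.2.2 := fun q hq =>
    path_pos hq.1 (h.Y₁_pos _ (hWI _ hq.2).2)
  have sR : ContDiffOn ℝ ∞ (fun q : ℝ × Total => √(1 - q.1 + q.1 * N.S q.2.1.1 ^ 2)) D :=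
    (hs'.add (hs.mul ((ct _ h.smooth_S).pow 2))).sqrt fun q hq => (pos q hq).ne'
  have R0 : ∀ q ∈ D, √(1 - q.1 + q.1 * N.S q.2.1.1 ^ 2) ≠ 0 := fun q hq =>
    (Real.sqrt_pos.2 (pos q hq)).ne'
  have sS₁ := ((hs.mul (ct _ h.smooth_S)).mul (ct _ h.smooth_S₁)).div sR R0
  exact (((hs'.mul ht).add (hs.mul (ct _ h.smooth_T))).prodMk
    (((sR.mul hx).add (hs.mul (ct _ h.smooth_X))).prodMk
      ((hs'.mul hy).add (hs.mul (cy _ h.smooth_Y))))).prodMk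
    (((hu.sub (((sS₁.mul hx).add (hs.mul (ct _ h.smooth_X₁))).div (contDiffOn_const.mul sR)
      fun q hq => mul_ne_zero two_ne_zero (R0 q hq))).div sR R0).prodMk
      ((((hs'.add (hs.mul (cy _ h.smooth_Y₁))).inv fun q hq => (pos' q hq).ne').mul hv).add
        (hs.mul (cy _ h.smooth_V))))

theorem IsOn.isContinuousPointSymmetry (h : N.IsOn I J) (r : ℕ∞)
    {Ψ : OpenPartialHomeomorph Total Total} (hΨ : ∀ z ∈ Ψ.source, z.1.1 ∈ I ∧ z.1.2.2 ∈ J)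
    (hN : Set.EqOn Ψ N.map Ψ.source) : IsContinuousPointSymmetry r Ψ := by
  have : Nonempty (OpenPartialHomeomorph Total Total) := ⟨OpenPartialHomeomorph.refl _⟩
  have hex : ∀ s ∈ Set.Icc (0 : ℝ) 1, ∃ Φ : OpenPartialHomeomorph Total Total,
      Φ.source = Ψ.source ∧ ⇑Φ = (N.path s).map ∧ IsPointSymmetry Φ := fun s hs =>
    (h.path hs).exists_pointSymmetry Ψ.open_source hΨ
  choose! F hF using hex
  refine ⟨F, fun s hs => ⟨(hF s hs).2.2, (hF s hs).1⟩, fun z hz => ?_, fun z hz => ?_, ?_⟩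
  · rw [(hF 0 (by simp)).2.1, map_path_zero]; rfl
  · rw [(hF 1 (by simp)).2.1, h.map_path_one (hΨ z hz).1, hN hz]
  · refine ((h.contDiffOn_map_path hΨ).of_le (by exact_mod_cast le_top)).congr fun q hq => ?_
    rw [(hF q.1 hq.1).2.1]

end NormalData

end BLP

/-! ### Orientation preserving symmetries on convex domains -/

namespace BLP

/-- A function on a convex open set whose differential is a multiple of a coordinate `π` at each
point is a function of this coordinate. -/
theorem exists_eq_comp_of_fderiv {E : Type*} [NormedAddCommGroup E] [NormedSpace ℝ E] {W : Set E}
    (hW : IsOpen W) (hW' : Convex ℝ W) (π : E →L[ℝ] ℝ) {e : E} (he : π e = 1) {h : E → ℝ}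
    (hh : ContDiffOn ℝ ∞ h W) (h0 : ∀ z ∈ W, ∀ w, π w = 0 → dd w h z = 0) :
    ∃ H : ℝ → ℝ, ContDiffOn ℝ ∞ H (π '' W) ∧ ∀ z ∈ W, h z = H (π z) ∧
      ∀ w, dd w h z = deriv H (π z) * π w := by
  have hconst : ∀ z ∈ W, ∀ z' ∈ W, π z' = π z → h z' = h z := fun z hz z' hz' hπ =>
    eq_of_fderiv_eq_zero hW' (fun y hy => differentiableAt_of_open hW hh hy) hz hz' fun y hy =>
      h0 y hy _ (by rw [map_sub, hπ, sub_self])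
  have hex : ∀ t ∈ π '' W, ∃ z ∈ W, π z = t := fun t ht => ht
  -- The choice of preimages need not be continuous. Smoothness of h ∘ c comes from the constancy of
  -- h on the fibres of π, which allows c to be replaced near each point by the affine section t ↦ z
  -- + (t − π z)e.
  choose! c hc hπc using hex
  have hH : ∀ z ∈ W, h z = h (c (π z)) := fun z hz =>
    hconst _ (hc _ ⟨z, hz, rfl⟩) _ hz (hπc _ ⟨z, hz, rfl⟩).symm
  have hsm : ∀ z ∈ W, ContDiffAt ℝ ∞ (fun t => h (c t)) (π z) := by
    intro z hz
    have hl : ContDiff ℝ ∞ fun t : ℝ => z + (t - π z) • e := by fun_prop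
    have hl0 : z + (π z - π z) • e = z := by simp
    have h1 : ContDiffAt ℝ ∞ (fun t : ℝ => h (z + (t - π z) • e)) (π z) :=
      ContDiffAt.comp (g := h) (f := fun t : ℝ => z + (t - π z) • e) (π z)
        (by rw [hl0]; exact contDiffAt_of_open hW hh hz) hl.contDiffAt
    refine h1.congr_of_eventuallyEq ?_
    have h2 : ∀ᶠ t in nhds (π z), z + (t - π z) • e ∈ W :=
      hl.continuous.continuousAt.eventually_mem (by rw [hl0]; exact hW.mem_nhds hz)
    filter_upwards [h2] with t ht
    have h3 : π (z + (t - π z) • e) = t := by simp [he]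
    rw [hH _ ht, h3]
  refine ⟨fun t => h (c t), ?_, fun z hz => ⟨hH z hz, fun w => ?_⟩⟩
  · rintro _ ⟨z, hz, rfl⟩
    exact (hsm z hz).contDiffWithinAt
  · rw [dd_congr hW (h := fun z => h (c (π z))) hH hz]
    have h1 := ((hsm z hz).differentiableAt (by simp)).hasDerivAt.comp_hasFDerivAt z π.hasFDerivAt
    unfold dd
    exact (congrArg (fun L : E →L[ℝ] ℝ => L w) h1.fderiv).trans rfl

theorem dd_comp_mul {E : Type*} [NormedAddCommGroup E] [NormedSpace ℝ E] {f : ℝ → ℝ} {z : E}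
    (π π' : E →L[ℝ] ℝ) (hf : DifferentiableAt ℝ f (π z)) (w : E) :
    DifferentiableAt ℝ (fun z => f (π z) * π' z) z ∧
      dd w (fun z => f (π z) * π' z) z = deriv f (π z) * π w * π' z + f (π z) * π' w := by
  have h1 : HasFDerivAt (fun z => f (π z)) (deriv f (π z) • π) z :=
    hf.hasDerivAt.comp_hasFDerivAt z π.hasFDerivAt
  refine ⟨h1.differentiableAt.fun_mul π'.differentiableAt, ?_⟩
  rw [dd_mul _ h1.differentiableAt π'.differentiableAt]
  unfold dd
  rw [h1.fderiv, π'.fderiv]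
  rfl

theorem isOpen_image_of_apply_eq_one {E : Type*} [NormedAddCommGroup E] [NormedSpace ℝ E]
    {W : Set E} (hW : IsOpen W) (π : E →L[ℝ] ℝ) {e : E} (he : π e = 1) : IsOpen (π '' W) := by
  rw [isOpen_iff_mem_nhds]
  rintro _ ⟨z, hz, rfl⟩
  have hl : Continuous fun t : ℝ => z + (t - π z) • e := by fun_prop
  have h2 : ∀ᶠ t in nhds (π z), z + (t - π z) • e ∈ W :=
    hl.continuousAt.eventually_mem (by simpa using hW.mem_nhds hz)
  filter_upwards [h2] with t ht
  exact ⟨_, ht, by simp [he]⟩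

theorem contDiffOn_deriv {I : Set ℝ} (hI : IsOpen I) {f : ℝ → ℝ} (hf : ContDiffOn ℝ ∞ f I) :
    ContDiffOn ℝ ∞ (deriv f) I := hf.deriv_of_isOpen hI (by simp)

variable {Ψ : OpenPartialHomeomorph Total Total}

/-- Orientation preserving point symmetries with convex domain are continuous. -/
theorem IsPointSymmetry.isContinuous (hΨ : IsPointSymmetry Ψ) (hW : Convex ℝ Ψ.source)
    (hpos : ∀ z ∈ Ψ.source, 0 < dd ex (comp πx Ψ) z ∧ 0 < dd ey (comp πy Ψ) z) (r : ℕ∞) :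
    IsContinuousPointSymmetry r Ψ := by
  have oW := Ψ.open_source
  have dc : ∀ π, ∀ z ∈ Ψ.source, DifferentiableAt ℝ (comp π Ψ) z := fun π z hz =>
    differentiableAt_of_open oW (hΨ.contDiffOn_comp π) hz
  have et1 : πt et = 1 := rfl
  have ey1 : πy ey = 1 := rfl
  have oI := isOpen_image_of_apply_eq_one oW πt et1
  have oJ := isOpen_image_of_apply_eq_one oW πy ey1
  have Dt : ∀ z ∈ Ψ.source, ∀ w, dd w (comp πt Ψ) z = dd ex (comp πx Ψ) z ^ 2 * πt w :=
    fun z hz w => (hΨ.dd_comp_eq πt hz w).trans ((hΨ.normalAt hz).map_t w)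
  have Dx : ∀ z ∈ Ψ.source, ∀ w, dd w (comp πx Ψ) z =
      dd et (comp πx Ψ) z * πt w + dd ex (comp πx Ψ) z * πx w :=
    fun z hz w => (hΨ.dd_comp_eq πx hz w).trans ((hΨ.normalAt hz).map_x w)
  have Dy : ∀ z ∈ Ψ.source, ∀ w, dd w (comp πy Ψ) z = dd ey (comp πy Ψ) z * πy w :=
    fun z hz w => (hΨ.dd_comp_eq πy hz w).trans ((hΨ.normalAt hz).map_y w)
  have Dv : ∀ z ∈ Ψ.source, ∀ w, dd w (comp πv Ψ) z =
      dd ey (comp πv Ψ) z * πy w + (dd ey (comp πy Ψ) z)⁻¹ * πv w :=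
    fun z hz w => (hΨ.dd_comp_eq πv hz w).trans ((hΨ.normalAt hz).map_v w)
  obtain ⟨T, sT, hT⟩ := exists_eq_comp_of_fderiv oW hW πt et1 (hΨ.contDiffOn_comp πt)
    fun z hz w hw => by rw [Dt z hz, hw, mul_zero]
  obtain ⟨Y, sY, hY⟩ := exists_eq_comp_of_fderiv oW hW πy ey1 (hΨ.contDiffOn_comp πy)
    fun z hz w hw => by rw [Dy z hz, hw, mul_zero]
  have T' : ∀ z ∈ Ψ.source, deriv T (πt z) = dd ex (comp πx Ψ) z ^ 2 := fun z hz => by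
    have := (hT z hz).2 et
    rw [Dt z hz, et1, mul_one, mul_one] at this
    exact this.symm
  have Y' : ∀ z ∈ Ψ.source, deriv Y (πy z) = dd ey (comp πy Ψ) z := fun z hz => by
    have := (hY z hz).2 ey
    rw [ey1, mul_one] at this
    exact this.symm
  -- Positivity of x̃_x selects the positive root of T'.
  let S : ℝ → ℝ := fun t => √(deriv T t)
  have hS : ∀ z ∈ Ψ.source, S (πt z) = dd ex (comp πx Ψ) z := fun z hz => by
    simp only [S]
    rw [T' z hz, Real.sqrt_sq (hpos z hz).1.le]
  have sS : ContDiffOn ℝ ∞ S (πt '' Ψ.source) := by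
    refine (contDiffOn_deriv oI sT).sqrt ?_
    rintro _ ⟨z, hz, rfl⟩
    rw [T' z hz]
    exact (pow_pos (hpos z hz).1 2).ne'
  have sY' := contDiffOn_deriv oJ sY
  have Ypos : ∀ y ∈ πy '' Ψ.source, 0 < deriv Y y := by
    rintro _ ⟨z, hz, rfl⟩
    rw [Y' z hz]
    exact (hpos z hz).2
  have Spos : ∀ t ∈ πt '' Ψ.source, 0 < S t := by
    rintro _ ⟨z, hz, rfl⟩
    rw [hS z hz]
    exact (hpos z hz).1
  have sYi : ContDiffOn ℝ ∞ (fun y => (deriv Y y)⁻¹) (πy '' Ψ.source) :=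
    sY'.inv fun y hy => (Ypos y hy).ne'
  have cS : ∀ z ∈ Ψ.source, ∀ w, DifferentiableAt ℝ (fun z => S (πt z) * πx z) z ∧
      dd w (fun z => S (πt z) * πx z) z = deriv S (πt z) * πt w * πx z + S (πt z) * πx w :=
    fun z hz w => dd_comp_mul πt πx (differentiableAt_of_open oI sS ⟨z, hz, rfl⟩) w
  have cY : ∀ z ∈ Ψ.source, ∀ w, DifferentiableAt ℝ (fun z => (deriv Y (πy z))⁻¹ * πv z) z ∧
      dd w (fun z => (deriv Y (πy z))⁻¹ * πv z) z =
        deriv (fun y => (deriv Y y)⁻¹) (πy z) * πy w * πv z + (deriv Y (πy z))⁻¹ * πv w :=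
    fun z hz w => dd_comp_mul (f := fun y => (deriv Y y)⁻¹) πy πv
      (differentiableAt_of_open oJ sYi ⟨z, hz, rfl⟩) w
  -- Subtracting S(t)x from x̃ leaves a function whose differential is a multiple of dt; likewise ṽ
  -- − v/Y' below depends on y only.
  obtain ⟨X, sX, hX⟩ := exists_eq_comp_of_fderiv (h := fun z => comp πx Ψ z - S (πt z) * πx z) oW hW πt
    et1 ((hΨ.contDiffOn_comp πx).sub ((sS.comp πt.contDiff.contDiffOn fun z hz =>
      ⟨z, hz, rfl⟩).mul πx.contDiff.contDiffOn)) fun z hz w hw => by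
      rw [dd_sub _ (dc πx z hz) (cS z hz w).1, (cS z hz w).2, Dx z hz, hw, hS z hz]; ring
  obtain ⟨V, sV, hV⟩ := exists_eq_comp_of_fderiv
    (h := fun z => comp πv Ψ z - (deriv Y (πy z))⁻¹ * πv z) oW hW πy
    ey1 ((hΨ.contDiffOn_comp πv).sub ((sYi.comp πy.contDiff.contDiffOn fun z hz =>
      ⟨z, hz, rfl⟩).mul πv.contDiff.contDiffOn)) fun z hz w hw => by
      rw [dd_sub _ (dc πv z hz) (cY z hz w).1, (cY z hz w).2, Dv z hz, hw, Y' z hz]; ring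
  have X' : ∀ z ∈ Ψ.source, deriv S (πt z) * πx z + deriv X (πt z) = dd et (comp πx Ψ) z :=
    fun z hz => by
      have := (hX z hz).2 et
      rw [dd_sub _ (dc πx z hz) (cS z hz et).1, (cS z hz et).2, et1,
        show πx et = 0 from rfl] at this
      linear_combination -this
  let N : NormalData :=
    { T := T, S := S, S₁ := deriv S, X := X, X₁ := deriv X, Y := Y, Y₁ := deriv Y, V := V }
  have dI : ∀ f : ℝ → ℝ, ContDiffOn ℝ ∞ f (πt '' Ψ.source) → ∀ t ∈ πt '' Ψ.source,
      HasDerivAt f (deriv f t) t := fun f hf t ht => (differentiableAt_of_open oI hf ht).hasDerivAt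
  have hN : N.IsOn (πt '' Ψ.source) (πy '' Ψ.source) :=
    { isOpen_left := oI
      isOpen_right := oJ
      convex_left := hW.linear_image πt.toLinearMap
      convex_right := hW.linear_image πy.toLinearMap
      smooth_T := sT
      smooth_S := sS
      smooth_S₁ := contDiffOn_deriv oI sS
      smooth_X := sX
      smooth_X₁ := contDiffOn_deriv oI sX
      smooth_Y := sY
      smooth_Y₁ := sY'
      smooth_V := sV
      deriv_T := by
        rintro _ ⟨z, hz, rfl⟩
        refine (dI T sT _ ⟨z, hz, rfl⟩).congr_deriv ?_
        rw [T' z hz, ← hS z hz]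
      deriv_S := dI S sS
      deriv_X := dI X sX
      deriv_Y := fun y hy => (differentiableAt_of_open oJ sY hy).hasDerivAt
      S_pos := Spos
      Y₁_pos := Ypos }
  refine hN.isContinuousPointSymmetry r (fun z hz => ⟨⟨z, hz, rfl⟩, ⟨z, hz, rfl⟩⟩) fun z hz => ?_
  refine Prod.ext (Prod.ext (hT z hz).1 (Prod.ext ?_ (hY z hz).1)) (Prod.ext ?_ ?_)
  · exact sub_eq_iff_eq_add'.1 (hX z hz).1
  · rw [(hΨ.normalAt hz).value_u, ← X' z hz, ← hS z hz]; rfl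
  · exact sub_eq_iff_eq_add'.1 (hV z hz).1

end BLP

/-! ### Choice and uniqueness of the reflection -/

namespace BLP

theorem exists_sign {α : Type*} [TopologicalSpace α] {C : Set α} (hC : IsPreconnected C)
    {h : α → ℝ} (hh : ContinuousOn h C) (hne : ∀ c ∈ C, h c ≠ 0) :
    ∃ a : ℝ, a * a = 1 ∧ ∀ c ∈ C, 0 < a * h c := by
  rcases C.eq_empty_or_nonempty with rfl | ⟨c₀, hc₀⟩
  · exact ⟨1, one_mul 1, fun c hc => hc.elim⟩
  rcases (hne c₀ hc₀).lt_or_gt with h0 | h0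
  · refine ⟨-1, by norm_num, fun c hc => pos_of_isPreconnected (h := fun c => -1 * h c) hC
      (continuousOn_const.mul hh) (fun c hc => mul_ne_zero (by norm_num) (hne c hc)) hc₀ hc ?_⟩
    linarith
  · exact ⟨1, one_mul 1, fun c hc => by rw [one_mul]; exact pos_of_isPreconnected hC hh hne hc₀ hc h0⟩

variable {Φ : OpenPartialHomeomorph Total Total}

/-- After composition with a reflection, a point symmetry with connected domain preserves the
orientations of the `x`- and `y`-axes. -/
theorem IsPointSymmetry.exists_reflection (hΦ : IsPointSymmetry Φ) (hC : IsPreconnected Φ.source) :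
    ∃ δ ∈ Subgroup.closure {reflX, reflY}, IsPointSymmetry (Φ.transHomeomorph δ⁻¹) ∧
      ∀ z ∈ Φ.source, 0 < dd ex (comp πx (Φ.transHomeomorph δ⁻¹)) z ∧
        0 < dd ey (comp πy (Φ.transHomeomorph δ⁻¹)) z := by
  have hs := fun π w => (contDiffOn_dd Φ.open_source (hΦ.contDiffOn_comp π) w).continuousOn
  obtain ⟨a, ha, hpa⟩ := exists_sign hC (hs πx ex) fun z hz => (hΦ.normalAt hz).σ_ne
  obtain ⟨b, hb, hpb⟩ := exists_sign hC (hs πy ey) fun z hz => (hΦ.normalAt hz).η_ne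
  obtain ⟨ε, hε, hεs⟩ := exists_signMap ha hb
  -- The decomposition Φ = δ ∘ Ψ has Ψ = δ⁻¹ ∘ Φ, so the sign map ε that corrects the orientations
  -- is δ⁻¹.
  refine ⟨ε⁻¹, inv_mem hε, ?_, fun z hz => ?_⟩
  · rw [inv_inv]; exact hΦ.transHomeomorph ha hb hεs
  · rw [inv_inv, (dd_signMap_comp hΦ hεs hz).1, (dd_signMap_comp hΦ hεs hz).2]
    exact ⟨hpa z hz, hpb z hz⟩

theorem eq_of_mul_pos {a a' c : ℝ} (ha : a * a = 1) (ha' : a' * a' = 1) (h : 0 < a * c)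
    (h' : 0 < a' * c) : a = a' := by
  rcases eq_one_or_neg_one ha with rfl | rfl <;> rcases eq_one_or_neg_one ha' with rfl | rfl <;>
    first | rfl | linarith

/-- At a single point the signs of x̃_x and ỹ_y already determine both signs of the reflection. -/
theorem IsPointSymmetry.reflection_unique (hΦ : IsPointSymmetry Φ) {z : Total} (hz : z ∈ Φ.source)
    {δ δ' : Total ≃ₜ Total} (hδ : δ ∈ Subgroup.closure {reflX, reflY})
    (hδ' : δ' ∈ Subgroup.closure {reflX, reflY})
    (h : 0 < dd ex (comp πx (Φ.transHomeomorph δ⁻¹)) z ∧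
      0 < dd ey (comp πy (Φ.transHomeomorph δ⁻¹)) z)
    (h' : 0 < dd ex (comp πx (Φ.transHomeomorph δ'⁻¹)) z ∧
      0 < dd ey (comp πy (Φ.transHomeomorph δ'⁻¹)) z) : δ = δ' := by
  obtain ⟨a, b, ha, hb, hs⟩ := signMap_of_mem_closure (inv_mem hδ)
  obtain ⟨a', b', ha', hb', hs'⟩ := signMap_of_mem_closure (inv_mem hδ')
  rw [(dd_signMap_comp hΦ hs hz).1, (dd_signMap_comp hΦ hs hz).2] at h
  rw [(dd_signMap_comp hΦ hs' hz).1, (dd_signMap_comp hΦ hs' hz).2] at h'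
  have e1 := eq_of_mul_pos ha ha' h.1 h'.1
  have e2 := eq_of_mul_pos hb hb' h.2 h'.2
  apply inv_injective
  ext z : 1
  rw [hs, hs', e1, e2]

/-- A ball inside the domain is convex, so the convex case applies to the restriction. -/
theorem IsPointSymmetry.isContinuous_restr_ball (hΦ : IsPointSymmetry Φ) (r : ℕ∞)
    (hpos : ∀ z ∈ Φ.source, 0 < dd ex (comp πx Φ) z ∧ 0 < dd ey (comp πy Φ) z) {z : Total}
    (hz : z ∈ Φ.source) :
    ∃ W : Set Total, IsOpen W ∧ z ∈ W ∧ IsContinuousPointSymmetry r (Φ.restr W) := by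
  obtain ⟨ρ, hρ, hball⟩ := Metric.isOpen_iff.1 Φ.open_source z hz
  have hsrc : (Φ.restr (Metric.ball z ρ)).source = Metric.ball z ρ := by
    rw [Φ.restr_source, Metric.isOpen_ball.interior_eq, Set.inter_eq_right.2 hball]
  refine ⟨Metric.ball z ρ, Metric.isOpen_ball, Metric.mem_ball_self hρ,
    (hΦ.restr _).isContinuous ?_ (fun z hz => ?_) r⟩
  · rw [hsrc]; exact convex_ball z ρ
  · rw [hsrc] at hz
    exact hpos z (hball hz)

end BLP

/-! ### The classification of discrete point symmetries -/

theorem mainTheorem2 (r : ℕ∞) :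
    -- the two maps are involutions
    (BLP.reflX * BLP.reflX = 1 ∧ BLP.reflY * BLP.reflY = 1) ∧
    -- they are discrete point symmetries, independent modulo continuous ones
    (BLP.IsDiscretePointSymmetry r BLP.reflX.toOpenPartialHomeomorph ∧
      BLP.IsDiscretePointSymmetry r BLP.reflY.toOpenPartialHomeomorph ∧
      BLP.IsDiscretePointSymmetry r (BLP.reflX * BLP.reflY).toOpenPartialHomeomorph) ∧
    -- every point symmetry `Φ` with connected domain is, locally, `δ ∘ Ψ` with a unique `δ` in the
    -- group generated by the two involutions and with continuous point symmetries `Ψ`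
    (∀ Φ : OpenPartialHomeomorph BLP.Total BLP.Total,
      BLP.IsPointSymmetry Φ → IsConnected Φ.source →
      ∃! δ : BLP.Total ≃ₜ BLP.Total,
        δ ∈ Subgroup.closure {BLP.reflX, BLP.reflY} ∧
        ∀ z ∈ Φ.source, ∃ W : Set BLP.Total, IsOpen W ∧ z ∈ W ∧
          BLP.IsContinuousPointSymmetry r ((Φ.transHomeomorph δ⁻¹).restr W)) ∧
    -- and if the domain is convex, `Ψ` can be taken on the whole domain
    (∀ Φ : OpenPartialHomeomorph BLP.Total BLP.Total,
      BLP.IsPointSymmetry Φ → Φ.source.Nonempty → Convex ℝ Φ.source →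
      ∃! δ : BLP.Total ≃ₜ BLP.Total,
        δ ∈ Subgroup.closure {BLP.reflX, BLP.reflY} ∧
        BLP.IsContinuousPointSymmetry r (Φ.transHomeomorph δ⁻¹)) := by
  refine ⟨⟨?_, ?_⟩, ⟨?_, ?_, ?_⟩, fun Φ hΦ hC => ?_, fun Φ hΦ hne hC => ?_⟩
  · ext z : 1
    change BLP.reflX (BLP.reflX z) = z
    simp [BLP.reflX]
  · ext z : 1
    change BLP.reflY (BLP.reflY z) = z
    simp [BLP.reflY]
  · exact BLP.isDiscretePointSymmetry_of_signMap r (a := -1) (b := 1) (by norm_num) (by norm_num)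
      (fun z => by simp [BLP.signMap_apply, BLP.reflX]) (Or.inl rfl)
  · exact BLP.isDiscretePointSymmetry_of_signMap r (a := 1) (b := -1) (by norm_num) (by norm_num)
      (fun z => by simp [BLP.signMap_apply, BLP.reflY]) (Or.inr rfl)
  · refine BLP.isDiscretePointSymmetry_of_signMap r (a := -1) (b := -1) (by norm_num) (by norm_num)
      (fun z => ?_) (Or.inl rfl)
    change BLP.reflX (BLP.reflY z) = _
    simp [BLP.signMap_apply, BLP.reflX, BLP.reflY]
  · obtain ⟨δ, hδ, hsym, hpos⟩ := hΦ.exists_reflection hC.isPreconnected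
    refine ⟨δ, ⟨hδ, fun z hz => hsym.isContinuous_restr_ball r hpos hz⟩, fun δ' hδ' => ?_⟩
    obtain ⟨z, hz⟩ := hC.nonempty
    obtain ⟨W, oW, hzW, hW⟩ := hδ'.2 z hz
    refine hΦ.reflection_unique hz hδ'.1 hδ (hW.dd_pos ?_) (hpos z hz)
    rw [OpenPartialHomeomorph.restr_source, oW.interior_eq]
    exact ⟨hz, hzW⟩
  · obtain ⟨δ, hδ, hsym, hpos⟩ := hΦ.exists_reflection hC.isPreconnected
    refine ⟨δ, ⟨hδ, hsym.isContinuous hC hpos r⟩, fun δ' hδ' => ?_⟩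
    obtain ⟨z, hz⟩ := hne
    exact hΦ.reflection_unique hz hδ'.1 hδ (hδ'.2.dd_pos hz) (hpos z hz)
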